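/- Let $(M,g)$ be a smooth Riemannian manifold of dimension $n\ge 1$, let $H(x,\xi)=|\xi|_g$ on $T^*M$, let $\omega$ be the canonical symplectic form of $T^*M$, and let $G^t$ be the geodesic flow, i.e. the flow of the Hamiltonian vector field of $H$ on $T^*M$ minus the zero section. Let $z\in M$ be a blow-down point with return time $T>0$: for every $\xi$ in the unit cosphere $S^*_zM$, the orbit $G^t(z,\xi)$ exists for $0\le t\le T$, lies over $z$ at $t=T$, and does not lie over $z$ for $0<t<T$. Then $S^*_zM$ is a smooth embedded submanifold of $T^*M$ and $G^T$ restricts to a diffeomorphism $\Phi_z=G^T_z$ of $S^*_zM$ (the first return map). Let $$\mathcal C_T=\bigl(S^*_zM\times[0,T]\bigr)/\sim,\qquad (\xi,T)\sim(\Phi_z(\xi),0),$$ be its mapping cylinder. It is a smooth $n$-dimensional manifold: it has a smooth structure for which the map $q:S^*_zM\times\mathbb R\to\mathcal C_T$ determined by $q(\xi,t)=[\xi,t]$ for $0\le t\le T$ and $q(\xi,t+T)=q(\Phi_z(\xi),t)$ is a local diffeomorphism. Let $\iota_z:\mathcal C_T\to T^*M$, $\iota_z(\xi,t)=G^t(z,\xi)$.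 Then: 1. $\iota_z$ is a Lagrangian embedding, that is, a smooth embedding such that each tangent space of its image is its own $\omega$-orthogonal complement. 2. The image $\Lambda_z=\iota_z(\mathcal C_T)$ is invariant under the geodesic flow: for every $p\in\Lambda_z$ and $t\in\mathbb R$, $G^t(p)$ is defined and lies in $\Lambda_z$. 3. $\Lambda_z$ is an embedded Lagrangian submanifold of $T^*M$, diffeomorphic to $\mathcal C_T$. 4. If $n\le 2$, or if $\Phi_z$ is smoothly isotopic to the identity of $S^*_zM$ (in particular if $\Phi_z=\mathrm{id}$), then $\Lambda_z$ is diffeomorphic to $S^1\times S^{n-1}$. -/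

import Mathlib

open scoped Manifold ContDiff
open Bundle Set

noncomputable section

namespace BlowDown

/-- Smooth Riemannian metrics on a smooth `n`-dimensional manifold `M`. -/
abbrev Metric (n : ℕ) (M : Type*) [TopologicalSpace M] [ChartedSpace (EuclideanSpace ℝ (Fin n)) M]
    [IsManifold (𝓡 n) ∞ M] :=
  ContMDiffRiemannianMetric (𝓡 n) ∞ (EuclideanSpace ℝ (Fin n))
    (fun x : M => TangentSpace (𝓡 n) x)

/-- The cotangent bundle `T*M`: pairs `p = (x, ξ)` with `p.proj = x ∈ M` and
`p.snd = ξ : T_x M → ℝ` linear. -/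
abbrev Cotangent (n : ℕ) (M : Type*) [TopologicalSpace M]
    [ChartedSpace (EuclideanSpace ℝ (Fin n)) M] [IsManifold (𝓡 n) ∞ M] :=
  TotalSpace (EuclideanSpace ℝ (Fin n) →L[ℝ] ℝ)
    (fun x : M => TangentSpace (𝓡 n) x →L[ℝ] Trivial M ℝ x)

/-- The model with corners of `T*M`. -/
abbrev cotangentModel (n : ℕ) :=
  (𝓡 n).prod 𝓘(ℝ, EuclideanSpace ℝ (Fin n) →L[ℝ] ℝ)

section

variable {n : ℕ} {M : Type*} [TopologicalSpace M] [ChartedSpace (EuclideanSpace ℝ (Fin n)) M]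
  [IsManifold (𝓡 n) ∞ M]

/-! ### Symplectic geometry of the cotangent bundle -/

/-- The canonical one-form `α = ξ · dx` of `T*M`: `α_(x,ξ)(v) = ξ(dπ v)`. -/
def canonicalForm (p : Cotangent n M) : TangentSpace (cotangentModel n) p →L[ℝ] ℝ :=
  ContinuousLinearMap.comp (p.snd : TangentSpace (𝓡 n) p.proj →L[ℝ] ℝ)
    (mfderiv (cotangentModel n) (𝓡 n) (fun q : Cotangent n M => q.proj) p)

/-- The canonical one-form, read in the chart of `T*M` around `p`. -/
def canonicalFormInChart (p : Cotangent n M)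
    (y : EuclideanSpace ℝ (Fin n) × (EuclideanSpace ℝ (Fin n) →L[ℝ] ℝ)) :
    (EuclideanSpace ℝ (Fin n) × (EuclideanSpace ℝ (Fin n) →L[ℝ] ℝ)) →L[ℝ] ℝ :=
  ContinuousLinearMap.comp (canonicalForm ((extChartAt (cotangentModel n) p).symm y))
    (mfderiv 𝓘(ℝ, EuclideanSpace ℝ (Fin n) × (EuclideanSpace ℝ (Fin n) →L[ℝ] ℝ))
      (cotangentModel n) (extChartAt (cotangentModel n) p).symm y)

/-- The canonical symplectic form `ω = dα` of `T*M`: in the chart around `p`,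
`dα(v, w) = (D_v α)(w) - (D_w α)(v)`. -/
def symplecticForm (p : Cotangent n M) (v w : TangentSpace (cotangentModel n) p) : ℝ :=
  let D := fderiv ℝ (canonicalFormInChart p) (extChartAt (cotangentModel n) p p)
  let e := mfderiv (cotangentModel n)
    𝓘(ℝ, EuclideanSpace ℝ (Fin n) × (EuclideanSpace ℝ (Fin n) →L[ℝ] ℝ))
    (extChartAt (cotangentModel n) p) p
  D (e v) (e w) - D (e w) (e v)

/-- A map `j : N → T*M` is a Lagrangian embedding if it is a smooth embedding and each tangent
space of the image is equal to its own orthogonal complement for `ω`. -/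
def IsLagrangianEmbedding {E H : Type*} [NormedAddCommGroup E] [NormedSpace ℝ E]
    [TopologicalSpace H] (I : ModelWithCorners ℝ E H) {N : Type*} [TopologicalSpace N]
    [ChartedSpace H N] (j : N → Cotangent n M) : Prop :=
  Manifold.IsSmoothEmbedding I (cotangentModel n) ∞ j ∧
    ∀ (a : N) (v : TangentSpace (cotangentModel n) (j a)),
      (∃ u : TangentSpace I a, mfderiv I (cotangentModel n) j a u = v) ↔
        ∀ u : TangentSpace I a, symplecticForm (j a) v (mfderiv I (cotangentModel n) j a u) = 0

/-! ### The geodesic flow -/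

/-- The Hamiltonian `H(x, ξ) = |ξ|_g`, the norm on `T*_x M` dual to the norm `√g_x(v, v)` on
`T_x M`. -/
def conorm (g : Metric n M) (p : Cotangent n M) : ℝ :=
  sSup {r : ℝ | ∃ v : TangentSpace (𝓡 n) p.proj, g.inner p.proj v v ≤ 1 ∧ p.snd v = r}

open Classical in
/-- The Hamiltonian vector field `X_H` of `H = |ξ|_g`: the vector with `ω(X_H, ·) = -dH`, that is
`ẋ = ∂H/∂ξ`, `ξ̇ = -∂H/∂x` in canonical coordinates. (The value at the zero section, where `H` is
not differentiable, is irrelevant.) -/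
def geodesicField (g : Metric n M) (p : Cotangent n M) : TangentSpace (cotangentModel n) p :=
  if h : ∃ X : TangentSpace (cotangentModel n) p, ∀ w : TangentSpace (cotangentModel n) p,
      symplecticForm p X w = -(mfderiv (cotangentModel n) 𝓘(ℝ, ℝ) (conorm g) p w : ℝ)
  then h.choose else 0

/-- `G^t(p)` is defined: the integral curve of the geodesic vector field that starts at `p` exists
on the interval from `0` to `t` (`t` may be negative). -/
def FlowDefined (g : Metric n M) (t : ℝ) (p : Cotangent n M) : Prop :=
  ∃ γ : ℝ → Cotangent n M, γ 0 = p ∧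
    IsMIntegralCurveOn (I := cotangentModel n) γ (geodesicField g) (uIcc 0 t)

open Classical in
/-- The geodesic flow `G^t`. Where it is not defined the value is irrelevant. -/
def geodesicFlow (g : Metric n M) (t : ℝ) (p : Cotangent n M) : Cotangent n M :=
  if h : FlowDefined g t p then h.choose t else p

theorem geodesicFlow_zero (g : Metric n M) (p : Cotangent n M) : geodesicFlow g 0 p = p := by
  unfold geodesicFlow
  split_ifs with h
  · exact h.choose_spec.1
  · rfl

/-! ### Blow-down points, the mapping cylinder and the map `ι_z` -/

/-- The unit cosphere `S*_z M`, as a subset of `T*M`. -/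
def cosphere (g : Metric n M) (z : M) : Set (Cotangent n M) :=
  {p | p.proj = z ∧ conorm g p = 1}

/-- `z` is a blow-down point with return time `T > 0`: every unit speed geodesic that starts at `z`
exists up to time `T` and returns to `z` for the first time at time `T`. -/
structure IsBlowDownPoint (g : Metric n M) (z : M) (T : ℝ) : Prop where
  pos : 0 < T
  defined : ∀ ξ ∈ cosphere g z, FlowDefined g T ξ
  returns : ∀ ξ ∈ cosphere g z, (geodesicFlow g T ξ).proj = z
  first : ∀ ξ ∈ cosphere g z, ∀ t ∈ Ioo 0 T, (geodesicFlow g t ξ).proj ≠ z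

/-- The mapping cylinder `C_T` of the first return map: the quotient (with the quotient topology)
of `S*_z M × [0, T]` by the identifications `(ξ, T) ∼ (G^T(z, ξ), 0)`. -/
abbrev MappingCylinder (g : Metric n M) (z : M) (T : ℝ) :=
  Quot (fun a b : cosphere g z × Icc (0 : ℝ) T =>
    (a.2 : ℝ) = T ∧ (b.2 : ℝ) = 0 ∧ (b.1 : Cotangent n M) = geodesicFlow g T a.1)

/-- The map `ι_z : C_T → T*M`, `ι_z(ξ, t) = G^t(z, ξ)`. -/
def iota (g : Metric n M) (z : M) (T : ℝ) : MappingCylinder g z T → Cotangent n M :=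
  Quot.lift (fun a => geodesicFlow g a.2 a.1) (by
    rintro a b ⟨ha, hb, h⟩
    simp only [ha, hb, geodesicFlow_zero, h])

/-- The image `Λ_z` of `ι_z`. -/
def blowDownLagrangian (g : Metric n M) (z : M) (T : ℝ) : Set (Cotangent n M) :=
  range (iota g z T)

end

/-- The diffeomorphism `Φ` of `S` is smoothly isotopic to the identity. (The parameter runs over
`ℝ`; an isotopy over `[0, 1]` becomes one over `ℝ` after a reparametrization that makes it constant
near both ends.) -/
def IsIsotopicToId {m : ℕ} {S : Type*} [TopologicalSpace S]
    [ChartedSpace (EuclideanSpace ℝ (Fin m)) S] (Φ : S ≃ₘ⟮𝓡 m, 𝓡 m⟯ S) : Prop :=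
  ∃ F : ℝ → (S ≃ₘ⟮𝓡 m, 𝓡 m⟯ S),
    ContMDiff (𝓘(ℝ, ℝ).prod (𝓡 m)) (𝓡 m) ∞ (fun a : ℝ × S => F a.1 a.2) ∧
      (∀ ξ, F 0 ξ = ξ) ∧ ∀ ξ, F 1 ξ = Φ ξ

end BlowDown

end

open scoped Manifold ContDiff
open Bundle Set

noncomputable section

/-! The geodesics leaving `z` return to `z` at time `T`, hence can be concatenated: the curve
starting at `ξ` continues with initial covector `Φ ξ`, then `Φ² ξ`, and so on, where `Φ` is the
return map. Time reversal `R (x, ξ) = (x, -ξ)` turns geodesics into geodesics, which gives `Φ ∘ R ∘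
Φ = R`; so `Φ` is bijective with inverse `R ∘ Φ ∘ R`, and the geodesics from `z` exist for all
positive and negative times. This yields a map `sweep : S*_z M × ℝ → T*M`, `(ξ, t) ↦ G^t ξ`, whose
image is invariant under the flow.

Two points have the same image under `sweep` exactly when they differ by a power of `(ξ, t) ↦ (Φ ξ,
t - T)`, because by the first-return condition a geodesic from `z` lies over `z` only at multiples
of `T` (`geodesic_eq_geodesic_iff`). So `sweep` factors through an injective map of the mapping
cylinder, namely `iota`, which is an embedding since the cylinder is compact and `T*M` is Hausdorff.

The map `sweep` is an isotropic immersion (`isIsotropicImmersionAt_sweep`). At `t = 0` the tangent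
space of the image is spanned by the tangent space of the cosphere and the Hamiltonian field `X`.
The cosphere is vertical, hence isotropic, and lies in the level set `H = 1`, hence is orthogonal to
`X`; by Euler's identity for the homogeneous function `H`, the field `X` is not vertical. The
geodesic flow is symplectic, so the property spreads to all times. An isotropic submanifold of
dimension `n` in dimension `2n` is Lagrangian.

An isotopy from the identity to `Φ` trivializes the mapping torus: the explicit map `trivialization`
to the circle times the cosphere has the same fibres as the unrolling map. For `n ≤ 2` such an
isotopy always exists, because `Φ ξ ≠ -ξ`: a geodesic that returned with the opposite covector would
coincide with its own reversal at time `T / 2`. A diffeomorphism of a circle or of two points that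
moves no point to its antipode is isotopic to the identity.

The analysis underneath is the smooth dependence of solutions of differential equations on time and
initial value (`exists_contDiffOn_localFlow`), obtained from the inverse function theorem on a space
of curves. -/

namespace BlowDown

/-! ### Smoothness of composition operators on spaces of continuous maps -/

section Superposition

set_option synthInstance.maxHeartbeats 200000

open Topology

universe u

variable {K : Type*} [TopologicalSpace K] [CompactSpace K]

/-- Pointwise application of a bilinear map to two continuous families of vectors. -/
def pointwiseBilin (K : Type*) [TopologicalSpace K] [CompactSpace K] {G E F : Type*}
    [NormedAddCommGroup G] [NormedSpace ℝ G]
    [NormedAddCommGroup E] [NormedSpace ℝ E] [NormedAddCommGroup F] [NormedSpace ℝ F]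
    (b : G →L[ℝ] E →L[ℝ] F) : C(K, G) →L[ℝ] C(K, E) →L[ℝ] C(K, F) :=
  LinearMap.mkContinuous₂
    (LinearMap.mk₂ ℝ (fun (A : C(K, G)) (h : C(K, E)) =>
        (⟨fun k => b (A k) (h k), by fun_prop⟩ : C(K, F)))
      (by intros; ext; simp) (by intros; ext; simp) (by intros; ext; simp)
      (by intros; ext; simp)) ‖b‖ (by
    intro A h
    rw [ContinuousMap.norm_le _ (by positivity)]
    intro k
    exact (b.le_opNorm₂ _ _).trans (by
      gcongr
      · exact ContinuousMap.norm_coe_le_norm A k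
      · exact ContinuousMap.norm_coe_le_norm h k))

/-- Pointwise application of a continuous family of operators to a continuous family of vectors. -/
def pointwiseApply (K : Type*) [TopologicalSpace K] [CompactSpace K] (E F : Type*)
    [NormedAddCommGroup E] [NormedSpace ℝ E] [NormedAddCommGroup F] [NormedSpace ℝ F] :
    C(K, E →L[ℝ] F) →L[ℝ] C(K, E) →L[ℝ] C(K, F) :=
  pointwiseBilin K (ContinuousLinearMap.id ℝ (E →L[ℝ] F))

/-- The mean value inequality on the segment from `γ k` to `γ k + h k` bounds the remainder by the
oscillation of `f'` along it. The bound is uniform in `k` because `γ ↦ f' ∘ γ` is continuous for the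
sup norm, `K` being compact. -/
theorem hasFDerivAt_postcomp {E F : Type*}
    [NormedAddCommGroup E] [NormedSpace ℝ E] [NormedAddCommGroup F] [NormedSpace ℝ F]
    (f : C(E, F)) (f' : C(E, E →L[ℝ] F)) (hf : ∀ x, HasFDerivAt f (f' x) x) (γ : C(K, E)) :
    HasFDerivAt (fun γ : C(K, E) => f.comp γ) (pointwiseApply K E F (f'.comp γ)) γ := by
  rw [hasFDerivAt_iff_isLittleO_nhds_zero, Asymptotics.isLittleO_iff]
  intro c hc
  have hcont : Continuous fun γ : C(K, E) => f'.comp γ := f'.continuous_postcomp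
  obtain ⟨δ, hδ, hball⟩ := (Metric.continuousAt_iff (α := C(K, E)) (β := C(K, E →L[ℝ] F))).1
    (hcont.continuousAt (x := γ)) c hc
  filter_upwards [Metric.ball_mem_nhds (0 : C(K, E)) hδ] with h hh
  rw [ContinuousMap.norm_le _ (by positivity)]
  intro k
  have key := Convex.norm_image_sub_le_of_norm_hasFDerivWithin_le' (𝕜 := ℝ) (f := f) (f' := f')
    (s := segment ℝ (γ k) (γ k + h k)) (x := γ k) (y := γ k + h k) (φ := f' (γ k)) (C := c)
    (fun x _ => (hf x).hasFDerivWithinAt) ?_ (convex_segment _ _) (left_mem_segment _ _ _)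
    (right_mem_segment _ _ _)
  · simp only [add_sub_cancel_left] at key
    exact key.trans (mul_le_mul_of_nonneg_left (h.norm_coe_le_norm k) hc.le)
  · intro x hx
    rw [segment_eq_image'] at hx
    obtain ⟨s, hs, rfl⟩ := hx
    have h1 : dist (γ + s • h) γ < δ := by
      rw [dist_eq_norm, add_sub_cancel_left, norm_smul, Real.norm_of_nonneg hs.1]
      rw [mem_ball_zero_iff] at hh
      exact lt_of_le_of_lt (mul_le_of_le_one_left (norm_nonneg _) hs.2) hh
    have h2 := hball h1
    have h3 := (ContinuousMap.dist_apply_le_dist (f := f'.comp (γ + s • h)) (g := f'.comp γ) k).trans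
      h2.le
    rw [dist_eq_norm] at h3
    simpa using h3

/-- The derivative of the composition operator of `f` is a bounded linear image of the composition
operator of `f'`, so smoothness follows by induction. The induction replaces `F` by `E →L[ℝ] F`,
hence `F` is quantified after `n` and both spaces lie in one universe. -/
theorem contDiff_postcomp_nat {E : Type u} [NormedAddCommGroup E] [NormedSpace ℝ E] (n : ℕ) :
    ∀ {F : Type u} [NormedAddCommGroup F] [NormedSpace ℝ F] (f : C(E, F)),
      ContDiff ℝ n f → ContDiff ℝ n (fun γ : C(K, E) => f.comp γ) := by
  induction n with
  | zero =>
    intro F _ _ f _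
    exact contDiff_zero.2 f.continuous_postcomp
  | succ n ih =>
    intro F _ _ f hf
    obtain ⟨f', hf', hd⟩ := contDiff_succ_iff_hasFDerivAt.1 (by exact_mod_cast hf)
    refine contDiff_succ_iff_hasFDerivAt.2
      ⟨fun γ => pointwiseApply K E F ((⟨f', hf'.continuous⟩ : C(E, E →L[ℝ] F)).comp γ), ?_,
        fun γ => hasFDerivAt_postcomp f ⟨f', hf'.continuous⟩ hd γ⟩
    exact (pointwiseApply K E F).contDiff.comp (ih ⟨f', hf'.continuous⟩ hf')

theorem contDiff_postcomp {E F : Type u} [NormedAddCommGroup E] [NormedSpace ℝ E]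
    [NormedAddCommGroup F] [NormedSpace ℝ F] (f : C(E, F)) (hf : ContDiff ℝ ∞ f) :
    ContDiff ℝ ∞ (fun γ : C(K, E) => f.comp γ) :=
  contDiff_infty.2 fun n => contDiff_postcomp_nat n f (contDiff_infty.1 hf n)

end Superposition

/-! ### Smooth local flows of vector fields in a Banach space -/

section LocalFlow

open Topology unitInterval

variable {E : Type*} [NormedAddCommGroup E] [NormedSpace ℝ E] [CompleteSpace E]

/-- The primitive `s ↦ ∫₀ˢ γ` of a continuous curve on the unit interval. -/
def primitive (E : Type*) [NormedAddCommGroup E] [NormedSpace ℝ E] [CompleteSpace E] :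
    C(I, E) →L[ℝ] C(I, E) :=
  LinearMap.mkContinuous
    { toFun := fun γ => ⟨fun s => ∫ r in (0 : ℝ)..s, γ (projIcc 0 1 zero_le_one r), by
        have h : Continuous fun s : ℝ => ∫ r in (0 : ℝ)..s, γ (projIcc 0 1 zero_le_one r) :=
          intervalIntegral.continuous_primitive
            (fun a b => (γ.continuous.comp continuous_projIcc).intervalIntegrable a b) 0
        exact h.comp continuous_subtype_val⟩
      map_add' := fun γ η => by
        ext s
        exact intervalIntegral.integral_add
          ((γ.continuous.comp continuous_projIcc).intervalIntegrable _ _)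
          ((η.continuous.comp continuous_projIcc).intervalIntegrable _ _)
      map_smul' := fun c γ => by
        ext s
        exact intervalIntegral.integral_smul _ _ } 1 (by
    intro γ
    rw [ContinuousMap.norm_le _ (by positivity)]
    intro s
    refine (intervalIntegral.norm_integral_le_of_norm_le_const
      (C := ‖γ‖) fun r _ => γ.norm_coe_le_norm _).trans ?_
    rw [sub_zero, abs_of_nonneg s.2.1, one_mul]
    exact mul_le_of_le_one_right (norm_nonneg _) s.2.2)

theorem primitive_apply (γ : C(I, E)) (s : I) :
    primitive E γ s = ∫ r in (0 : ℝ)..s, γ (projIcc 0 1 zero_le_one r) := rfl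

/-- Constant curves. -/
def constCurve (E : Type*) [NormedAddCommGroup E] [NormedSpace ℝ E] : E →L[ℝ] C(I, E) :=
  LinearMap.mkContinuous
    { toFun := fun x => ContinuousMap.const I x
      map_add' := fun _ _ => rfl
      map_smul' := fun _ _ => rfl } 1 (by
    intro x
    rw [ContinuousMap.norm_le _ (by positivity)]
    intro s
    exact (one_mul ‖x‖).ge)

/-- The map whose zeros in the last component are the solutions of the rescaled differential
equation `γ' = t f(γ)`, `γ(0) = x`. -/
def integralEquation (f : C(E, E)) (p : E × ℝ × C(I, E)) : E × ℝ × C(I, E) :=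
  (p.1, p.2.1, p.2.2 - constCurve E p.1 - p.2.1 • primitive E (f.comp p.2.2))

theorem contDiff_integralEquation (f : C(E, E)) (hf : ContDiff ℝ ∞ f) :
    ContDiff ℝ ∞ (integralEquation f) := by
  have h := (contDiff_postcomp (K := I) f hf).comp
    (contDiff_snd.comp contDiff_snd : ContDiff ℝ ∞ fun p : E × ℝ × C(I, E) => p.2.2)
  have h2 := (primitive E).contDiff.comp h
  have h3 := (constCurve E).contDiff.comp (contDiff_fst : ContDiff ℝ ∞ fun p : E × ℝ × C(I, E) => p.1)
  exact contDiff_fst.prodMk ((contDiff_fst.comp contDiff_snd).prodMk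
    (((contDiff_snd.comp contDiff_snd).sub h3).sub ((contDiff_fst.comp contDiff_snd).smul h2)))

/-- At `t = 0` the derivative of `t ∫ f(γ)` in the direction of `γ` vanishes. The total derivative
is therefore triangular with identities on the diagonal, and its inverse `B` is `A` with the
off-diagonal signs changed. -/
theorem hasFDerivAt_integralEquation (f : C(E, E)) (hf : ContDiff ℝ ∞ f) (x : E) :
    ∃ L : (E × ℝ × C(I, E)) ≃L[ℝ] (E × ℝ × C(I, E)),
      HasFDerivAt (integralEquation f) (L : (E × ℝ × C(I, E)) →L[ℝ] (E × ℝ × C(I, E)))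
        (x, 0, constCurve E x) := by
  let c : C(I, E) := primitive E (f.comp (constCurve E x))
  let π₁ := ContinuousLinearMap.fst ℝ E (ℝ × C(I, E))
  let π₂ := (ContinuousLinearMap.fst ℝ ℝ C(I, E)).comp (ContinuousLinearMap.snd ℝ E (ℝ × C(I, E)))
  let π₃ := (ContinuousLinearMap.snd ℝ ℝ C(I, E)).comp (ContinuousLinearMap.snd ℝ E (ℝ × C(I, E)))
  let A : (E × ℝ × C(I, E)) →L[ℝ] (E × ℝ × C(I, E)) :=
    π₁.prod (π₂.prod (π₃ - (constCurve E).comp π₁ - π₂.smulRight c))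
  let B : (E × ℝ × C(I, E)) →L[ℝ] (E × ℝ × C(I, E)) :=
    π₁.prod (π₂.prod (π₃ + (constCurve E).comp π₁ + π₂.smulRight c))
  refine ⟨ContinuousLinearEquiv.equivOfInverse A B (fun p => ?_) (fun p => ?_), ?_⟩
  · refine Prod.ext rfl (Prod.ext rfl ?_)
    change p.2.2 - constCurve E p.1 - p.2.1 • c + constCurve E p.1 + p.2.1 • c = p.2.2
    abel
  · refine Prod.ext rfl (Prod.ext rfl ?_)
    change p.2.2 + constCurve E p.1 + p.2.1 • c - constCurve E p.1 - p.2.1 • c = p.2.2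
    abel
  · have hd : HasFDerivAt (fun p : E × ℝ × C(I, E) => primitive E (f.comp p.2.2))
        (fderiv ℝ (fun p : E × ℝ × C(I, E) => primitive E (f.comp p.2.2)) (x, 0, constCurve E x))
        (x, 0, constCurve E x) := by
      have h := (contDiff_postcomp (K := I) f hf).comp
        (contDiff_snd.comp contDiff_snd : ContDiff ℝ ∞ fun p : E × ℝ × C(I, E) => p.2.2)
      exact (((primitive E).contDiff.comp h).differentiable (by simp) _).hasFDerivAt
    have h2 : HasFDerivAt (fun p : E × ℝ × C(I, E) => p.2.1) π₂ (x, 0, constCurve E x) :=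
      π₂.hasFDerivAt
    have h1 : HasFDerivAt (fun p : E × ℝ × C(I, E) => p.1) π₁ (x, 0, constCurve E x) :=
      π₁.hasFDerivAt
    have h3 : HasFDerivAt (fun p : E × ℝ × C(I, E) => p.2.2) π₃ (x, 0, constCurve E x) :=
      π₃.hasFDerivAt
    have hs := h2.smul hd
    simp only [zero_smul, zero_add] at hs
    exact h1.prodMk (h2.prodMk ((h3.sub ((constCurve E).hasFDerivAt.comp _ h1)).sub hs))

/-- The flow of a smooth vector field is smooth in the time and the initial value. -/
theorem exists_contDiffOn_localFlow (f : E → E) (hf : ContDiff ℝ ∞ f) (x₀ : E)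
    {U : Set E} (hU : U ∈ 𝓝 x₀) :
    ∃ ε > 0, ∃ B : Set E, IsOpen B ∧ x₀ ∈ B ∧ ∃ φ : ℝ → E → E,
      ContDiffOn ℝ ∞ (fun p : ℝ × E => φ p.1 p.2) (Ioo (-ε) ε ×ˢ B) ∧
      ∀ y ∈ B, φ 0 y = y ∧ ∀ t ∈ Ioo (-ε) ε, φ t y ∈ U ∧
        HasDerivAt (fun s => φ s y) (f (φ t y)) t := by
  -- Picard–Lindelöf provides solutions `α` that are jointly continuous in the initial value and the
  -- time. Their smoothness will come from the local inverse of `integralEquation`.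
  obtain ⟨ε, hε, a, r, Λ, K, hr, hpl⟩ := IsPicardLindelof.of_contDiffAt_one
    ((hf.of_le (by simp)).contDiffAt (x := x₀))
  obtain ⟨α, hα, hαc⟩ :=
    (hpl 0).exists_forall_mem_closedBall_eq_hasDerivWithinAt_continuousOn
  simp only [zero_sub, zero_add] at hα hαc
  have hr' : (0 : ℝ) < r := hr
  let fc : C(E, E) := ⟨f, hf.continuous⟩
  obtain ⟨L, hL⟩ := hasFDerivAt_integralEquation fc hf x₀
  have hS := contDiff_integralEquation fc hf
  let e := hS.contDiffAt.toOpenPartialHomeomorph (integralEquation fc) hL (by simp)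
  have he : ∀ p, e p = integralEquation fc p := fun p => rfl
  have hp₀ : (x₀, (0 : ℝ), constCurve E x₀) ∈ e.source :=
    hS.contDiffAt.mem_toOpenPartialHomeomorph_source hL (by simp)
  -- the points where the derivative is invertible
  let O : Set (E × ℝ × C(I, E)) := e.source ∩ {p | fderiv ℝ (integralEquation fc) p ∈
    range (ContinuousLinearEquiv.toContinuousLinearMap (R₁ := ℝ) (σ₁₂ := RingHom.id ℝ)
      (M₁ := E × ℝ × C(I, E)) (M₂ := E × ℝ × C(I, E)))}
  have hO : IsOpen O := e.open_source.inter
    (ContinuousLinearEquiv.isOpen.preimage (hS.continuous_fderiv (by simp)))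
  have hO₀ : (x₀, (0 : ℝ), constCurve E x₀) ∈ O := ⟨hp₀, L, hL.fderiv.symm⟩
  have hsymm : ∀ p ∈ O, ContDiffAt ℝ ∞ e.symm (e p) := by
    rintro p ⟨hp, L', hL'⟩
    refine e.contDiffAt_symm (f₀' := L') (e.map_source hp) ?_ ?_
    · rw [e.left_inv hp, hL']
      exact ((hS.differentiable (by simp)) p).hasFDerivAt
    · exact hS.contDiffAt
  obtain ⟨ρ, hρ, hball⟩ := Metric.isOpen_iff.1 hO _ hO₀
  -- shrink the domain so that all curves stay close to the centre
  have hα0 : α (x₀, 0) = x₀ := (hα x₀ (Metric.mem_closedBall_self r.2)).1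
  have hnhds : (Metric.closedBall x₀ r ×ˢ Icc (-ε) ε) ∈ 𝓝 (x₀, (0 : ℝ)) :=
    prod_mem_nhds (Metric.closedBall_mem_nhds _ hr') (Icc_mem_nhds (by linarith) hε)
  have hαa : ContinuousAt α (x₀, 0) := hαc.continuousAt hnhds
  -- Half of `ρ` is used because a pointwise strict bound only gives a weak bound for the sup
  -- distance of curves.
  have hev : ∀ᶠ p in 𝓝 (x₀, (0 : ℝ)), α p ∈ Metric.ball x₀ (ρ / 2) ∩ U :=
    hαa.eventually (by
      rw [hα0]
      exact Filter.inter_mem (Metric.ball_mem_nhds _ (by positivity)) hU)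
  obtain ⟨δ, hδ, hδb⟩ := Metric.eventually_nhds_iff_ball.1
    (hev.and (Filter.eventually_of_mem hnhds fun _ h => h))
  let δ' := min δ ρ
  have hδ' : 0 < δ' := lt_min hδ hρ
  have hmem : ∀ y ∈ Metric.ball x₀ δ', ∀ t ∈ Ioo (-δ') δ',
      (y, t) ∈ Metric.ball (x₀, (0 : ℝ)) δ := by
    intro y hy t ht
    rw [← ball_prod_same]
    refine ⟨Metric.ball_subset_ball (min_le_left _ _) hy, ?_⟩
    rw [mem_ball_zero_iff, Real.norm_eq_abs, abs_lt]
    exact ⟨(neg_le_neg (min_le_left _ _)).trans_lt ht.1, ht.2.trans_le (min_le_left _ _)⟩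
  have hder : ∀ y ∈ Metric.ball x₀ δ', ∀ t ∈ Ioo (-δ') δ',
      HasDerivAt (fun s => α (y, s)) (f (α (y, t))) t := by
    intro y hy t ht
    have hin : ∀ s ∈ Ioo (-δ') δ', (y, s) ∈ Metric.closedBall x₀ r ×ˢ Icc (-ε) ε :=
      fun s hs => (hδb _ (hmem y hy s hs)).2
    refine ((hα y (hin t ht).1).2 t (hin t ht).2).hasDerivAt ?_
    exact Filter.mem_of_superset (Ioo_mem_nhds ht.1 ht.2) fun s hs => (hin s hs).2
  -- the curve on the unit interval
  have hscale : ∀ t ∈ Ioo (-δ') δ', ∀ s : ℝ, s ∈ Icc (0 : ℝ) 1 → t * s ∈ Ioo (-δ') δ' := by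
    intro t ht s hs
    rw [mem_Ioo, ← abs_lt] at ht ⊢
    rw [abs_mul, abs_of_nonneg hs.1]
    exact (mul_le_of_le_one_right (abs_nonneg _) hs.2).trans_lt ht
  have hcurve : ∀ y ∈ Metric.ball x₀ δ', ∀ t ∈ Ioo (-δ') δ', ∃ c : C(I, E),
      (∀ s : I, c s = α (y, t * s)) ∧ integralEquation fc (y, t, c) = (y, t, 0) ∧
        (y, t, c) ∈ O := by
    intro y hy t ht
    have hcont : Continuous fun s : I => α (y, t * s) := by
      rw [continuous_iff_continuousAt]
      intro s
      have h1 := (hder y hy (t * s) (hscale t ht s s.2)).continuousAt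
      exact ContinuousAt.comp (f := fun s : I => t * (s : ℝ)) (g := fun r => α (y, r)) h1
        (by fun_prop)
    refine ⟨⟨fun s => α (y, t * s), hcont⟩, fun s => rfl, ?_, hball ?_⟩
    · refine Prod.ext rfl (Prod.ext rfl ?_)
      ext s
      change α (y, t * s) - y - t • primitive E _ s = 0
      rw [primitive_apply, ← intervalIntegral.integral_smul]
      have hint : ∫ r in (0 : ℝ)..s, t • f (α (y, t * (projIcc (0 : ℝ) 1 zero_le_one r : ℝ)))
          = α (y, t * s) - α (y, t * 0) := by
        refine intervalIntegral.integral_eq_sub_of_hasDerivAt_of_le (f := fun r => α (y, t * r)) s.2.1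
          ?_ (fun r hr => ?_) ?_
        · intro r hr
          have h1 := (hder y hy (t * r) (hscale t ht r ⟨hr.1, hr.2.trans s.2.2⟩)).continuousAt
          exact (ContinuousAt.comp (f := fun r : ℝ => t * r) (g := fun r => α (y, r)) h1
            (by fun_prop)).continuousWithinAt
        · have hr' : r ∈ Icc (0 : ℝ) 1 := ⟨hr.1.le, hr.2.le.trans s.2.2⟩
          rw [projIcc_of_mem zero_le_one hr']
          have h1 := (hder y hy (t * r) (hscale t ht r hr'))
          have h2 : HasDerivAt (fun r : ℝ => t * r) t r := by
            simpa using (hasDerivAt_id r).const_mul t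
          exact h1.scomp r h2
        · have h3 : Continuous fun r : ℝ =>
              t • f (α (y, t * (projIcc (0 : ℝ) 1 zero_le_one r : ℝ))) :=
            (hf.continuous.comp (hcont.comp continuous_projIcc)).const_smul t
          exact h3.intervalIntegrable _ _
      have hy0 : α (y, 0) = y := by
        have := (hδb _ (hmem y hy 0 ⟨by linarith, hδ'⟩)).2.1
        exact (hα y this).1
      rw [mul_zero, hy0] at hint
      rw [sub_eq_zero]
      exact hint.symm
    · rw [← ball_prod_same, ← ball_prod_same]
      refine ⟨Metric.ball_subset_ball (min_le_right _ _) hy, ?_, ?_⟩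
      · rw [mem_ball_zero_iff, Real.norm_eq_abs, abs_lt]
        exact ⟨(neg_le_neg (min_le_right _ _)).trans_lt ht.1, ht.2.trans_le (min_le_right _ _)⟩
      · rw [Metric.mem_ball]
        refine lt_of_le_of_lt ((ContinuousMap.dist_le (by positivity : (0 : ℝ) ≤ ρ / 2)).2
          fun s => ?_) (half_lt_self hρ)
        exact (Metric.mem_ball.1 (hδb _ (hmem y hy _ (hscale t ht s s.2))).1.1).le
  refine ⟨δ', hδ', Metric.ball x₀ δ', Metric.isOpen_ball, Metric.mem_ball_self hδ',
    fun t y => α (y, t), ?_, fun y hy => ⟨?_, fun t ht => ⟨?_, hder y hy t ht⟩⟩⟩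
  -- The rescaled solution `s ↦ α (y, t s)` solves the integral equation and lies in the domain of
  -- the local inverse, so it is the curve component of `e.symm (y, t, 0)`. Its value at `s = 1` is
  -- `α (y, t)`.
  · have hsm : ContDiffOn ℝ ∞
        (fun p : ℝ × E => (e.symm (p.2, p.1, (0 : C(I, E)))).2.2 1) (Ioo (-δ') δ' ×ˢ
          Metric.ball x₀ δ') := by
      rintro ⟨t, y⟩ ⟨ht, hy⟩
      obtain ⟨c, -, hc2, hc3⟩ := hcurve y hy t ht
      have h1 := hsymm _ hc3
      rw [he, hc2] at h1
      have h2 : ContDiffAt ℝ ∞ (fun p : ℝ × E => (p.2, p.1, (0 : C(I, E)))) (t, y) :=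
        contDiffAt_snd.prodMk (contDiffAt_fst.prodMk contDiffAt_const)
      have h3 := ContDiffAt.comp (t, y) (f := fun p : ℝ × E => (p.2, p.1, (0 : C(I, E)))) h1 h2
      exact ((ContinuousMap.evalCLM ℝ (1 : I)).contDiff.contDiffAt.comp _
        (contDiffAt_snd.comp _ (contDiffAt_snd.comp _ h3))).contDiffWithinAt
    refine hsm.congr ?_
    rintro ⟨t, y⟩ ⟨ht, hy⟩
    obtain ⟨c, hc1, hc2, hc3⟩ := hcurve y hy t ht
    have h1 : e.symm (y, t, (0 : C(I, E))) = (y, t, c) := by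
      rw [← hc2, ← he]
      exact e.left_inv hc3.1
    change α (y, t) = (e.symm (y, t, (0 : C(I, E)))).2.2 1
    rw [h1]
    change α (y, t) = c 1
    rw [hc1]
    simp
  · exact (hα y (hδb _ (hmem y hy 0 ⟨by linarith, hδ'⟩)).2.1).1
  · exact (hδb _ (hmem y hy t ht)).1.2

end LocalFlow

/-! ### Inverse function theorem, immersions and quotient structures on manifolds -/

section InverseFunction

open Topology

variable {E F : Type*} [NormedAddCommGroup E] [NormedSpace ℝ E] [NormedAddCommGroup F]
  [NormedSpace ℝ F]

/-- The local inverse is known to be smooth only at images of points with invertible derivative.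
Invertibility is an open condition, so restricting to `O` makes the inverse smooth on its whole
domain. -/
theorem isLocalDiffeomorphAt_of_hasFDerivAt [CompleteSpace E] {f : E → F} {U : Set E}
    (hU : IsOpen U) (hf : ContDiffOn ℝ ∞ f U) {x : E} (hx : x ∈ U) (L : E ≃L[ℝ] F)
    (hL : HasFDerivAt f (L : E →L[ℝ] F) x) :
    IsLocalDiffeomorphAt 𝓘(ℝ, E) 𝓘(ℝ, F) ∞ f x := by
  have hfx : ContDiffAt ℝ ∞ f x := hf.contDiffAt (hU.mem_nhds hx)
  let e := hfx.toOpenPartialHomeomorph f hL (by simp)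
  let O : Set E := U ∩ fderiv ℝ f ⁻¹' range
    (ContinuousLinearEquiv.toContinuousLinearMap (R₁ := ℝ) (σ₁₂ := RingHom.id ℝ)
      (M₁ := E) (M₂ := F))
  have hO : IsOpen O := (hf.continuousOn_fderiv_of_isOpen hU (by simp)).isOpen_inter_preimage hU
    ContinuousLinearEquiv.isOpen
  let e' := e.restrOpen O hO
  refine ⟨⟨e'.toPartialEquiv, e'.open_source, e'.open_target, ?_, ?_⟩, ?_, fun y _ => rfl⟩
  · rw [contMDiffOn_iff_contDiffOn]
    exact hf.mono fun y hy => (e.restrOpen_source O hO ▸ hy).2.1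
  · rw [contMDiffOn_iff_contDiffOn]
    intro y hy
    have hy' := e'.map_target hy
    rw [e.restrOpen_source O hO] at hy'
    obtain ⟨hy1, hy2, L', hL'⟩ := hy'
    have hyt : y ∈ e.target := by
      have := e.map_source hy1
      rwa [show e (e'.symm y) = y from e'.right_inv hy] at this
    have hC : ContDiffAt ℝ ∞ f (e'.symm y) := hf.contDiffAt (hU.mem_nhds hy2)
    refine (e.contDiffAt_symm (f₀' := L') hyt ?_ hC).contDiffWithinAt
    rw [hL']
    exact (hC.differentiableAt (by simp)).hasFDerivAt
  · change x ∈ e'.source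
    rw [e.restrOpen_source O hO]
    exact ⟨hfx.mem_toOpenPartialHomeomorph_source hL (by simp), hx, L, hL.fderiv.symm⟩

variable {H G : Type*} [TopologicalSpace H] [TopologicalSpace G]
  {I : ModelWithCorners ℝ E H} {J : ModelWithCorners ℝ F G}
  {N : Type*} [TopologicalSpace N] [ChartedSpace H N]
  {P : Type*} [TopologicalSpace P] [ChartedSpace G P]

theorem IsLocalDiffeomorphAt.congr {f g : N → P} {x : N}
    (hf : IsLocalDiffeomorphAt I J ∞ f x) (h : f =ᶠ[𝓝 x] g) :
    IsLocalDiffeomorphAt I J ∞ g x := by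
  obtain ⟨Φ, hx, hΦ⟩ := hf
  obtain ⟨O, hO, hOo, hxO⟩ := mem_nhds_iff.1 h
  let e' := Φ.toOpenPartialHomeomorph.restrOpen O hOo
  have hs : e'.source ⊆ Φ.source := fun y hy => hy.1
  have ht : e'.target ⊆ Φ.target := fun y hy => hy.1
  refine ⟨⟨e'.toPartialEquiv, e'.open_source, e'.open_target, Φ.contMDiffOn_toFun.mono hs,
    Φ.contMDiffOn_invFun.mono ht⟩, ⟨hx, hxO⟩, fun y hy => ?_⟩
  exact (hO hy.2).symm.trans (hΦ hy.1)

/-- The extended chart as a partial diffeomorphism. -/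
def extChartPartialDiffeomorph (I : ModelWithCorners ℝ E H) [I.Boundaryless] [IsManifold I ∞ N]
    (x : N) : PartialDiffeomorph I 𝓘(ℝ, E) N E ∞ where
  toPartialEquiv := extChartAt I x
  open_source := isOpen_extChartAt_source x
  open_target := isOpen_extChartAt_target x
  contMDiffOn_toFun := by
    have h := contMDiffOn_extChartAt (I := I) (n := ∞) (x := x)
    rwa [← extChartAt_source I] at h
  contMDiffOn_invFun := contMDiffOn_extChartAt_symm x

/-- The inverse of a boundaryless model as a partial diffeomorphism. -/
def modelSymmPartialDiffeomorph (I : ModelWithCorners ℝ E H) [I.Boundaryless] :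
    PartialDiffeomorph 𝓘(ℝ, E) I E H ∞ where
  toPartialEquiv := I.toHomeomorph.symm.toPartialEquiv
  open_source := isOpen_univ
  open_target := isOpen_univ
  contMDiffOn_toFun := by
    have h := I.contMDiffOn_symm (n := ∞)
    rwa [I.range_eq_univ] at h
  contMDiffOn_invFun := I.contMDiff.contMDiffOn

/-- The written-in-charts representative of a smooth map. -/
theorem contDiffOn_writtenInExtChartAt [I.Boundaryless] [J.Boundaryless] [IsManifold I ∞ N]
    [IsManifold J ∞ P] {f : N → P} {U : Set N} (hU : IsOpen U) (hf : ContMDiffOn I J ∞ f U)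
    {x : N} (hx : x ∈ U) :
    ∃ V : Set E, IsOpen V ∧ extChartAt I x x ∈ V ∧ V ⊆ (extChartAt I x).target ∧
      (∀ u ∈ V, (extChartAt I x).symm u ∈ U) ∧
      (∀ u ∈ V, f ((extChartAt I x).symm u) ∈ (extChartAt J (f x)).source) ∧
      ContDiffOn ℝ ∞ (writtenInExtChartAt I J x f) V := by
  have hW : IsOpen (U ∩ f ⁻¹' (extChartAt J (f x)).source) :=
    hf.continuousOn.isOpen_inter_preimage hU (isOpen_extChartAt_source (f x))
  refine ⟨(extChartAt I x).target ∩ (extChartAt I x).symm ⁻¹'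
      (U ∩ f ⁻¹' (extChartAt J (f x)).source),
    (continuousOn_extChartAt_symm x).isOpen_inter_preimage (isOpen_extChartAt_target x) hW,
    ⟨mem_extChartAt_target x, ?_⟩, inter_subset_left, fun u hu => hu.2.1, fun u hu => hu.2.2, ?_⟩
  · rw [mem_preimage, extChartAt_to_inv]
    exact ⟨hx, mem_extChartAt_source (f x)⟩
  · rw [← contMDiffOn_iff_contDiffOn]
    exact (extChartPartialDiffeomorph J (f x)).contMDiffOn_toFun.comp
      (hf.comp ((contMDiffOn_extChartAt_symm x).mono inter_subset_left) fun u hu => hu.2.1)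
      fun u hu => hu.2.2

theorem hasFDerivAt_writtenInExtChartAt [I.Boundaryless] {f : N → P} {x : N} {L : E →L[ℝ] F}
    (h : HasMFDerivAt I J f x L) :
    HasFDerivAt (writtenInExtChartAt I J x f) L (extChartAt I x x) := by
  have h2 : HasFDerivWithinAt (writtenInExtChartAt I J x f) L (range I) (extChartAt I x x) := h.2
  rwa [I.range_eq_univ, hasFDerivWithinAt_univ] at h2

theorem isLocalDiffeomorphAt_of_hasMFDerivAt [CompleteSpace E] [I.Boundaryless] [J.Boundaryless]
    [IsManifold I ∞ N] [IsManifold J ∞ P] {f : N → P} {U : Set N} (hU : IsOpen U)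
    (hf : ContMDiffOn I J ∞ f U) {x : N} (hx : x ∈ U) (L : E ≃L[ℝ] F)
    (hL : HasMFDerivAt I J f x (L : E →L[ℝ] F)) :
    IsLocalDiffeomorphAt I J ∞ f x := by
  obtain ⟨V, hV, hxV, hVt, -, hVf, hg⟩ := contDiffOn_writtenInExtChartAt hU hf hx
  have hd := hasFDerivAt_writtenInExtChartAt hL
  have h1 := isLocalDiffeomorphAt_of_hasFDerivAt hV hg hxV L hd
  have h2 : IsLocalDiffeomorphAt I 𝓘(ℝ, E) ∞ (extChartAt I x) x :=
    (extChartPartialDiffeomorph I x).isLocalDiffeomorphAt _ _ _ (mem_extChartAt_source x)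
  have h3 : IsLocalDiffeomorphAt 𝓘(ℝ, F) J ∞ (extChartAt J (f x)).symm
      (writtenInExtChartAt I J x f (extChartAt I x x)) :=
    (extChartPartialDiffeomorph J (f x)).symm.isLocalDiffeomorphAt _ _ _ (by
      change _ ∈ (extChartAt J (f x)).target
      simp [writtenInExtChartAt])
  refine IsLocalDiffeomorphAt.congr (h2.comp J P (h1.comp J P h3)) ?_
  have hc : ContinuousAt (extChartAt I x) x := continuousAt_extChartAt x
  filter_upwards [hc.preimage_mem_nhds (hV.mem_nhds hxV), extChartAt_source_mem_nhds (I := I) x]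
    with y hy hys
  have := hVf _ hy
  simp only [Function.comp_apply, writtenInExtChartAt]
  rw [(extChartAt I x).left_inv hys] at this ⊢
  exact (extChartAt J (f x)).left_inv this

/-- For a complement `C` of the range of the differential, `(u, c) ↦ g u + c` has invertible
derivative at `(a, 0)`. Its local inverse straightens the image of `g` to the first factor. -/
theorem isImmersionAt_of_injective [FiniteDimensional ℝ E] [FiniteDimensional ℝ F]
    [I.Boundaryless] [J.Boundaryless]
    [IsManifold I ∞ N] [IsManifold J ∞ P] {f : N → P} {U : Set N} (hU : IsOpen U)
    (hf : ContMDiffOn I J ∞ f U) {x : N} (hx : x ∈ U)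
    (hinj : Function.Injective (mfderiv I J f x)) :
    Manifold.IsImmersionAt I J ∞ f x := by
  obtain ⟨V, hV, hxV, hVt, -, hVf, hg⟩ := contDiffOn_writtenInExtChartAt hU hf hx
  have hfx : MDifferentiableAt I J f x :=
    (hf.contMDiffAt (hU.mem_nhds hx)).mdifferentiableAt (by simp)
  let D : E →L[ℝ] F := mfderiv I J f x
  have hd : HasFDerivAt _ D _ := hasFDerivAt_writtenInExtChartAt hfx.hasMFDerivAt
  set g := writtenInExtChartAt I J x f with hgdef
  set a := extChartAt I x x with ha
  obtain ⟨C, hC⟩ := Submodule.exists_isCompl (LinearMap.range (D : E →ₗ[ℝ] F))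
  have hDinj : Function.Injective (D : E →ₗ[ℝ] F) := hinj
  let A₀ : (E × C) ≃ₗ[ℝ] F :=
    ((LinearEquiv.ofInjective (D : E →ₗ[ℝ] F) hDinj).prodCongr (LinearEquiv.refl ℝ C)).trans
      (Submodule.prodEquivOfIsCompl _ _ hC)
  let A : (E × C) ≃L[ℝ] F := A₀.toContinuousLinearEquiv
  have hA : ∀ p, A p = D p.1 + p.2 := fun p => rfl
  have hΘd : HasFDerivAt (fun p : E × C => g p.1 + (p.2 : F)) (A : (E × C) →L[ℝ] F) (a, 0) := by
    have h1 : HasFDerivAt (fun p : E × C => g p.1) (D.comp (ContinuousLinearMap.fst ℝ E C))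
        (a, 0) :=
      HasFDerivAt.comp (f := fun p : E × C => p.1) (a, (0 : C)) hd hasFDerivAt_fst
    have h2 : HasFDerivAt (fun p : E × C => (p.2 : F))
        (C.subtypeL.comp (ContinuousLinearMap.snd ℝ E C)) (a, 0) :=
      (C.subtypeL.comp (ContinuousLinearMap.snd ℝ E C)).hasFDerivAt
    exact h1.add h2
  have hΘ : ContDiffOn ℝ ∞ (fun p : E × C => g p.1 + (p.2 : F)) (V ×ˢ univ) :=
    (hg.comp contDiffOn_fst fun p hp => hp.1).add
      (C.subtypeL.comp (ContinuousLinearMap.snd ℝ E C)).contDiff.contDiffOn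
  obtain ⟨Ξ, hΞ, hΞΘ⟩ := isLocalDiffeomorphAt_of_hasFDerivAt (hV.prod isOpen_univ) hΘ
    (x := (a, 0)) ⟨hxV, mem_univ _⟩ A hΘd
  -- In this target chart the map reads `u ↦ A (u, 0)`. The source chart is shrunk to the points
  -- where `(u, 0)` lies in the domain of `Ξ`.
  let Ω : PartialDiffeomorph J J P G ∞ :=
    (extChartPartialDiffeomorph J (f x)).trans (Ξ.symm.trans
      (A.toDiffeomorph.toPartialDiffeomorph.trans (modelSymmPartialDiffeomorph J)))
  have hO : IsOpen ((chartAt H x).source ∩ {y | (extChartAt I x y, (0 : C)) ∈ Ξ.source}) := by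
    rw [← extChartAt_source I]
    exact (continuousOn_extChartAt x).isOpen_inter_preimage (isOpen_extChartAt_source x)
      (Ξ.open_source.preimage (by fun_prop : Continuous fun u : E => (u, (0 : C))))
  have hdom : (chartAt H x).restr
      ((chartAt H x).source ∩ {y | (extChartAt I x y, (0 : C)) ∈ Ξ.source}) ∈
      IsManifold.maximalAtlas I ∞ N :=
    restr_mem_maximalAtlas (G := contDiffGroupoid ∞ I)
      (IsManifold.chart_mem_maximalAtlas x) hO
  refine ⟨C, inferInstance, inferInstance,
    Manifold.IsImmersionAtOfComplement.mk_of_continuousAt hfx.continuousAt A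
    ((chartAt H x).restr
      ((chartAt H x).source ∩ {y | (extChartAt I x y, (0 : C)) ∈ Ξ.source}))
    Ω.toOpenPartialHomeomorph ?_ ?_ hdom ?_ ?_⟩
  · rw [OpenPartialHomeomorph.restr_source, hO.interior_eq]
    exact ⟨mem_chart_source H x, mem_chart_source H x, hΞ⟩
  · have h1 : Ξ (a, (0 : C)) = extChartAt J (f x) (f x) := by
      rw [← hΞΘ hΞ]
      simp [hgdef, ha, writtenInExtChartAt]
    refine ⟨mem_extChartAt_source (f x), ?_, mem_univ _, mem_univ _⟩
    change extChartAt J (f x) (f x) ∈ Ξ.target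
    rw [← h1]
    exact Ξ.map_source hΞ
  · exact Ω.toOpenPartialHomeomorph.mem_maximalAtlas_of_contMDiffOn Ω.contMDiffOn_toFun
      Ω.contMDiffOn_invFun
  · intro u hu
    have hu' : I.symm u ∈ ((chartAt H x).restr
      ((chartAt H x).source ∩ {y | (extChartAt I x y, (0 : C)) ∈ Ξ.source})).target := by
      rw [OpenPartialHomeomorph.extend_target] at hu
      exact hu.1
    have h1 := OpenPartialHomeomorph.map_target _ hu'
    rw [OpenPartialHomeomorph.restr_source, hO.interior_eq] at h1
    have h2 : extChartAt I x ((chartAt H x).symm (I.symm u)) = u := by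
      have h3 : I.symm u ∈ (chartAt H x).target := hu'.1
      simp [extChartAt, OpenPartialHomeomorph.extend, (chartAt H x).right_inv h3,
        I.right_inv (I.range_eq_univ ▸ mem_univ u)]
    have h4 : (u, (0 : C)) ∈ Ξ.source := by
      have := h1.2.2
      change (extChartAt I x ((chartAt H x).symm (I.symm u)), (0 : C)) ∈ Ξ.source at this
      rwa [h2] at this
    change J (J.symm (A (Ξ.invFun (g u)))) = A (u, 0)
    rw [J.right_inv (J.range_eq_univ ▸ mem_univ _)]
    have h5 : g u = Ξ (u, (0 : C)) := by
      rw [← hΞΘ h4]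
      simp
    rw [h5]
    exact congrArg A (Ξ.left_inv h4)

/-- Charts of `X` are local inverses of `q` followed by charts of `N`. Two local inverses differ by
a map identifying points of the same fibre, so `hdeck` makes the transition maps smooth. The
equivalence `A` only replaces the model space. The cosphere, the mapping cylinder and the image of
`iota` all get their structures in this way. -/
theorem exists_manifold_of_isLocalHomeomorph [I.Boundaryless] [IsManifold I ∞ N]
    {X : Type*} [TopologicalSpace X] (A : E ≃L[ℝ] F) {q : N → X} (hq : IsLocalHomeomorph q)
    (hs : Function.Surjective q)
    (hdeck : ∀ y y', q y = q y' →
      ∃ τ : N → N, IsLocalDiffeomorphAt I I ∞ τ y ∧ τ y = y' ∧ q ∘ τ =ᶠ[𝓝 y] q) :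
    ∃ (_ : ChartedSpace F X) (_ : IsManifold 𝓘(ℝ, F) ∞ X),
      IsLocalDiffeomorph I 𝓘(ℝ, F) ∞ q := by
  let g := Function.surjInv hs
  have hg : ∀ x, q (g x) = x := Function.surjInv_eq hs
  let loc : X → OpenPartialHomeomorph X N := fun x => hq.localInverseAt (g x)
  have hlocs : ∀ x z, (loc x).symm z = q z := fun x z => by simp [loc]
  have hlocg : ∀ x, g x ∈ (loc x).target := fun x => hq.self_mem_localInverseAt_target
  let b : N → OpenPartialHomeomorph N E :=
    fun y => (extChartPartialDiffeomorph I y).toOpenPartialHomeomorph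
  let c : X → OpenPartialHomeomorph X F := fun x =>
    (loc x).trans ((b (g x)).trans A.toHomeomorph.toOpenPartialHomeomorph)
  have hc : ∀ x z, c x z = A (extChartAt I (g x) (loc x z)) := fun x z => rfl
  have hcs : ∀ x v, (c x).symm v = q ((extChartAt I (g x)).symm (A.symm v)) := fun x v => by
    rw [← hlocs x]
    rfl
  -- The point `loc x (q y)` is in the fibre of `y`. Near `y`, the local inverse after `q` is the
  -- local diffeomorphism that joins these two points.
  have hlocdeck : ∀ x y, q y ∈ (loc x).source → ∃ τ : N → N, IsLocalDiffeomorphAt I I ∞ τ y ∧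
      τ y = loc x (q y) ∧ (loc x) ∘ q =ᶠ[𝓝 y] τ := by
    intro x y hy
    have h1 : q (loc x (q y)) = q y := by
      rw [← hlocs x]
      exact (loc x).left_inv hy
    obtain ⟨τ, hτ, hτy, hτq⟩ := hdeck y _ h1.symm
    refine ⟨τ, hτ, hτy, ?_⟩
    have h2 : τ ⁻¹' (loc x).target ∈ 𝓝 y := hτ.contMDiffAt.continuousAt.preimage_mem_nhds
      ((loc x).open_target.mem_nhds (hτy ▸ (loc x).map_source hy))
    filter_upwards [h2, hτq] with w hw hwq
    simp only [Function.comp_apply] at hwq ⊢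
    rw [← hwq, ← hlocs x]
    exact (loc x).right_inv hw
  let cs : ChartedSpace F X :=
    { atlas := range c
      chartAt := c
      mem_chart_source := fun x => by
        have h : x ∈ (loc x).source := by
          have := (loc x).map_target (hlocg x)
          rwa [hlocs, hg] at this
        refine ⟨h, ?_, mem_univ _⟩
        have h2 : loc x x = g x := by
          have := (loc x).right_inv (hlocg x)
          rwa [hlocs, hg] at this
        change loc x x ∈ (extChartAt I (g x)).source
        rw [h2]
        exact mem_extChartAt_source (g x)
      chart_mem_atlas := fun x => ⟨x, rfl⟩ }
  have hm : IsManifold 𝓘(ℝ, F) ∞ X := by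
    refine isManifold_of_contDiffOn _ _ _ ?_
    rintro _ _ ⟨x, rfl⟩ ⟨x', rfl⟩ u hu
    have hu1 : u ∈ (c x).target ∧ (c x).symm u ∈ (c x').source := hu.1
    obtain ⟨hu1, hu2⟩ := hu1
    set y := (extChartAt I (g x)).symm (A.symm u) with hy
    have hut : A.symm u ∈ (extChartAt I (g x)).target := hu1.1.2
    rw [hcs] at hu2
    obtain ⟨τ, hτ, hτy, hτq⟩ := hlocdeck x' y hu2.1
    have hs1 : ContMDiffAt 𝓘(ℝ, F) I ∞ (fun v => (extChartAt I (g x)).symm (A.symm v)) u := by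
      have h1 : ContMDiffAt 𝓘(ℝ, E) I ∞ (extChartAt I (g x)).symm (A.symm u) :=
        (contMDiffOn_extChartAt_symm (g x)).contMDiffAt
          ((isOpen_extChartAt_target (g x)).mem_nhds hut)
      exact h1.comp u A.symm.contDiff.contMDiff.contMDiffAt
    have hs2 : ContMDiffAt 𝓘(ℝ, F) I ∞
        (fun v => τ ((extChartAt I (g x)).symm (A.symm v))) u := hτ.contMDiffAt.comp u hs1
    have hs3 : ContMDiffAt I 𝓘(ℝ, E) ∞ (extChartAt I (g x')) (τ y) := by
      refine contMDiffAt_extChartAt' ?_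
      rw [hτy, ← extChartAt_source I]
      exact hu2.2.1
    have hs4 : ContMDiffAt 𝓘(ℝ, F) 𝓘(ℝ, F) ∞ (fun v => A (extChartAt I (g x')
        (τ ((extChartAt I (g x)).symm (A.symm v))))) u :=
      A.contDiff.contMDiff.contMDiffAt.comp u (hs3.comp u hs2)
    refine (contMDiffAt_iff_contDiffAt.1 (hs4.congr_of_eventuallyEq ?_)).contDiffWithinAt
    filter_upwards [hs1.continuousAt.preimage_mem_nhds hτq] with v hv
    change c x' ((c x).symm v) = _
    rw [hcs, hc]
    exact congrArg (fun w => A (extChartAt I (g x') w)) hv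
  refine ⟨cs, hm, fun y => ?_⟩
  have hyl : q y ∈ (loc (q y)).source := by
    have := (loc (q y)).map_target (hlocg (q y))
    rwa [hlocs, hg] at this
  obtain ⟨τ, hτ, hτy, hτq⟩ := hlocdeck (q y) y hyl
  have hlq : loc (q y) (q y) = g (q y) := by
    have := (loc (q y)).right_inv (hlocg (q y))
    rwa [hlocs, hg] at this
  have h1 : IsLocalDiffeomorphAt I 𝓘(ℝ, E) ∞ (extChartAt I (g (q y))) (τ y) :=
    (extChartPartialDiffeomorph I (g (q y))).isLocalDiffeomorphAt _ _ _ (by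
      rw [hτy, hlq]
      exact mem_extChartAt_source (g (q y)))
  have h2 : IsLocalDiffeomorphAt 𝓘(ℝ, E) 𝓘(ℝ, F) ∞ A (extChartAt I (g (q y)) (τ y)) :=
    A.toDiffeomorph.isLocalDiffeomorph _
  have hA : A (extChartAt I (g (q y)) (τ y)) = extChartAt 𝓘(ℝ, F) (q y) (q y) := by
    rw [hτy]
    rfl
  have h3 : IsLocalDiffeomorphAt 𝓘(ℝ, F) 𝓘(ℝ, F) ∞ (extChartAt 𝓘(ℝ, F) (q y)).symm
      (A (extChartAt I (g (q y)) (τ y))) :=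
    (extChartPartialDiffeomorph 𝓘(ℝ, F) (q y)).symm.isLocalDiffeomorphAt _ _ _ (by
      rw [hA]
      exact mem_extChartAt_target (q y))
  refine IsLocalDiffeomorphAt.congr (hτ.comp 𝓘(ℝ, F) X (h1.comp 𝓘(ℝ, F) X (h2.comp 𝓘(ℝ, F) X h3)))
    ?_
  have hqc : q ⁻¹' (extChartAt 𝓘(ℝ, F) (q y)).source ∈ 𝓝 y :=
    hq.continuous.continuousAt.preimage_mem_nhds (extChartAt_source_mem_nhds (q y))
  filter_upwards [hτq, hqc] with w hw hws
  have h4 : A (extChartAt I (g (q y)) (τ w)) = extChartAt 𝓘(ℝ, F) (q y) (q w) := by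
    rw [← hw]
    rfl
  simp only [Function.comp_apply]
  rw [h4]
  exact (extChartAt 𝓘(ℝ, F) (q y)).left_inv hws

end InverseFunction

/-! ### Canonical coordinates on the cotangent bundle -/

section CotangentCharts

open Topology

variable {n : ℕ} {M : Type*} [TopologicalSpace M] [ChartedSpace (EuclideanSpace ℝ (Fin n)) M]
  [IsManifold (𝓡 n) ∞ M]

/-- The model space of the cotangent bundle. -/
abbrev PhaseSpace (n : ℕ) := EuclideanSpace ℝ (Fin n) × (EuclideanSpace ℝ (Fin n) →L[ℝ] ℝ)

theorem mem_cotangent_source {p₀ p : Cotangent n M} :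
    p ∈ (extChartAt (cotangentModel n) p₀).source ↔ p.proj ∈ (chartAt (EuclideanSpace ℝ (Fin n)) p₀.proj).source := by
  rw [extChartAt_source, FiberBundle.chartedSpace_chartAt]
  simp only [OpenPartialHomeomorph.trans_source, OpenPartialHomeomorph.prod_source, mem_inter_iff,
    hom_trivializationAt_source, mem_preimage, mem_prod]
  constructor
  · exact fun h => h.2.1
  · intro h
    refine ⟨?_, h, mem_univ _⟩
    simpa using h

theorem cotangent_extChartAt_apply (p₀ p : Cotangent n M) :
    extChartAt (cotangentModel n) p₀ p = (extChartAt (𝓡 n) p₀.proj p.proj,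
      ContinuousLinearMap.comp (p.snd : TangentSpace (𝓡 n) p.proj →L[ℝ] ℝ)
        ((trivializationAt (EuclideanSpace ℝ (Fin n)) (TangentSpace (𝓡 n)) p₀.proj).symmL ℝ
          p.proj)) := by
  rw [FiberBundle.extChartAt]
  refine Prod.ext rfl ?_
  change ((trivializationAt (EuclideanSpace ℝ (Fin n) →L[ℝ] ℝ)
    (fun x : M => TangentSpace (𝓡 n) x →L[ℝ] Trivial M ℝ x) p₀.proj) p).2 = _
  rw [hom_trivializationAt_apply]
  ext v
  simp [ContinuousLinearMap.inCoordinates]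

theorem cotangent_extChartAt_target (p₀ : Cotangent n M) :
    (extChartAt (cotangentModel n) p₀).target = (extChartAt (𝓡 n) p₀.proj).target ×ˢ univ := by
  rw [FiberBundle.extChartAt_target]
  ext ⟨a, b⟩
  simp [hom_trivializationAt_baseSet]
  intro h
  have := (chartAt (EuclideanSpace ℝ (Fin n)) p₀.proj).map_target h
  simpa [extChartAt] using this

/-- Covectors over one point lie in a common chart, since a chart domain contains every fibre it
meets; covectors over different points are separated in the base. This serves the uniqueness of
integral curves and the embedding property of `iota`. -/
instance [T2Space M] : T2Space (Cotangent n M) := by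
  refine ⟨fun p q hpq => ?_⟩
  by_cases h : p.proj = q.proj
  · let e := chartAt (ModelProd (EuclideanSpace ℝ (Fin n)) (EuclideanSpace ℝ (Fin n) →L[ℝ] ℝ)) p
    have hp : p ∈ e.source := mem_chart_source _ p
    have hq : q ∈ e.source := by
      have : q ∈ (extChartAt (cotangentModel n) p).source := by
        rw [mem_cotangent_source, ← h]
        exact mem_chart_source _ _
      rwa [extChartAt_source] at this
    obtain ⟨u, v, hu, hv, hpu, hqv, huv⟩ := t2_separation (X := PhaseSpace n)
      (fun he => hpq (e.injOn hp hq he) : (e p : PhaseSpace n) ≠ e q)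
    exact ⟨e.source ∩ e ⁻¹' u, e.source ∩ e ⁻¹' v, e.isOpen_inter_preimage hu,
      e.isOpen_inter_preimage hv, ⟨hp, hpu⟩, ⟨hq, hqv⟩,
      (huv.preimage e).mono inter_subset_right inter_subset_right⟩
  · obtain ⟨u, v, hu, hv, hpu, hqv, huv⟩ := t2_separation h
    have hc : Continuous (fun q : Cotangent n M => q.proj) :=
      FiberBundle.continuous_proj _ _
    exact ⟨_, _, hu.preimage hc, hv.preimage hc, hpu, hqv, huv.preimage _⟩

/-- The differential of the cotangent chart around `p₀`. -/
def chartDeriv (p₀ p : Cotangent n M) : TangentSpace (cotangentModel n) p →L[ℝ] PhaseSpace n :=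
  mfderiv (cotangentModel n) 𝓘(ℝ, PhaseSpace n) (extChartAt (cotangentModel n) p₀) p

theorem hasMFDerivAt_chart {p₀ p : Cotangent n M}
    (h : p ∈ (extChartAt (cotangentModel n) p₀).source) :
    HasMFDerivAt (cotangentModel n) 𝓘(ℝ, PhaseSpace n) (extChartAt (cotangentModel n) p₀) p
      (chartDeriv p₀ p) :=
  (mdifferentiableAt_extChartAt (by rwa [extChartAt_source] at h)).hasMFDerivAt

theorem chartDeriv_bijective {p₀ p : Cotangent n M}
    (h : p ∈ (extChartAt (cotangentModel n) p₀).source) :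
    Function.Bijective (chartDeriv p₀ p) :=
  (isInvertible_mfderiv_extChartAt h).bijective

/-- The fibre coordinate of a covector is its composition with the inverse of the tangent
trivialization, which is the differential of the base chart; the two cancel. So the canonical form
is `η · du` in every chart, not only in the one centred at `p`. -/
theorem canonicalForm_eq {p₀ p : Cotangent n M}
    (h : p ∈ (extChartAt (cotangentModel n) p₀).source)
    (u : TangentSpace (cotangentModel n) p) :
    canonicalForm p u = (extChartAt (cotangentModel n) p₀ p).2 (chartDeriv p₀ p u).1 := by
  have hx := mem_cotangent_source.1 h
  have h1 : HasMFDerivAt (cotangentModel n) 𝓘(ℝ, EuclideanSpace ℝ (Fin n))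
      (fun q : Cotangent n M => (extChartAt (cotangentModel n) p₀ q).1) p
      ((ContinuousLinearMap.fst ℝ (EuclideanSpace ℝ (Fin n))
        (EuclideanSpace ℝ (Fin n) →L[ℝ] ℝ)).comp (chartDeriv p₀ p)) :=
    ((ContinuousLinearMap.fst ℝ (EuclideanSpace ℝ (Fin n))
        (EuclideanSpace ℝ (Fin n) →L[ℝ] ℝ)).hasFDerivAt.hasMFDerivAt).comp p (hasMFDerivAt_chart h)
  have hproj : MDifferentiableAt (cotangentModel n) (𝓡 n) (fun q : Cotangent n M => q.proj) p :=
    (contMDiffAt_proj _ (n := 1)).mdifferentiableAt (by simp)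
  have h2 : HasMFDerivAt (cotangentModel n) 𝓘(ℝ, EuclideanSpace ℝ (Fin n))
      (fun q : Cotangent n M => extChartAt (𝓡 n) p₀.proj q.proj) p
      ((mfderiv (𝓡 n) 𝓘(ℝ, EuclideanSpace ℝ (Fin n)) (extChartAt (𝓡 n) p₀.proj) p.proj).comp
        (mfderiv (cotangentModel n) (𝓡 n) (fun q : Cotangent n M => q.proj) p)) :=
    HasMFDerivAt.comp p (mdifferentiableAt_extChartAt hx).hasMFDerivAt hproj.hasMFDerivAt
  have h3 : (fun q : Cotangent n M => (extChartAt (cotangentModel n) p₀ q).1) =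
      fun q : Cotangent n M => extChartAt (𝓡 n) p₀.proj q.proj := by
    funext q
    rw [cotangent_extChartAt_apply]
  rw [h3] at h1
  have h4 := congrArg (fun L => L u) (hasMFDerivAt_unique h1 h2)
  have h5 : (chartDeriv p₀ p u).1 = (trivializationAt (EuclideanSpace ℝ (Fin n))
      (TangentSpace (𝓡 n)) p₀.proj).continuousLinearMapAt ℝ p.proj
        (mfderiv (cotangentModel n) (𝓡 n) (fun q : Cotangent n M => q.proj) p u) := by
    rw [TangentBundle.continuousLinearMapAt_trivializationAt hx]
    exact h4
  rw [h5, cotangent_extChartAt_apply]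
  change _ = p.snd _
  have hb : p.proj ∈ (trivializationAt (EuclideanSpace ℝ (Fin n))
      (TangentSpace (𝓡 n)) p₀.proj).baseSet := by simpa using hx
  exact congrArg p.snd (Trivialization.symmL_continuousLinearMapAt _ hb _).symm

end CotangentCharts

/-! ### The symplectic form is standard in every canonical chart -/

section SymplecticCharts


open Topology

variable {n : ℕ} {M : Type*} [TopologicalSpace M] [ChartedSpace (EuclideanSpace ℝ (Fin n)) M]
  [IsManifold (𝓡 n) ∞ M]

set_option synthInstance.maxHeartbeats 200000

section Linear

variable {E F : Type*} [NormedAddCommGroup E] [NormedSpace ℝ E] [NormedAddCommGroup F]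
  [NormedSpace ℝ F]

/-- The canonical symplectic form of `E × F` for a pairing `b` of `F` with `E`. -/
def pairForm (b : F →L[ℝ] E →L[ℝ] ℝ) : (E × F) →L[ℝ] (E × F) →L[ℝ] ℝ :=
  b.bilinearComp (ContinuousLinearMap.snd ℝ E F) (ContinuousLinearMap.fst ℝ E F) -
    (b.bilinearComp (ContinuousLinearMap.snd ℝ E F) (ContinuousLinearMap.fst ℝ E F)).flip

theorem pairForm_apply (b : F →L[ℝ] E →L[ℝ] ℝ) (v w : E × F) :
    pairForm b v w = b v.2 w.1 - b w.2 v.1 := rfl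

/-- Exterior differentiation commutes with pullback: differentiating the invariance of the one-form
produces a second derivative of `τ`, which is symmetric and cancels after antisymmetrization. -/
theorem pairForm_eq_of_preserves_oneForm (b : F →L[ℝ] E →L[ℝ] ℝ) {τ : E × F → E × F} {y : E × F}
    (hτ : ContDiffAt ℝ 2 τ y)
    (h : ∀ᶠ y' in 𝓝 y, ∀ v, b (τ y').2 (fderiv ℝ τ y' v).1 = b y'.2 v.1) (v w : E × F) :
    pairForm b (fderiv ℝ τ y v) (fderiv ℝ τ y w) = pairForm b v w := by
  have hd : HasFDerivAt τ (fderiv ℝ τ y) y := (hτ.differentiableAt (by simp)).hasFDerivAt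
  have hdd : HasFDerivAt (fderiv ℝ τ) (fderiv ℝ (fderiv ℝ τ) y) y :=
    ((hτ.fderiv_right (m := 1) (by norm_num)).differentiableAt (by simp)).hasFDerivAt
  have key : ∀ a c : E × F, b (τ y).2 (fderiv ℝ (fderiv ℝ τ) y c a).1 +
      b (fderiv ℝ τ y c).2 (fderiv ℝ τ y a).1 = b c.2 a.1 := by
    intro a c
    have h1 : HasFDerivAt (fun y' : E × F => (fderiv ℝ τ y' a).1)
        ((ContinuousLinearMap.fst ℝ E F).comp ((fderiv ℝ (fderiv ℝ τ) y).flip a)) y :=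
      HasFDerivAt.comp (g := Prod.fst) (f := fun y' => fderiv ℝ τ y' a) y hasFDerivAt_fst
        (by simpa using hdd.clm_apply (hasFDerivAt_const a y))
    have h2 : HasFDerivAt (fun y' : E × F => b (τ y').2)
        (b.comp ((ContinuousLinearMap.snd ℝ E F).comp (fderiv ℝ τ y))) y :=
      (b.comp (ContinuousLinearMap.snd ℝ E F)).hasFDerivAt.comp y hd
    have h3 := h2.clm_apply h1
    have h4 : HasFDerivAt (fun y' : E × F => b y'.2 a.1)
        ((b.flip a.1).comp (ContinuousLinearMap.snd ℝ E F)) y :=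
      ((b.flip a.1).comp (ContinuousLinearMap.snd ℝ E F)).hasFDerivAt
    have h5 : (fun y' : E × F => b (τ y').2 (fderiv ℝ τ y' a).1) =ᶠ[𝓝 y]
        fun y' => b y'.2 a.1 := h.mono fun y' hy => hy a
    have h6 := DFunLike.congr_fun ((h4.congr_of_eventuallyEq h5).unique h3) c
    simpa using h6.symm
  have hsymm : fderiv ℝ (fderiv ℝ τ) y v w = fderiv ℝ (fderiv ℝ τ) y w v :=
    (hτ.isSymmSndFDerivAt (by simp)) v w
  have h1 := key v w
  have h2 := key w v
  rw [hsymm] at h2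
  simp only [pairForm_apply]
  linarith

/-- The isomorphism `v ↦ B v` of a nondegenerate bilinear form. -/
def flatEquiv [FiniteDimensional ℝ E] (B : E →L[ℝ] E →L[ℝ] ℝ)
    (h : ∀ v, (∀ w, B v w = 0) → v = 0) : E ≃L[ℝ] (E →L[ℝ] ℝ) :=
  have hinj : Function.Injective (B : E →ₗ[ℝ] (E →L[ℝ] ℝ)) := by
    rw [injective_iff_map_eq_zero]
    exact fun v hv => h v fun w => DFunLike.congr_fun hv w
  have hdim : Module.finrank ℝ E = Module.finrank ℝ (E →L[ℝ] ℝ) := by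
    rw [← (LinearMap.toContinuousLinearMap (𝕜 := ℝ) (E := E) (F' := ℝ)).finrank_eq]
    exact (Subspace.dual_finrank_eq (K := ℝ) (V := E)).symm
  (LinearEquiv.ofBijective (B : E →ₗ[ℝ] (E →L[ℝ] ℝ)) ⟨hinj,
    (LinearMap.injective_iff_surjective_of_finrank_eq_finrank hdim).1 hinj⟩).toContinuousLinearEquiv

end Linear


/-- The standard symplectic form of `ℝⁿ × (ℝⁿ)*`. -/
def stdForm (n : ℕ) : PhaseSpace n →L[ℝ] PhaseSpace n →L[ℝ] ℝ :=
  pairForm (ContinuousLinearMap.id ℝ (EuclideanSpace ℝ (Fin n) →L[ℝ] ℝ))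

theorem stdForm_apply (v w : PhaseSpace n) : stdForm n v w = v.2 w.1 - w.2 v.1 := rfl

theorem stdForm_nondegenerate {v : PhaseSpace n} (h : ∀ w, stdForm n v w = 0) : v = 0 := by
  refine Prod.ext ?_ ?_
  · by_contra hv
    obtain ⟨f, -, hf⟩ := exists_dual_vector ℝ v.1 (norm_ne_zero_iff.2 hv)
    have h1 := h (0, f)
    simp only [stdForm_apply, map_zero, zero_sub, neg_eq_zero] at h1
    rw [h1] at hf
    exact hv (norm_eq_zero.1 (by simpa using hf.symm))
  · ext u
    simpa [stdForm_apply] using h (u, 0)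

/-- The musical isomorphism of the standard symplectic form. -/
def stdFlat (n : ℕ) : PhaseSpace n ≃L[ℝ] (PhaseSpace n →L[ℝ] ℝ) :=
  flatEquiv (stdForm n) fun _ => stdForm_nondegenerate

theorem stdFlat_apply (v w : PhaseSpace n) : stdFlat n v w = stdForm n v w := rfl

theorem chart_symm_hasMFDerivAt {p₀ : Cotangent n M} {y : PhaseSpace n}
    (hy : y ∈ (extChartAt (cotangentModel n) p₀).target) :
    HasMFDerivAt 𝓘(ℝ, PhaseSpace n) (cotangentModel n) (extChartAt (cotangentModel n) p₀).symm y
      (mfderiv 𝓘(ℝ, PhaseSpace n) (cotangentModel n) (extChartAt (cotangentModel n) p₀).symm y) :=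
  (((contMDiffOn_extChartAt_symm (n := 1) p₀).contMDiffAt
    ((isOpen_extChartAt_target p₀).mem_nhds hy)).mdifferentiableAt (by simp)).hasMFDerivAt

theorem chartDeriv_symm_eq_fderiv {p₀ p₁ : Cotangent n M} {y : PhaseSpace n}
    (hy : y ∈ (extChartAt (cotangentModel n) p₁).target)
    (hs : (extChartAt (cotangentModel n) p₁).symm y ∈ (extChartAt (cotangentModel n) p₀).source)
    (v : PhaseSpace n) :
    chartDeriv p₀ ((extChartAt (cotangentModel n) p₁).symm y)
      (mfderiv 𝓘(ℝ, PhaseSpace n) (cotangentModel n) (extChartAt (cotangentModel n) p₁).symm y v) =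
    fderiv ℝ (fun y' => extChartAt (cotangentModel n) p₀
      ((extChartAt (cotangentModel n) p₁).symm y')) y v := by
  let L : PhaseSpace n →L[ℝ] PhaseSpace n :=
    (chartDeriv p₀ ((extChartAt (cotangentModel n) p₁).symm y)).comp
      (mfderiv 𝓘(ℝ, PhaseSpace n) (cotangentModel n) (extChartAt (cotangentModel n) p₁).symm y)
  have h : HasMFDerivAt 𝓘(ℝ, PhaseSpace n) 𝓘(ℝ, PhaseSpace n)
      (fun y' : PhaseSpace n => (extChartAt (cotangentModel n) p₀
      ((extChartAt (cotangentModel n) p₁).symm y') : PhaseSpace n)) y L :=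
    HasMFDerivAt.comp y (hasMFDerivAt_chart hs) (chart_symm_hasMFDerivAt hy)
  have h' : HasFDerivAt (fun y' : PhaseSpace n => (extChartAt (cotangentModel n) p₀
      ((extChartAt (cotangentModel n) p₁).symm y') : PhaseSpace n)) L y := h.hasFDerivAt
  have h'' : L = fderiv ℝ (fun y' => extChartAt (cotangentModel n) p₀
      ((extChartAt (cotangentModel n) p₁).symm y')) y := h'.fderiv.symm
  exact DFunLike.congr_fun h'' v

theorem canonicalFormInChart_apply {p₀ : Cotangent n M} {y : PhaseSpace n}
    (hy : y ∈ (extChartAt (cotangentModel n) p₀).target) (v : PhaseSpace n) :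
    canonicalFormInChart p₀ y v = y.2 v.1 := by
  have hs := (extChartAt (cotangentModel n) p₀).map_target hy
  have h1 := canonicalForm_eq hs
    (mfderiv 𝓘(ℝ, PhaseSpace n) (cotangentModel n) (extChartAt (cotangentModel n) p₀).symm y v)
  rw [chartDeriv_symm_eq_fderiv hy hs, (extChartAt (cotangentModel n) p₀).right_inv hy] at h1
  have h2 : (fun y' => extChartAt (cotangentModel n) p₀
      ((extChartAt (cotangentModel n) p₀).symm y')) =ᶠ[𝓝 y] id := by
    filter_upwards [(isOpen_extChartAt_target p₀).mem_nhds hy] with y' hy'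
    exact (extChartAt (cotangentModel n) p₀).right_inv hy'
  rw [h2.fderiv_eq, fderiv_id] at h1
  exact h1

theorem symplecticForm_self (p : Cotangent n M) (v w : TangentSpace (cotangentModel n) p) :
    symplecticForm p v w = stdForm n (chartDeriv p p v) (chartDeriv p p w) := by
  have h : canonicalFormInChart p =ᶠ[𝓝 (extChartAt (cotangentModel n) p p)]
      fun y => ((ContinuousLinearMap.compL ℝ (PhaseSpace n) (EuclideanSpace ℝ (Fin n)) ℝ).flip
        (ContinuousLinearMap.fst ℝ _ _)).comp (ContinuousLinearMap.snd ℝ _ _) y := by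
    filter_upwards [(isOpen_extChartAt_target p).mem_nhds (mem_extChartAt_target p)] with y hy
    ext v
    · rw [ContinuousLinearMap.comp_apply, canonicalFormInChart_apply hy]
      simp
    · rw [ContinuousLinearMap.comp_apply, canonicalFormInChart_apply hy]
      simp
  unfold symplecticForm
  rw [h.fderiv_eq, ContinuousLinearMap.fderiv]
  rfl

/-- The definition at `p` uses the chart centred at `p`. Any other chart gives the same form because
transition maps preserve `η · du`. This lets one fixed chart serve for all nearby points. -/
theorem symplecticForm_eq {p₀ p : Cotangent n M}
    (hp : p ∈ (extChartAt (cotangentModel n) p₀).source)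
    (v w : TangentSpace (cotangentModel n) p) :
    symplecticForm p v w = stdForm n (chartDeriv p₀ p v) (chartDeriv p₀ p w) := by
  rw [symplecticForm_self]
  set e := extChartAt (cotangentModel n) p
  set e₀ := extChartAt (cotangentModel n) p₀
  let τ : PhaseSpace n → PhaseSpace n := fun y => e₀ (e.symm y)
  have hO : IsOpen (e.target ∩ e.symm ⁻¹' e₀.source) :=
    (continuousOn_extChartAt_symm p).isOpen_inter_preimage (isOpen_extChartAt_target p)
      (isOpen_extChartAt_source p₀)
  have hpe : e p ∈ e.target ∩ e.symm ⁻¹' e₀.source := by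
    refine ⟨mem_extChartAt_target p, ?_⟩
    rw [mem_preimage, extChartAt_to_inv]
    exact hp
  have hτ : ContDiffAt ℝ 2 τ (e p) := by
    rw [← contMDiffAt_iff_contDiffAt]
    have h1 : ContMDiffOn 𝓘(ℝ, PhaseSpace n) 𝓘(ℝ, PhaseSpace n) 2 τ
        (e.target ∩ e.symm ⁻¹' e₀.source) :=
      ((extChartPartialDiffeomorph (cotangentModel n) p₀).contMDiffOn_toFun.of_le
        (by simp [ENat.LEInfty.out])).comp
        ((contMDiffOn_extChartAt_symm p).mono inter_subset_left) fun y hy => hy.2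
    exact h1.contMDiffAt (hO.mem_nhds hpe)
  have hpres : ∀ᶠ y in 𝓝 (e p), ∀ v, (τ y).2 (fderiv ℝ τ y v).1 = y.2 v.1 := by
    filter_upwards [hO.mem_nhds hpe] with y hy v
    rw [← canonicalFormInChart_apply hy.1 v, ← chartDeriv_symm_eq_fderiv hy.1 hy.2]
    exact (canonicalForm_eq hy.2 _).symm
  have hcomp : ∀ u : TangentSpace (cotangentModel n) p,
      fderiv ℝ τ (e p) (chartDeriv p p u) = chartDeriv p₀ p u := by
    intro u
    have h1 : HasMFDerivAt (cotangentModel n) 𝓘(ℝ, PhaseSpace n) (fun q => τ (e q)) p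
        ((fderiv ℝ τ (e p)).comp (chartDeriv p p)) :=
      ((hτ.differentiableAt (by simp)).hasFDerivAt.hasMFDerivAt).comp p
        (hasMFDerivAt_chart (mem_extChartAt_source p))
    have h2 : (fun q => τ (e q)) =ᶠ[𝓝 p] e₀ := by
      filter_upwards [extChartAt_source_mem_nhds (I := cotangentModel n) p] with q hq
      change e₀ (e.symm (e q)) = e₀ q
      rw [e.left_inv hq]
    exact congrArg (fun L => L u)
      (hasMFDerivAt_unique h1 ((hasMFDerivAt_chart hp).congr_of_eventuallyEq h2))
  rw [← hcomp v, ← hcomp w]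
  exact (pairForm_eq_of_preserves_oneForm _ hτ hpres _ _).symm

end SymplecticCharts

/-! ### The Hamiltonian, its vector field and time reversal in coordinates -/

section CoordinateFlowField

open Topology

set_option synthInstance.maxHeartbeats 200000

section Linear
variable {E : Type*} [NormedAddCommGroup E] [NormedSpace ℝ E]

theorem posDef_isInvertible [FiniteDimensional ℝ E] {B : E →L[ℝ] E →L[ℝ] ℝ} (hpos : ∀ v, v ≠ 0 → 0 < B v v) :
    B.IsInvertible :=
  ⟨flatEquiv B fun v hv => by_contra fun h => (hpos v h).ne' (hv v), rfl⟩

/-- By Cauchy–Schwarz the maximum is attained at `a / √(B a a)`; for `a = 0` the convention `0⁻¹ =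
0` makes this vector `0`, which still works. -/
theorem sSup_eq_sqrt {B : E →L[ℝ] E →L[ℝ] ℝ} (hsymm : ∀ v w, B v w = B w v)
    (hpos : ∀ v, v ≠ 0 → 0 < B v v) (a : E) :
    sSup {r : ℝ | ∃ v, B v v ≤ 1 ∧ B a v = r} = √(B a a) := by
  have hnn : ∀ v, 0 ≤ B v v := fun v => by
    by_cases hv : v = 0
    · simp [hv]
    · exact (hpos v hv).le
  refine IsGreatest.csSup_eq ⟨⟨(√(B a a))⁻¹ • a, ?_, ?_⟩, ?_⟩
  · simp only [map_smul, smul_apply, smul_eq_mul]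
    rw [← mul_assoc, ← mul_inv, Real.mul_self_sqrt (hnn a)]
    exact inv_mul_le_one
  · simp only [map_smul, smul_eq_mul]
    rw [mul_comm, ← div_eq_mul_inv, Real.div_sqrt]
  · rintro r ⟨v, hv, rfl⟩
    apply Real.le_sqrt_of_sq_le
    by_cases ha : a = 0
    · simp [ha]
    -- Positivity on the component of `v` orthogonal to `a`, scaled by `B a a` to avoid division.
    · have h1 := hnn (B a a • v - B a v • a)
      simp only [map_sub, map_smul, sub_apply, smul_apply,
        smul_eq_mul, hsymm v a] at h1
      have h2 : 0 ≤ B a a * (B a a * B v v - B a v ^ 2) := by nlinarith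
      have h3 := nonneg_of_mul_nonneg_right h2 (hpos a ha)
      nlinarith [hnn a]
theorem contDiffAt_symplecticGradient (A : E ≃L[ℝ] (E →L[ℝ] ℝ)) {h : E → ℝ} {y : E}
    (hh : ContDiffAt ℝ ∞ h y) : ContDiffAt ℝ ∞ (fun z => A.symm (-fderiv ℝ h z)) y :=
  ContDiffAt.comp y (f := fun z => -fderiv ℝ h z) (g := A.symm) A.symm.contDiff.contDiffAt
    (hh.fderiv_right (m := ∞) (by simp)).neg

end Linear

variable {n : ℕ} {M : Type*} [TopologicalSpace M] [ChartedSpace (EuclideanSpace ℝ (Fin n)) M]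
  [IsManifold (𝓡 n) ∞ M]

/-- The matrix of the metric in the chart around `x₀`. -/
def metricInChart (g : Metric n M) (x₀ : M) (u : EuclideanSpace ℝ (Fin n)) :
    EuclideanSpace ℝ (Fin n) →L[ℝ] EuclideanSpace ℝ (Fin n) →L[ℝ] ℝ :=
  ContinuousLinearMap.inCoordinates (EuclideanSpace ℝ (Fin n)) (TangentSpace (𝓡 n) : M → Type _)
    (EuclideanSpace ℝ (Fin n) →L[ℝ] ℝ) (fun x : M => TangentSpace (𝓡 n) x →L[ℝ] Trivial M ℝ x) x₀
    ((extChartAt (𝓡 n) x₀).symm u) x₀ ((extChartAt (𝓡 n) x₀).symm u)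
    (g.inner ((extChartAt (𝓡 n) x₀).symm u))

theorem metricInChart_apply (g : Metric n M) {x₀ x : M}
    (hx : x ∈ (chartAt (EuclideanSpace ℝ (Fin n)) x₀).source) (v w : EuclideanSpace ℝ (Fin n)) :
    metricInChart g x₀ (extChartAt (𝓡 n) x₀ x) v w = g.inner x
      ((trivializationAt (EuclideanSpace ℝ (Fin n)) (TangentSpace (𝓡 n)) x₀).symmL ℝ x v)
      ((trivializationAt (EuclideanSpace ℝ (Fin n)) (TangentSpace (𝓡 n)) x₀).symmL ℝ x w) := by
  have hb : x ∈ (trivializationAt (EuclideanSpace ℝ (Fin n))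
      (TangentSpace (𝓡 n)) x₀).baseSet := by simpa using hx
  unfold metricInChart
  rw [(extChartAt (𝓡 n) x₀).left_inv (by simpa using hx), inCoordinates_apply_eq₂ hb hb (mem_univ _)]
  have hs : ∀ a, (trivializationAt (EuclideanSpace ℝ (Fin n)) (TangentSpace (𝓡 n)) x₀).symmL ℝ x a =
      (trivializationAt (EuclideanSpace ℝ (Fin n)) (TangentSpace (𝓡 n)) x₀).symm x a :=
    fun a => Trivialization.symmL_apply _ hb a
  rw [hs, hs]
  simp

theorem contDiffOn_metricInChart (g : Metric n M) (x₀ : M) :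
    ContDiffOn ℝ ∞ (metricInChart g x₀) (extChartAt (𝓡 n) x₀).target := by
  have h : ContMDiffOn (𝓡 n) 𝓘(ℝ, EuclideanSpace ℝ (Fin n) →L[ℝ] EuclideanSpace ℝ (Fin n) →L[ℝ] ℝ) ∞ (fun x => ContinuousLinearMap.inCoordinates (EuclideanSpace ℝ (Fin n)) (TangentSpace (𝓡 n) : M → Type _)
    (EuclideanSpace ℝ (Fin n) →L[ℝ] ℝ) (fun x : M => TangentSpace (𝓡 n) x →L[ℝ] Trivial M ℝ x) x₀
    x x₀ x (g.inner x)) (extChartAt (𝓡 n) x₀).source := by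
    have h := (trivializationAt (EuclideanSpace ℝ (Fin n) →L[ℝ] EuclideanSpace ℝ (Fin n) →L[ℝ] ℝ)
      (fun x : M => TangentSpace (𝓡 n) x →L[ℝ] TangentSpace (𝓡 n) x →L[ℝ] Trivial M ℝ x) x₀).contMDiffOn_iff (IB := 𝓡 n) (n := ∞) (f := fun x => TotalSpace.mk' (EuclideanSpace ℝ (Fin n) →L[ℝ] EuclideanSpace ℝ (Fin n) →L[ℝ] ℝ) x (g.inner x)) (s := (extChartAt (𝓡 n) x₀).source) (IM := 𝓡 n) (by
        intro x hx
        simp [hom_trivializationAt_baseSet]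
        simpa using hx)
    exact (h.1 g.contMDiff.contMDiffOn).2
  rw [← contMDiffOn_iff_contDiffOn]
  exact h.comp (contMDiffOn_extChartAt_symm x₀) fun u hu => (extChartAt (𝓡 n) x₀).map_target hu

theorem metricInChart_symm (g : Metric n M) (x₀ : M) {u : EuclideanSpace ℝ (Fin n)}
    (hu : u ∈ (extChartAt (𝓡 n) x₀).target) (v w : EuclideanSpace ℝ (Fin n)) :
    metricInChart g x₀ u v w = metricInChart g x₀ u w v := by
  rw [← (extChartAt (𝓡 n) x₀).right_inv hu]
  have hx := (extChartAt (𝓡 n) x₀).map_target hu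
  rw [extChartAt_source] at hx
  rw [metricInChart_apply g hx, metricInChart_apply g hx]
  exact g.symm _ _ _

theorem metricInChart_pos (g : Metric n M) (x₀ : M) {u : EuclideanSpace ℝ (Fin n)}
    (hu : u ∈ (extChartAt (𝓡 n) x₀).target) (v : EuclideanSpace ℝ (Fin n)) (hv : v ≠ 0) :
    0 < metricInChart g x₀ u v v := by
  rw [← (extChartAt (𝓡 n) x₀).right_inv hu]
  have hx := (extChartAt (𝓡 n) x₀).map_target hu
  rw [extChartAt_source] at hx
  rw [metricInChart_apply g hx]
  refine g.pos _ _ fun h => hv ?_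
  have hb : (extChartAt (𝓡 n) x₀).symm u ∈ (trivializationAt (EuclideanSpace ℝ (Fin n))
      (TangentSpace (𝓡 n)) x₀).baseSet := by simpa using hx
  rw [← Trivialization.continuousLinearMapAt_symmL (R := ℝ) (trivializationAt (EuclideanSpace ℝ (Fin n))
      (TangentSpace (𝓡 n)) x₀) hb v, h, map_zero]

/-- The Hamiltonian `|ξ|_g` in the chart around `x₀`. -/
def coordHam (g : Metric n M) (x₀ : M) (y : PhaseSpace n) : ℝ :=
  √(y.2 ((metricInChart g x₀ y.1).inverse y.2))

theorem metricInChart_inverse_apply (g : Metric n M) (x₀ : M) {u : EuclideanSpace ℝ (Fin n)}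
    (hu : u ∈ (extChartAt (𝓡 n) x₀).target) (η : EuclideanSpace ℝ (Fin n) →L[ℝ] ℝ) :
    metricInChart g x₀ u ((metricInChart g x₀ u).inverse η) = η := by
  obtain ⟨e, he⟩ := posDef_isInvertible (metricInChart_pos g x₀ hu)
  rw [← he, ContinuousLinearMap.inverse_equiv]
  exact e.apply_symm_apply η

theorem coordHam_arg_pos (g : Metric n M) (x₀ : M) {y : PhaseSpace n}
    (hy : y.1 ∈ (extChartAt (𝓡 n) x₀).target) (h : y.2 ≠ 0) :
    0 < y.2 ((metricInChart g x₀ y.1).inverse y.2) := by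
  have h1 := metricInChart_pos g x₀ hy ((metricInChart g x₀ y.1).inverse y.2) (fun h0 => h (by
    rw [← metricInChart_inverse_apply g x₀ hy y.2, h0, map_zero]))
  rwa [metricInChart_inverse_apply g x₀ hy] at h1

theorem coordHam_pos_iff (g : Metric n M) (x₀ : M) {y : PhaseSpace n}
    (hy : y.1 ∈ (extChartAt (𝓡 n) x₀).target) : 0 < coordHam g x₀ y ↔ y.2 ≠ 0 := by
  constructor
  · intro h h0
    simp [coordHam, h0] at h
  · exact fun h => Real.sqrt_pos.2 (coordHam_arg_pos g x₀ hy h)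

/-- The dual norm of `η` is the norm of the vector `G⁻¹ η`, where `G` is the matrix of the metric.
The resulting formula `√(η G⁻¹ η)` is smooth off the zero section, unlike the supremum as it is
written. -/
theorem conorm_eq (g : Metric n M) {p₀ p : Cotangent n M}
    (hp : p ∈ (extChartAt (cotangentModel n) p₀).source) :
    conorm g p = coordHam g p₀.proj (extChartAt (cotangentModel n) p₀ p) := by
  have hx := mem_cotangent_source.1 hp
  have hb : p.proj ∈ (trivializationAt (EuclideanSpace ℝ (Fin n))
      (TangentSpace (𝓡 n)) p₀.proj).baseSet := by simpa using hx
  have hu : extChartAt (𝓡 n) p₀.proj p.proj ∈ (extChartAt (𝓡 n) p₀.proj).target :=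
    (extChartAt (𝓡 n) p₀.proj).map_source (by simpa using hx)
  rw [cotangent_extChartAt_apply]
  set u := extChartAt (𝓡 n) p₀.proj p.proj with hu_def
  set e := trivializationAt (EuclideanSpace ℝ (Fin n)) (TangentSpace (𝓡 n)) p₀.proj
  set η : EuclideanSpace ℝ (Fin n) →L[ℝ] ℝ := ContinuousLinearMap.comp
    (p.snd : TangentSpace (𝓡 n) p.proj →L[ℝ] ℝ) (e.symmL ℝ p.proj)
  have h1 := sSup_eq_sqrt (metricInChart_symm g p₀.proj hu) (metricInChart_pos g p₀.proj hu)
    ((metricInChart g p₀.proj u).inverse η)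
  rw [metricInChart_inverse_apply g p₀.proj hu] at h1
  unfold coordHam
  rw [← h1]
  unfold conorm
  congr 1
  ext r
  constructor
  · rintro ⟨v, hv, rfl⟩
    have hs : e.symmL ℝ p.proj (e.continuousLinearMapAt ℝ p.proj v) = v :=
      Trivialization.symmL_continuousLinearMapAt e hb v
    refine ⟨e.continuousLinearMapAt ℝ p.proj v, ?_, congrArg p.snd hs⟩
    rw [metricInChart_apply g hx, hs]
    exact hv
  · rintro ⟨v, hv, rfl⟩
    rw [metricInChart_apply g hx] at hv
    exact ⟨e.symmL ℝ p.proj v, hv, rfl⟩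

theorem contDiffAt_coordHam (g : Metric n M) (x₀ : M) {y : PhaseSpace n}
    (hy : y.1 ∈ (extChartAt (𝓡 n) x₀).target) (h : y.2 ≠ 0) :
    ContDiffAt ℝ ∞ (coordHam g x₀) y := by
  have h1 : ContDiffAt ℝ ∞ (metricInChart g x₀) y.1 :=
    (contDiffOn_metricInChart g x₀).contDiffAt ((isOpen_extChartAt_target x₀).mem_nhds hy)
  have h2 : ContDiffAt ℝ ∞ (fun z : PhaseSpace n => (metricInChart g x₀ z.1).inverse) y :=
    ContDiffAt.comp y
      (f := fun z : PhaseSpace n => metricInChart g x₀ z.1) (g := ContinuousLinearMap.inverse)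
      (posDef_isInvertible (metricInChart_pos g x₀ hy)).contDiffAt_map_inverse
      (ContDiffAt.comp y (f := Prod.fst) (g := metricInChart g x₀) h1 contDiffAt_fst)
  exact ContDiffAt.sqrt (contDiffAt_snd.clm_apply (h2.clm_apply contDiffAt_snd))
    (coordHam_arg_pos g x₀ hy h).ne'

/-- The Hamiltonian vector field of `|ξ|_g` in the chart around `x₀`. -/
def coordField (g : Metric n M) (x₀ : M) (y : PhaseSpace n) : PhaseSpace n :=
  (stdFlat n).symm (-fderiv ℝ (coordHam g x₀) y)

theorem stdForm_coordField (g : Metric n M) (x₀ : M) (y w : PhaseSpace n) :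
    stdForm n (coordField g x₀ y) w = -fderiv ℝ (coordHam g x₀) y w := by
  rw [← stdFlat_apply, coordField, ContinuousLinearEquiv.apply_symm_apply]
  rfl

theorem contDiffAt_coordField (g : Metric n M) (x₀ : M) {y : PhaseSpace n}
    (hy : y.1 ∈ (extChartAt (𝓡 n) x₀).target) (h : y.2 ≠ 0) :
    ContDiffAt ℝ ∞ (coordField g x₀) y :=
  contDiffAt_symplecticGradient (stdFlat n) (contDiffAt_coordHam g x₀ hy h)

theorem fderiv_coordHam_coordField (g : Metric n M) (x₀ : M) (y : PhaseSpace n) :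
    fderiv ℝ (coordHam g x₀) y (coordField g x₀ y) = 0 := by
  have h := stdForm_coordField g x₀ y (coordField g x₀ y)
  rw [stdForm_apply, sub_self] at h
  linarith

theorem coordHam_smul (g : Metric n M) (x₀ : M) (u : EuclideanSpace ℝ (Fin n))
    (η : EuclideanSpace ℝ (Fin n) →L[ℝ] ℝ) {c : ℝ} (hc : 0 ≤ c) :
    coordHam g x₀ (u, c • η) = c * coordHam g x₀ (u, η) := by
  unfold coordHam
  simp only [map_smul, smul_apply, smul_eq_mul]
  rw [← mul_assoc, Real.sqrt_mul (mul_self_nonneg c), Real.sqrt_mul_self hc]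

/-- Euler's identity: `H` is homogeneous of degree one in `η`, and the base component of the field
is `∂H/∂η`. Consequently the field is nowhere vertical off the zero section. -/
theorem coordField_pairing (g : Metric n M) (x₀ : M) {y : PhaseSpace n}
    (hy : y.1 ∈ (extChartAt (𝓡 n) x₀).target) (h : y.2 ≠ 0) :
    y.2 (coordField g x₀ y).1 = coordHam g x₀ y := by
  have h1 := stdForm_coordField g x₀ y (0, y.2)
  simp only [stdForm_apply, map_zero, zero_sub, neg_inj] at h1
  rw [h1]
  have h2 : HasDerivAt (fun s : ℝ => ((y.1, s • y.2) : PhaseSpace n)) (0, y.2) 1 :=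
    (hasDerivAt_const _ _).prodMk (by simpa using (hasDerivAt_id (1 : ℝ)).smul_const y.2)
  have h3 : HasDerivAt (fun s : ℝ => coordHam g x₀ (y.1, s • y.2))
      (fderiv ℝ (coordHam g x₀) y (0, y.2)) 1 := by
    have hd : HasFDerivAt (coordHam g x₀) (fderiv ℝ (coordHam g x₀) y) (y.1, (1 : ℝ) • y.2) := by
      rw [one_smul]
      exact ((contDiffAt_coordHam g x₀ hy h).differentiableAt (by simp)).hasFDerivAt
    exact hd.comp_hasDerivAt 1 h2
  have h4 : HasDerivAt (fun s : ℝ => coordHam g x₀ (y.1, s • y.2)) (coordHam g x₀ y) 1 := by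
    have h5 : HasDerivAt (fun s : ℝ => s * coordHam g x₀ y) (coordHam g x₀ y) 1 := by
      simpa using (hasDerivAt_id (1 : ℝ)).mul_const (coordHam g x₀ y)
    refine h5.congr_of_eventuallyEq ?_
    filter_upwards [lt_mem_nhds (zero_lt_one (α := ℝ))] with s hs
    exact coordHam_smul g x₀ y.1 y.2 hs.le
  exact h3.unique h4

/-- The defining equation of `geodesicField` is solvable because the chart differential is onto, and
determined because the standard form is nondegenerate, so the chosen vector has the expected
coordinates. -/
theorem geodesicField_eq (g : Metric n M) {p₀ p : Cotangent n M}
    (hp : p ∈ (extChartAt (cotangentModel n) p₀).source) (h0 : 0 < conorm g p) :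
    chartDeriv p₀ p (geodesicField g p) =
      coordField g p₀.proj (extChartAt (cotangentModel n) p₀ p) := by
  have hy : (extChartAt (cotangentModel n) p₀ p).1 ∈ (extChartAt (𝓡 n) p₀.proj).target := by
    have := (extChartAt (cotangentModel n) p₀).map_source hp
    rw [cotangent_extChartAt_target] at this
    exact this.1
  rw [conorm_eq g hp] at h0
  have hne := (coordHam_pos_iff g p₀.proj hy).1 h0
  have hd : HasMFDerivAt (cotangentModel n) 𝓘(ℝ, ℝ) (conorm g) p
      ((fderiv ℝ (coordHam g p₀.proj) (extChartAt (cotangentModel n) p₀ p)).comp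
        (chartDeriv p₀ p)) := by
    have h1 : HasMFDerivAt (cotangentModel n) 𝓘(ℝ, ℝ)
        (fun q => coordHam g p₀.proj (extChartAt (cotangentModel n) p₀ q)) p
        ((fderiv ℝ (coordHam g p₀.proj) (extChartAt (cotangentModel n) p₀ p)).comp
        (chartDeriv p₀ p)) :=
      (((contDiffAt_coordHam g p₀.proj hy hne).differentiableAt
        (by simp)).hasFDerivAt.hasMFDerivAt).comp p (hasMFDerivAt_chart hp)
    refine h1.congr_of_eventuallyEq ?_
    filter_upwards [(isOpen_extChartAt_source p₀).mem_nhds hp] with q hq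
    exact conorm_eq g hq
  have hw : ∀ w : TangentSpace (cotangentModel n) p,
      (mfderiv (cotangentModel n) 𝓘(ℝ, ℝ) (conorm g) p w : ℝ) =
      fderiv ℝ (coordHam g p₀.proj) (extChartAt (cotangentModel n) p₀ p) (chartDeriv p₀ p w) :=
    fun w => DFunLike.congr_fun hd.mfderiv w
  obtain ⟨X, hX⟩ := (chartDeriv_bijective hp).2
    (coordField g p₀.proj (extChartAt (cotangentModel n) p₀ p))
  have hex : ∃ X : TangentSpace (cotangentModel n) p, ∀ w : TangentSpace (cotangentModel n) p,
      symplecticForm p X w = -(mfderiv (cotangentModel n) 𝓘(ℝ, ℝ) (conorm g) p w : ℝ) := by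
    refine ⟨X, fun w => ?_⟩
    rw [symplecticForm_eq hp, hw, hX, stdForm_coordField]
    rfl
  have hG : ∀ w : TangentSpace (cotangentModel n) p, symplecticForm p (geodesicField g p) w =
      -fderiv ℝ (coordHam g p₀.proj) (extChartAt (cotangentModel n) p₀ p) (chartDeriv p₀ p w) := by
    intro w
    unfold geodesicField
    rw [dif_pos hex]
    exact (hex.choose_spec w).trans (congrArg Neg.neg (hw w))
  apply (stdFlat n).injective
  refine ContinuousLinearMap.ext fun w => ?_
  obtain ⟨v, rfl⟩ := (chartDeriv_bijective hp).2 w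
  rw [stdFlat_apply, stdFlat_apply, stdForm_coordField, ← hG v, symplecticForm_eq hp]

/-- The reversal `(u, η) ↦ (u, -η)` in coordinates. -/
def coordReversal (n : ℕ) : PhaseSpace n ≃L[ℝ] PhaseSpace n :=
  (ContinuousLinearEquiv.refl ℝ _).prodCongr (ContinuousLinearEquiv.neg ℝ)

theorem coordReversal_apply (y : PhaseSpace n) : coordReversal n y = (y.1, -y.2) := rfl

/-- Reversal preserves `H` and changes the sign of the symplectic form, so it carries the
Hamiltonian field to its negative. -/
theorem coordField_reversal (g : Metric n M) (x₀ : M) (y : PhaseSpace n) :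
    coordField g x₀ (coordReversal n y) = -coordReversal n (coordField g x₀ y) := by
  have h1 : coordHam g x₀ ∘ coordReversal n = coordHam g x₀ := by
    funext z
    simp [coordHam, coordReversal_apply]
  have h2 := (coordReversal n).comp_right_fderiv (f := coordHam g x₀) (x := y)
  rw [h1] at h2
  apply (stdFlat n).injective
  refine ContinuousLinearMap.ext fun w => ?_
  obtain ⟨v, rfl⟩ := (coordReversal n).surjective w
  have h3 : fderiv ℝ (coordHam g x₀) y v =
    fderiv ℝ (coordHam g x₀) (coordReversal n y) (coordReversal n v) := DFunLike.congr_fun h2 v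
  rw [stdFlat_apply, stdFlat_apply, stdForm_coordField, ← h3, ← stdForm_coordField]
  simp only [stdForm_apply, coordReversal_apply, map_neg, neg_apply]
  ring

/-- The reversal `(x, ξ) ↦ (x, -ξ)` of the cotangent bundle. -/
def reversal (p : Cotangent n M) : Cotangent n M :=
  ⟨p.proj, -(p.snd : TangentSpace (𝓡 n) p.proj →L[ℝ] ℝ)⟩

theorem reversal_proj (p : Cotangent n M) : (reversal p).proj = p.proj := rfl

theorem reversal_reversal (p : Cotangent n M) : reversal (reversal p) = p := by
  rcases p with ⟨x, ξ⟩
  exact congrArg (TotalSpace.mk x) (neg_neg (ξ : TangentSpace (𝓡 n) x →L[ℝ] ℝ))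

theorem reversal_mem_source {p₀ p : Cotangent n M} :
    reversal p ∈ (extChartAt (cotangentModel n) p₀).source ↔
      p ∈ (extChartAt (cotangentModel n) p₀).source := by
  rw [mem_cotangent_source, mem_cotangent_source, reversal_proj]

theorem extChartAt_reversal (p₀ p : Cotangent n M) :
    extChartAt (cotangentModel n) p₀ (reversal p) =
      coordReversal n (extChartAt (cotangentModel n) p₀ p) := by
  rw [cotangent_extChartAt_apply, cotangent_extChartAt_apply, coordReversal_apply]
  exact Prod.ext rfl (ContinuousLinearMap.ext fun v => rfl)

theorem conorm_reversal (g : Metric n M) (p : Cotangent n M) :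
    conorm g (reversal p) = conorm g p := by
  have hp : p ∈ (extChartAt (cotangentModel n) p).source := mem_extChartAt_source p
  rw [conorm_eq g (reversal_mem_source.2 hp), conorm_eq g hp, extChartAt_reversal]
  simp [coordHam, coordReversal_apply]

theorem conorm_pos_iff (g : Metric n M) {p₀ p : Cotangent n M}
    (hp : p ∈ (extChartAt (cotangentModel n) p₀).source) :
    0 < conorm g p ↔ (extChartAt (cotangentModel n) p₀ p).2 ≠ 0 := by
  have := (extChartAt (cotangentModel n) p₀).map_source hp
  rw [cotangent_extChartAt_target] at this
  rw [conorm_eq g hp, coordHam_pos_iff g _ this.1]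

theorem isOpen_conorm_pos (g : Metric n M) : IsOpen {p : Cotangent n M | 0 < conorm g p} := by
  rw [isOpen_iff_mem_nhds]
  intro p hp
  have hs : p ∈ (extChartAt (cotangentModel n) p).source := mem_extChartAt_source p
  have h1 : ContinuousAt (fun q => (extChartAt (cotangentModel n) p q).2) p :=
    continuous_snd.continuousAt.comp (continuousAt_extChartAt p)
  filter_upwards [(isOpen_extChartAt_source p).mem_nhds hs,
    h1.preimage_mem_nhds (isOpen_compl_singleton.mem_nhds ((conorm_pos_iff g hs).1 hp))] with q hq hq'
  exact (conorm_pos_iff g hq).2 hq'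

theorem mem_target_of_mem_source {p₀ p : Cotangent n M}
    (hp : p ∈ (extChartAt (cotangentModel n) p₀).source) :
    (extChartAt (cotangentModel n) p₀ p).1 ∈ (extChartAt (𝓡 n) p₀.proj).target := by
  have := (extChartAt (cotangentModel n) p₀).map_source hp
  rw [cotangent_extChartAt_target] at this
  exact this.1

end CoordinateFlowField

/-! ### Energy conservation and uniqueness of geodesic curves -/

section GeodesicCurves

open Topology Filter

variable {n : ℕ} {M : Type*} [TopologicalSpace M] [ChartedSpace (EuclideanSpace ℝ (Fin n)) M]
  [IsManifold (𝓡 n) ∞ M]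

set_option synthInstance.maxHeartbeats 200000

section Generic

variable {F : Type*} [NormedAddCommGroup F] [NormedSpace ℝ F]

theorem HasMFDerivWithinAt.hasDerivWithinAt {f : ℝ → F} {s : Set ℝ} {t : ℝ} {L : ℝ →L[ℝ] F}
    (h : HasMFDerivWithinAt 𝓘(ℝ, ℝ) 𝓘(ℝ, F) f s t L) : HasDerivWithinAt f (L 1) s t :=
  have h' : HasFDerivWithinAt f L s t := h.hasFDerivWithinAt
  h'.hasDerivWithinAt

theorem HasDerivWithinAt.comp_neg {f : ℝ → F} {f' : F} {s s' : Set ℝ} {t : ℝ}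
    (h : HasDerivWithinAt f f' s t) (hs : MapsTo Neg.neg s' s) :
    HasDerivWithinAt (fun r => f (-r)) (-f') s' (-t) := by
  have h2 := HasDerivWithinAt.scomp (h := Neg.neg) (-t) (t' := s)
    (by rw [neg_neg]; exact h) (hasDerivAt_neg (-t)).hasDerivWithinAt hs
  simpa [Function.comp_def] using h2

end Generic

/-- The velocity of `γ` at time `t`, within `s`, is the geodesic field. -/
abbrev HasGeodesicVelocity (g : Metric n M) (γ : ℝ → Cotangent n M) (s : Set ℝ) (t : ℝ) : Prop :=
  HasMFDerivWithinAt 𝓘(ℝ, ℝ) (cotangentModel n) γ s t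
    ((1 : ℝ →L[ℝ] ℝ).smulRight (geodesicField g (γ t)))

theorem contMDiffAt_chart_symm {p₀ p : Cotangent n M}
    (hp : p ∈ (extChartAt (cotangentModel n) p₀).source) :
    ContMDiffAt 𝓘(ℝ, PhaseSpace n) (cotangentModel n) ∞ (extChartAt (cotangentModel n) p₀).symm
      (extChartAt (cotangentModel n) p₀ p) :=
  (contMDiffOn_extChartAt_symm p₀).contMDiffAt ((isOpen_extChartAt_target p₀).mem_nhds
    ((extChartAt (cotangentModel n) p₀).map_source hp))

theorem mfderiv_chart_symm_chartDeriv {p₀ p : Cotangent n M}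
    (hp : p ∈ (extChartAt (cotangentModel n) p₀).source)
    (v : TangentSpace (cotangentModel n) p) :
    (mfderiv 𝓘(ℝ, PhaseSpace n) (cotangentModel n) (extChartAt (cotangentModel n) p₀).symm
      (extChartAt (cotangentModel n) p₀ p) (chartDeriv p₀ p v) : PhaseSpace n) = v := by
  have h1 := HasMFDerivAt.comp p (chart_symm_hasMFDerivAt
    ((extChartAt (cotangentModel n) p₀).map_source hp)) (hasMFDerivAt_chart hp)
  have h2 : ((extChartAt (cotangentModel n) p₀).symm ∘ extChartAt (cotangentModel n) p₀)
      =ᶠ[𝓝 p] id := by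
    filter_upwards [(isOpen_extChartAt_source p₀).mem_nhds hp] with q hq
    exact (extChartAt (cotangentModel n) p₀).left_inv hq
  have h3 := hasMFDerivAt_unique (h1.congr_of_eventuallyEq h2.symm) (hasMFDerivAt_id p)
  exact DFunLike.congr_fun h3 v

/-- Translates the velocity condition on the manifold into an ordinary differential equation in any
chart containing the point. Continuity is listed separately because a curve that leaves the chart
could have a differentiable coordinate expression. -/
theorem hasGeodesicVelocity_iff (g : Metric n M) {γ : ℝ → Cotangent n M} {s : Set ℝ} {t : ℝ}
    {p₀ : Cotangent n M} (hs : γ t ∈ (extChartAt (cotangentModel n) p₀).source)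
    (hpos : 0 < conorm g (γ t)) :
    HasGeodesicVelocity g γ s t ↔ ContinuousWithinAt γ s t ∧
      HasDerivWithinAt (fun r => extChartAt (cotangentModel n) p₀ (γ r))
        (coordField g p₀.proj (extChartAt (cotangentModel n) p₀ (γ t))) s t := by
  constructor
  · intro h
    refine ⟨h.continuousWithinAt, ?_⟩
    have h1 := (HasMFDerivAt.comp_hasMFDerivWithinAt t (hasMFDerivAt_chart hs) h)
    let L : ℝ →L[ℝ] PhaseSpace n := ContinuousLinearMap.toSpanSingleton ℝ
      (coordField g p₀.proj (extChartAt (cotangentModel n) p₀ (γ t)))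
    have hL : L = ContinuousLinearMap.comp (chartDeriv p₀ (γ t))
        ((1 : ℝ →L[ℝ] ℝ).smulRight (geodesicField g (γ t))) := by
      refine ContinuousLinearMap.ext fun c => ?_
      change c • coordField g p₀.proj (extChartAt (cotangentModel n) p₀ (γ t)) =
        chartDeriv p₀ (γ t) (c • geodesicField g (γ t))
      rw [map_smul, geodesicField_eq g hs hpos]
    have h2 : HasMFDerivWithinAt 𝓘(ℝ, ℝ) 𝓘(ℝ, PhaseSpace n)
        (fun r => extChartAt (cotangentModel n) p₀ (γ r)) s t L := by
      rw [hL]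
      exact h1
    have h3 := HasMFDerivWithinAt.hasDerivWithinAt h2
    have h4 : L 1 = coordField g p₀.proj (extChartAt (cotangentModel n) p₀ (γ t)) :=
      one_smul ℝ _
    exact h4 ▸ h3
  · rintro ⟨hc, hd⟩
    have h1 := HasMFDerivAt.comp_hasMFDerivWithinAt t
      (f := fun r => extChartAt (cotangentModel n) p₀ (γ r)) (chart_symm_hasMFDerivAt
      ((extChartAt (cotangentModel n) p₀).map_source hs)) hd.hasFDerivWithinAt.hasMFDerivWithinAt
    have h2 : γ =ᶠ[𝓝[s] t] ((extChartAt (cotangentModel n) p₀).symm ∘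
        fun r => extChartAt (cotangentModel n) p₀ (γ r)) := by
      filter_upwards [hc ((isOpen_extChartAt_source p₀).mem_nhds hs)] with r hr
      exact ((extChartAt (cotangentModel n) p₀).left_inv hr).symm
    have h3 := h1.congr_of_eventuallyEq h2
      ((extChartAt (cotangentModel n) p₀).left_inv hs).symm
    have hD := mfderiv_chart_symm_chartDeriv hs (geodesicField g (γ t))
    rw [geodesicField_eq g hs hpos] at hD
    let D : PhaseSpace n →L[ℝ] PhaseSpace n := mfderiv 𝓘(ℝ, PhaseSpace n) (cotangentModel n)
      (extChartAt (cotangentModel n) p₀).symm (extChartAt (cotangentModel n) p₀ (γ t))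
    have hL : ((1 : ℝ →L[ℝ] ℝ).smulRight (geodesicField g (γ t)) : ℝ →L[ℝ] PhaseSpace n) =
        D.comp (ContinuousLinearMap.toSpanSingleton ℝ
          (coordField g p₀.proj (extChartAt (cotangentModel n) p₀ (γ t)))) := by
      refine ContinuousLinearMap.ext fun c => ?_
      change c • (geodesicField g (γ t) : PhaseSpace n) = D (c •
        coordField g p₀.proj (extChartAt (cotangentModel n) p₀ (γ t)))
      rw [map_smul]
      exact congrArg (fun v : PhaseSpace n => c • v) hD.symm
    have h4 : HasMFDerivWithinAt 𝓘(ℝ, ℝ) (cotangentModel n) γ s t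
      (D.comp (ContinuousLinearMap.toSpanSingleton ℝ
          (coordField g p₀.proj (extChartAt (cotangentModel n) p₀ (γ t)))) : ℝ →L[ℝ] PhaseSpace n) := h3
    rw [← hL] at h4
    exact h4

theorem continuous_conorm (g : Metric n M) : Continuous (conorm g) := by
  rw [continuous_iff_continuousAt]
  intro p
  have hs : p ∈ (extChartAt (cotangentModel n) p).source := mem_extChartAt_source p
  have hy := mem_target_of_mem_source hs
  have h1 : ContDiffAt ℝ ∞ (metricInChart g p.proj) (extChartAt (cotangentModel n) p p).1 :=
    (contDiffOn_metricInChart g p.proj).contDiffAt ((isOpen_extChartAt_target _).mem_nhds hy)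
  have h2 : ContinuousAt (fun z : PhaseSpace n => (metricInChart g p.proj z.1).inverse)
      (extChartAt (cotangentModel n) p p) :=
    ContinuousAt.comp (f := fun z : PhaseSpace n => metricInChart g p.proj z.1)
      (g := ContinuousLinearMap.inverse)
      ((posDef_isInvertible (metricInChart_pos g p.proj hy)).contDiffAt_map_inverse
        (n := 1)).continuousAt
      (ContinuousAt.comp (f := Prod.fst) h1.continuousAt continuousAt_fst)
  have h3 : ContinuousAt (coordHam g p.proj) (extChartAt (cotangentModel n) p p) :=
    (continuousAt_snd.clm_apply (h2.clm_apply continuousAt_snd)).sqrt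
  refine (ContinuousAt.comp (f := extChartAt (cotangentModel n) p) h3
    (continuousAt_extChartAt p)).congr ?_
  filter_upwards [(isOpen_extChartAt_source p).mem_nhds hs] with q hq
  exact (conorm_eq g hq).symm

theorem contMDiff_reversal :
    ContMDiff (cotangentModel n) (cotangentModel n) ∞ (reversal : Cotangent n M → Cotangent n M) := by
  intro p
  have hs : p ∈ (extChartAt (cotangentModel n) p).source := mem_extChartAt_source p
  have h1 : ContMDiffAt (cotangentModel n) 𝓘(ℝ, PhaseSpace n) ∞
      (fun q => coordReversal n (extChartAt (cotangentModel n) p q)) p :=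
    (coordReversal n).contDiff.contMDiff.contMDiffAt.comp p contMDiffAt_extChartAt
  have h2 : ContMDiffAt 𝓘(ℝ, PhaseSpace n) (cotangentModel n) ∞
      (extChartAt (cotangentModel n) p).symm
      (coordReversal n (extChartAt (cotangentModel n) p p)) := by
    rw [← extChartAt_reversal]
    exact contMDiffAt_chart_symm (reversal_mem_source.2 hs)
  refine (h2.comp p h1).congr_of_eventuallyEq ?_
  filter_upwards [(isOpen_extChartAt_source p).mem_nhds hs] with q hq
  change _ = (extChartAt (cotangentModel n) p).symm (coordReversal n (extChartAt (cotangentModel n) p q))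
  rw [← extChartAt_reversal, (extChartAt (cotangentModel n) p).left_inv (reversal_mem_source.2 hq)]

theorem HasGeodesicVelocity.reversal {g : Metric n M} {γ : ℝ → Cotangent n M} {s s' : Set ℝ} {t : ℝ}
    (h : HasGeodesicVelocity g γ s t) (hpos : 0 < conorm g (γ t)) (hs : MapsTo Neg.neg s' s) :
    HasGeodesicVelocity g (fun r => BlowDown.reversal (γ (-r))) s' (-t) := by
  have hm : γ t ∈ (extChartAt (cotangentModel n) (γ t)).source := mem_extChartAt_source _
  obtain ⟨hc, hd⟩ := (hasGeodesicVelocity_iff g hm hpos).1 h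
  have hm' : BlowDown.reversal (γ (- -t)) ∈ (extChartAt (cotangentModel n) (γ t)).source := by
    rw [neg_neg]
    exact reversal_mem_source.2 hm
  rw [hasGeodesicVelocity_iff g (γ := fun r => BlowDown.reversal (γ (-r))) (t := -t) hm'
    (by rwa [neg_neg, conorm_reversal])]
  constructor
  · refine contMDiff_reversal.continuous.continuousAt.comp_continuousWithinAt
      (ContinuousWithinAt.comp (t := s) ?_ continuous_neg.continuousWithinAt hs)
    rwa [neg_neg]
  · have h1 : HasDerivWithinAt (fun r => extChartAt (cotangentModel n) (γ t) (γ (-r)))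
        (-coordField g (γ t).proj (extChartAt (cotangentModel n) (γ t) (γ t))) s' (-t) :=
      HasDerivWithinAt.comp_neg hd hs
    have h3 := (coordReversal n).hasFDerivAt.comp_hasDerivWithinAt (-t) h1
    simp only [extChartAt_reversal, coordField_reversal, neg_neg]
    rw [map_neg] at h3
    exact h3

/-- A curve on `[0, b]` that follows the geodesic field as long as it is off the zero section. -/
structure IsForwardCurve (g : Metric n M) (γ : ℝ → Cotangent n M) (b : ℝ) : Prop where
  continuousOn : ContinuousOn γ (Icc 0 b)
  velocity : ∀ x ∈ Ico 0 b, 0 < conorm g (γ x) → HasGeodesicVelocity g γ (Ici x) x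

theorem isForwardCurve_of_integralCurve {g : Metric n M} {γ : ℝ → Cotangent n M} {b : ℝ}
    (h : IsMIntegralCurveOn (I := cotangentModel n) γ (geodesicField g) (Icc 0 b)) :
    IsForwardCurve g γ b where
  continuousOn x hx := (h x hx).continuousWithinAt
  velocity x hx _ := (h x (Ico_subset_Icc_self hx)).mono_of_mem_nhdsWithin
    (mem_of_superset (Icc_mem_nhdsGE hx.2) (Icc_subset_Icc_left hx.1))

theorem isForwardCurve_of_integralCurve_neg {g : Metric n M} {γ : ℝ → Cotangent n M} {b : ℝ}
    (h : IsMIntegralCurveOn (I := cotangentModel n) γ (geodesicField g) (Icc (-b) 0)) :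
    IsForwardCurve g (fun r => reversal (γ (-r))) b where
  continuousOn x hx := contMDiff_reversal.continuous.continuousAt.comp_continuousWithinAt
    (ContinuousWithinAt.comp (t := Icc (-b) 0) (h (-x) ⟨by linarith [hx.2], by
      linarith [hx.1]⟩).continuousWithinAt continuous_neg.continuousWithinAt
        fun y hy => ⟨by linarith [hy.2], by linarith [hy.1]⟩)
  velocity x hx hpos := by
    have h1 : HasGeodesicVelocity g γ (Iic (-x)) (-x) :=
      (h (-x) ⟨by linarith [hx.2], by linarith [hx.1]⟩).mono_of_mem_nhdsWithin
        (mem_of_superset (Icc_mem_nhdsLE (by linarith [hx.2] : -b < -x))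
          (Icc_subset_Icc_right (by linarith [hx.1])))
    have h2 := h1.reversal (s' := Ici x) (by rwa [conorm_reversal] at hpos)
      (fun y hy => neg_le_neg (mem_Ici.1 hy))
    rwa [neg_neg] at h2

theorem HasGeodesicVelocity.conorm {g : Metric n M} {γ : ℝ → Cotangent n M} {s : Set ℝ} {t : ℝ}
    (h : HasGeodesicVelocity g γ s t) (hpos : 0 < conorm g (γ t)) :
    HasDerivWithinAt (fun r => BlowDown.conorm g (γ r)) 0 s t := by
  have hm : γ t ∈ (extChartAt (cotangentModel n) (γ t)).source := mem_extChartAt_source _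
  obtain ⟨hc, hd⟩ := (hasGeodesicVelocity_iff g hm hpos).1 h
  have h1 := ((contDiffAt_coordHam g (γ t).proj (mem_target_of_mem_source hm)
    ((conorm_pos_iff g hm).1 hpos)).differentiableAt (by simp)).hasFDerivAt.comp_hasDerivWithinAt t hd
  rw [fderiv_coordHam_coordField] at h1
  refine h1.congr_of_eventuallyEq ?_ (conorm_eq g hm)
  filter_upwards [hc ((isOpen_extChartAt_source _).mem_nhds hm)] with r hr
  exact conorm_eq g hr

/-- Continuous induction on `[0, b]` in terms of right neighbourhoods `[t, t + δ]`. -/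
theorem forall_Icc_of_right_open {b : ℝ} {P : ℝ → Prop} (hcl : IsClosed ({t | P t} ∩ Icc 0 b))
    (h0 : P 0) (hr : ∀ t ∈ Ico 0 b, P t → ∃ δ > 0, ∀ s ∈ Icc t (t + δ), s ≤ b → P s) :
    ∀ t ∈ Icc 0 b, P t := by
  refine hcl.Icc_subset_of_forall_mem_nhdsWithin h0 ?_
  rintro t ⟨ht, htb⟩
  obtain ⟨δ, hδ, h⟩ := hr t htb ht
  have hlt : t < min (t + δ) b := lt_min (by linarith) htb.2
  filter_upwards [Ioc_mem_nhdsGT hlt] with s hs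
  exact h s ⟨hs.1.le, hs.2.trans (min_le_left _ _)⟩ (hs.2.trans (min_le_right _ _))

theorem exists_right_neighbourhood {X : Type*} [TopologicalSpace X] {γ : ℝ → X} {b t : ℝ}
    (hc : ContinuousOn γ (Icc 0 b)) (ht : t ∈ Ico 0 b) {U : Set X} (hU : U ∈ 𝓝 (γ t)) :
    ∃ δ > 0, ∀ s ∈ Icc t (t + δ), s ≤ b → γ s ∈ U := by
  have h1 := (hc t (Ico_subset_Icc_self ht)) hU
  rw [mem_map, Metric.mem_nhdsWithin_iff] at h1
  obtain ⟨ε, hε, h⟩ := h1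
  refine ⟨ε / 2, by positivity, fun s hs hsb => h ⟨?_, ht.1.trans hs.1, hsb⟩⟩
  rw [Metric.mem_ball, Real.dist_eq, abs_of_nonneg (by linarith [hs.1])]
  linarith [hs.2]

/-- The field is controlled only off the zero section, and a curve is known to stay off it only once
its energy is conserved. Continuous induction breaks the circle: where the energy is still the
initial one, a right neighbourhood avoids the zero section, and there the energy has zero right
derivative. -/
theorem IsForwardCurve.conorm_eq {g : Metric n M} {γ : ℝ → Cotangent n M} {b : ℝ}
    (h : IsForwardCurve g γ b) (hpos : 0 < conorm g (γ 0)) :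
    ∀ t ∈ Icc 0 b, conorm g (γ t) = conorm g (γ 0) := by
  refine forall_Icc_of_right_open ?_ rfl ?_
  · have := ((continuous_conorm g).comp_continuousOn h.continuousOn).preimage_isClosed_of_isClosed
      isClosed_Icc (isClosed_singleton (x := conorm g (γ 0)))
    rwa [inter_comm] at this
  · intro t ht hP
    obtain ⟨δ, hδ, hU⟩ := exists_right_neighbourhood h.continuousOn ht
      ((isOpen_conorm_pos g).mem_nhds (show 0 < conorm g (γ t) by rwa [hP]))
    refine ⟨δ, hδ, fun s hs hsb => ?_⟩
    rw [← hP]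
    refine constant_of_has_deriv_right_zero (f := fun r => conorm g (γ r)) (a := t) (b := s)
      (((continuous_conorm g).comp_continuousOn h.continuousOn).mono
        (Icc_subset_Icc ht.1 hsb)) ?_ s ⟨hs.1, le_rfl⟩
    intro x hx
    have hp : 0 < conorm g (γ x) := hU x ⟨hx.1, hx.2.le.trans hs.2⟩ (hx.2.le.trans hsb)
    exact (h.velocity x ⟨ht.1.trans hx.1, hx.2.trans_le hsb⟩ hp).conorm hp

/-- Continuous induction again: the coincidence set is closed since `T*M` is Hausdorff, and extends
to the right by Lipschitz uniqueness in one chart. Energy conservation keeps the common point off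
the zero section, where the field is smooth. -/
theorem IsForwardCurve.eqOn [T2Space M] {g : Metric n M} {γ₁ γ₂ : ℝ → Cotangent n M} {b : ℝ}
    (h₁ : IsForwardCurve g γ₁ b) (h₂ : IsForwardCurve g γ₂ b) (h0 : γ₁ 0 = γ₂ 0)
    (hpos : 0 < conorm g (γ₁ 0)) : ∀ t ∈ Icc 0 b, γ₁ t = γ₂ t := by
  refine forall_Icc_of_right_open ?_ h0 ?_
  · have := (h₁.continuousOn.prodMk h₂.continuousOn).preimage_isClosed_of_isClosed
      isClosed_Icc (isClosed_diagonal)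
    rwa [inter_comm] at this
  · intro t ht hP
    set p := γ₁ t with hp
    have hm : p ∈ (extChartAt (cotangentModel n) p).source := mem_extChartAt_source _
    have hp0 : 0 < conorm g p := by rwa [hp, h₁.conorm_eq hpos t (Ico_subset_Icc_self ht)]
    obtain ⟨K, U, hU, hK⟩ := ((contDiffAt_coordField g p.proj (mem_target_of_mem_source hm)
      ((conorm_pos_iff g hm).1 hp0)).of_le (m := 1) (by simp)).exists_lipschitzOnWith
    have hV : (extChartAt (cotangentModel n) p).source ∩ {q | 0 < conorm g q} ∩
        extChartAt (cotangentModel n) p ⁻¹' U ∈ 𝓝 p :=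
      inter_mem (inter_mem ((isOpen_extChartAt_source p).mem_nhds hm)
        ((isOpen_conorm_pos g).mem_nhds hp0)) (continuousAt_extChartAt p hU)
    obtain ⟨δ₁, hδ₁, hs₁⟩ := exists_right_neighbourhood h₁.continuousOn ht hV
    obtain ⟨δ₂, hδ₂, hs₂⟩ := exists_right_neighbourhood h₂.continuousOn ht
      (show _ ∈ 𝓝 (γ₂ t) by rw [← hP]; exact hV)
    refine ⟨min δ₁ δ₂, lt_min hδ₁ hδ₂, fun s hs hsb => ?_⟩
    have key : ∀ γ : ℝ → Cotangent n M, IsForwardCurve g γ b → (∀ x ∈ Icc t s, γ x ∈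
        (extChartAt (cotangentModel n) p).source ∩ {q | 0 < conorm g q} ∩
        extChartAt (cotangentModel n) p ⁻¹' U) →
        ContinuousOn (fun x => extChartAt (cotangentModel n) p (γ x)) (Icc t s) ∧
        ∀ x ∈ Ico t s, HasDerivWithinAt (fun x => extChartAt (cotangentModel n) p (γ x))
          (coordField g p.proj (extChartAt (cotangentModel n) p (γ x))) (Ici x) x := by
      intro γ hγ hin
      refine ⟨(continuousOn_extChartAt p).comp (hγ.continuousOn.mono (Icc_subset_Icc ht.1 hsb))
        fun x hx => (hin x hx).1.1, fun x hx => ?_⟩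
      have hx' := hin x (Ico_subset_Icc_self hx)
      exact ((hasGeodesicVelocity_iff g hx'.1.1 hx'.1.2).1 (hγ.velocity x
        ⟨ht.1.trans hx.1, hx.2.trans_le hsb⟩ hx'.1.2)).2
    have hin₁ : ∀ x ∈ Icc t s, _ := fun x hx => hs₁ x ⟨hx.1, hx.2.trans (hs.2.trans
      (by linarith [min_le_left δ₁ δ₂]))⟩ (hx.2.trans hsb)
    have hin₂ : ∀ x ∈ Icc t s, _ := fun x hx => hs₂ x ⟨hx.1, hx.2.trans (hs.2.trans
      (by linarith [min_le_right δ₁ δ₂]))⟩ (hx.2.trans hsb)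
    obtain ⟨hc₁, hd₁⟩ := key γ₁ h₁ hin₁
    obtain ⟨hc₂, hd₂⟩ := key γ₂ h₂ hin₂
    have h := ODE_solution_unique_of_mem_Icc_right
      (v := fun _ => coordField g p.proj) (s := fun _ => U) (K := K) (fun _ _ => hK) hc₁ hd₁
      (fun x hx => (hin₁ x (Ico_subset_Icc_self hx)).2) hc₂ hd₂
      (fun x hx => (hin₂ x (Ico_subset_Icc_self hx)).2)
      (congrArg _ hP) ⟨hs.1, le_rfl⟩
    exact (extChartAt (cotangentModel n) p).injOn (hin₁ s ⟨hs.1, le_rfl⟩).1.1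
      (hin₂ s ⟨hs.1, le_rfl⟩).1.1 h

/-- An integral curve of the geodesic field off the zero section conserves the energy. -/
theorem conorm_integralCurve {g : Metric n M} {γ : ℝ → Cotangent n M} {t : ℝ}
    (h : IsMIntegralCurveOn (I := cotangentModel n) γ (geodesicField g) (uIcc 0 t))
    (hpos : 0 < conorm g (γ 0)) : ∀ s ∈ uIcc 0 t, conorm g (γ s) = conorm g (γ 0) := by
  intro s hs
  rcases le_total 0 t with ht | ht
  · rw [uIcc_of_le ht] at h hs
    exact (isForwardCurve_of_integralCurve h).conorm_eq hpos s hs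
  · rw [uIcc_of_ge ht] at h hs
    have h1 := (isForwardCurve_of_integralCurve_neg (b := -t) (by rwa [neg_neg])).conorm_eq
      (by simpa [conorm_reversal] using hpos) (-s) ⟨by linarith [hs.2], by linarith [hs.1]⟩
    simpa [conorm_reversal] using h1

/-- Negative times reduce to positive ones by running the curves backwards and reversing the
covectors. -/
theorem eq_of_integralCurve [T2Space M] {g : Metric n M} {γ₁ γ₂ : ℝ → Cotangent n M} {t : ℝ}
    (h₁ : IsMIntegralCurveOn (I := cotangentModel n) γ₁ (geodesicField g) (uIcc 0 t))
    (h₂ : IsMIntegralCurveOn (I := cotangentModel n) γ₂ (geodesicField g) (uIcc 0 t))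
    (h0 : γ₁ 0 = γ₂ 0) (hpos : 0 < conorm g (γ₁ 0)) : γ₁ t = γ₂ t := by
  rcases le_total 0 t with ht | ht
  · rw [uIcc_of_le ht] at h₁ h₂
    exact (isForwardCurve_of_integralCurve h₁).eqOn (isForwardCurve_of_integralCurve h₂) h0 hpos t
      ⟨ht, le_rfl⟩
  · rw [uIcc_of_ge ht] at h₁ h₂
    have h := (isForwardCurve_of_integralCurve_neg (γ := γ₁) (b := -t) (by rwa [neg_neg])).eqOn
      (isForwardCurve_of_integralCurve_neg (γ := γ₂) (b := -t) (by rwa [neg_neg]))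
      (by simp [h0]) (by simpa [conorm_reversal] using hpos) (-t) ⟨by linarith, le_rfl⟩
    rw [neg_neg] at h
    rw [← reversal_reversal (γ₁ t), h, reversal_reversal]

/-- The flow is defined through a chosen integral curve; uniqueness makes the choice irrelevant, so
any integral curve computes it. -/
theorem geodesicFlow_eq [T2Space M] {g : Metric n M} {γ : ℝ → Cotangent n M} {t : ℝ}
    (h : IsMIntegralCurveOn (I := cotangentModel n) γ (geodesicField g) (uIcc 0 t))
    (hpos : 0 < conorm g (γ 0)) : geodesicFlow g t (γ 0) = γ t := by
  have hex : FlowDefined g t (γ 0) := ⟨γ, rfl, h⟩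
  unfold geodesicFlow
  rw [dif_pos hex]
  exact eq_of_integralCurve hex.choose_spec.2 h hex.choose_spec.1
    (by rwa [hex.choose_spec.1])

end GeodesicCurves

/-! ### Hamiltonian flows on a vector space preserve the symplectic form -/

section HamiltonianFlow

open Topology Filter

section Linear

variable {V : Type*} [NormedAddCommGroup V] [NormedSpace ℝ V]

/-- Differentiating `β (X, ·) = -dh` identifies `β (DX a) b` with minus the second derivative of
`h`, which is symmetric. This is the infinitesimal form of symplecticity. -/
theorem hamiltonian_fderiv_skew {β : V →L[ℝ] V →L[ℝ] ℝ} (hanti : ∀ v w, β v w = -β w v)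
    {h : V → ℝ} {X : V → V} {U : Set V} (hU : IsOpen U) (hh : ContDiffOn ℝ ∞ h U)
    (hX : ContDiffOn ℝ ∞ X U) (hham : ∀ y ∈ U, ∀ w, β (X y) w = -fderiv ℝ h y w) {y : V}
    (hy : y ∈ U) (a b : V) : β (fderiv ℝ X y a) b + β a (fderiv ℝ X y b) = 0 := by
  have hhy : ContDiffAt ℝ ∞ h y := hh.contDiffAt (hU.mem_nhds hy)
  have hXy : HasFDerivAt X (fderiv ℝ X y) y :=
    ((hX.contDiffAt (hU.mem_nhds hy)).differentiableAt (by simp)).hasFDerivAt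
  have hdd : HasFDerivAt (fderiv ℝ h) (fderiv ℝ (fderiv ℝ h) y) y :=
    (((hhy.of_le (m := 2) (by simp [ENat.LEInfty.out])).fderiv_right (m := 1)
      (by norm_num)).differentiableAt (by simp)).hasFDerivAt
  have key : ∀ a b, β (fderiv ℝ X y a) b = -fderiv ℝ (fderiv ℝ h) y a b := by
    intro a b
    have h1 : HasFDerivAt (fun z => β (X z) b) ((β.flip b).comp (fderiv ℝ X y)) y :=
      (β.flip b).hasFDerivAt.comp y hXy
    have h2 : HasFDerivAt (fun z => fderiv ℝ h z b) ((fderiv ℝ (fderiv ℝ h) y).flip b) y := by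
      simpa using hdd.clm_apply (hasFDerivAt_const b y)
    have h3 : (fun z => β (X z) b) =ᶠ[𝓝 y] fun z => -fderiv ℝ h z b := by
      filter_upwards [hU.mem_nhds hy] with z hz
      exact hham z hz b
    exact DFunLike.congr_fun (h1.unique (h2.fun_neg.congr_of_eventuallyEq h3)) a
  have hsymm : fderiv ℝ (fderiv ℝ h) y a b = fderiv ℝ (fderiv ℝ h) y b a :=
    ((hhy.of_le (m := 2) (by simp [ENat.LEInfty.out])).isSymmSndFDerivAt (by simp)) a b
  rw [hanti a, key a b, key b a, hsymm]
  ring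

/-- The variational equation: the time and space derivatives of the flow commute by symmetry of the
second derivative of `(t, y) ↦ φ t y`, and the time derivative is `X ∘ φ`. -/
theorem hasDerivAt_fderiv_flow {X : V → V} {U : Set V} (hU : IsOpen U) (hX : ContDiffOn ℝ ∞ X U)
    {φ : ℝ → V → V} {J : Set ℝ} {B : Set V} (hJ : IsOpen J) (hB : IsOpen B)
    (hφ : ContDiffOn ℝ ∞ (fun p : ℝ × V => φ p.1 p.2) (J ×ˢ B))
    (hflow : ∀ y ∈ B, ∀ t ∈ J, φ t y ∈ U ∧ HasDerivAt (fun s => φ s y) (X (φ t y)) t)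
    {y : V} (hy : y ∈ B) {t : ℝ} (ht : t ∈ J) (v : V) :
    HasDerivAt (fun s => fderiv ℝ (φ s) y v) (fderiv ℝ X (φ t y) (fderiv ℝ (φ t) y v)) t := by
  set F : ℝ × V → V := fun p => φ p.1 p.2 with hF
  have hO : IsOpen (J ×ˢ B) := hJ.prod hB
  have hFd : ∀ p ∈ J ×ˢ B, HasFDerivAt F (fderiv ℝ F p) p := fun p hp =>
    ((hφ.contDiffAt (hO.mem_nhds hp)).differentiableAt (by simp)).hasFDerivAt
  have hspace : ∀ p ∈ J ×ˢ B, ∀ w, fderiv ℝ (φ p.1) p.2 w = fderiv ℝ F p (0, w) := by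
    intro p hp w
    have h1 : HasFDerivAt (φ p.1) ((fderiv ℝ F p).comp (ContinuousLinearMap.inr ℝ ℝ V)) p.2 :=
      HasFDerivAt.comp p.2 (g := F) (f := fun z => (p.1, z)) (hFd p hp)
        (hasFDerivAt_prodMk_right p.1 p.2)
    rw [h1.fderiv]
    rfl
  have htime : ∀ p ∈ J ×ˢ B, fderiv ℝ F p (1, 0) = X (F p) := by
    intro p hp
    have h1 : HasDerivAt (fun s => F (s, p.2)) (fderiv ℝ F p (1, 0)) p.1 :=
      HasFDerivAt.comp_hasDerivAt p.1 (l := F) (f := fun s => (s, p.2)) (hFd p hp)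
        ((hasDerivAt_id _).prodMk (hasDerivAt_const _ _))
    exact h1.unique (hflow p.2 hp.2 p.1 hp.1).2
  have hp : (t, y) ∈ J ×ˢ B := ⟨ht, hy⟩
  have hFc : ContDiffAt ℝ ∞ F (t, y) := hφ.contDiffAt (hO.mem_nhds hp)
  have hdd : HasFDerivAt (fderiv ℝ F) (fderiv ℝ (fderiv ℝ F) (t, y)) (t, y) :=
    (((hFc.of_le (m := 2) (by simp [ENat.LEInfty.out])).fderiv_right (m := 1)
      (by norm_num)).differentiableAt (by simp)).hasFDerivAt
  have hsymm : fderiv ℝ (fderiv ℝ F) (t, y) (1, 0) (0, v) =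
      fderiv ℝ (fderiv ℝ F) (t, y) (0, v) (1, 0) :=
    ((hFc.of_le (m := 2) (by simp [ENat.LEInfty.out])).isSymmSndFDerivAt (by simp)) _ _
  have h1 : HasDerivAt (fun s => fderiv ℝ F (s, y) (0, v))
      (fderiv ℝ (fderiv ℝ F) (t, y) (1, 0) (0, v)) t := by
    have h2 : HasDerivAt (fun s => fderiv ℝ F (s, y)) (fderiv ℝ (fderiv ℝ F) (t, y) (1, 0)) t :=
      HasFDerivAt.comp_hasDerivAt t (l := fderiv ℝ F) (f := fun s => (s, y)) hdd
        ((hasDerivAt_id _).prodMk (hasDerivAt_const _ _))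
    have h3 := HasDerivAt.clm_apply h2 (hasDerivAt_const t ((0 : ℝ), v))
    rw [map_zero, add_zero] at h3
    exact h3
  have h3 : fderiv ℝ (fderiv ℝ F) (t, y) (0, v) (1, 0) =
      fderiv ℝ X (φ t y) (fderiv ℝ (φ t) y v) := by
    have h4 : HasFDerivAt (fun p => fderiv ℝ F p (1, 0))
        ((fderiv ℝ (fderiv ℝ F) (t, y)).flip (1, 0)) (t, y) := by
      simpa using hdd.clm_apply (hasFDerivAt_const ((1 : ℝ), (0 : V)) (t, y))
    have h5 : HasFDerivAt (fun p => X (F p)) ((fderiv ℝ X (φ t y)).comp (fderiv ℝ F (t, y))) (t, y) :=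
      HasFDerivAt.comp (t, y) (g := X) (f := F)
        (((hX.contDiffAt (hU.mem_nhds (hflow y hy t ht).1)).differentiableAt (by simp)).hasFDerivAt)
        (hFd _ hp)
    have h6 : (fun p => fderiv ℝ F p (1, 0)) =ᶠ[𝓝 (t, y)] fun p => X (F p) := by
      filter_upwards [hO.mem_nhds hp] with p hp using htime p hp
    have h7 := DFunLike.congr_fun (h4.unique (h5.congr_of_eventuallyEq h6)) (0, v)
    rw [hspace _ hp]
    exact h7
  rw [← h3, ← hsymm]
  refine h1.congr_of_eventuallyEq ?_
  filter_upwards [hJ.mem_nhds ht] with s hs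
  exact hspace (s, y) ⟨hs, hy⟩ v

/-- Along the variational equation the pulled-back form has zero time derivative by
`hamiltonian_fderiv_skew`, and at time `0` the differential of the flow is the identity. -/
theorem hamiltonianFlow_preserves_form {β : V →L[ℝ] V →L[ℝ] ℝ} (hanti : ∀ v w, β v w = -β w v)
    {h : V → ℝ} {X : V → V} {U : Set V} (hU : IsOpen U) (hh : ContDiffOn ℝ ∞ h U)
    (hX : ContDiffOn ℝ ∞ X U) (hham : ∀ y ∈ U, ∀ w, β (X y) w = -fderiv ℝ h y w)
    {φ : ℝ → V → V} {ε : ℝ} (hε : 0 < ε) {B : Set V} (hB : IsOpen B)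
    (hφ : ContDiffOn ℝ ∞ (fun p : ℝ × V => φ p.1 p.2) (Ioo (-ε) ε ×ˢ B))
    (h0 : ∀ y ∈ B, φ 0 y = y)
    (hflow : ∀ y ∈ B, ∀ t ∈ Ioo (-ε) ε, φ t y ∈ U ∧ HasDerivAt (fun s => φ s y) (X (φ t y)) t)
    {y : V} (hy : y ∈ B) {t : ℝ} (ht : t ∈ Ioo (-ε) ε) (v w : V) :
    β (fderiv ℝ (φ t) y v) (fderiv ℝ (φ t) y w) = β v w := by
  have hd : ∀ s ∈ Ioo (-ε) ε,
      HasDerivAt (fun s => β (fderiv ℝ (φ s) y v) (fderiv ℝ (φ s) y w)) 0 s := by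
    intro s hs
    have h1 := hasDerivAt_fderiv_flow hU hX isOpen_Ioo hB hφ hflow hy hs v
    have h2 := hasDerivAt_fderiv_flow hU hX isOpen_Ioo hB hφ hflow hy hs w
    have h3 : HasDerivAt (fun s => β (fderiv ℝ (φ s) y v) (fderiv ℝ (φ s) y w))
        (β (fderiv ℝ X (φ s y) (fderiv ℝ (φ s) y v)) (fderiv ℝ (φ s) y w) +
          β (fderiv ℝ (φ s) y v) (fderiv ℝ X (φ s y) (fderiv ℝ (φ s) y w))) s :=
      (β.hasFDerivAt.comp_hasDerivAt s h1).clm_apply h2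
    have h4 := hamiltonian_fderiv_skew hanti hU hh hX hham (hflow y hy s hs).1
      (fderiv ℝ (φ s) y v) (fderiv ℝ (φ s) y w)
    rw [h4] at h3
    exact h3
  have h0' : fderiv ℝ (φ 0) y = ContinuousLinearMap.id ℝ V := by
    have : φ 0 =ᶠ[𝓝 y] id := by
      filter_upwards [hB.mem_nhds hy] with z hz using h0 z hz
    rw [this.fderiv_eq, fderiv_id]
  have h5 := isOpen_Ioo.is_const_of_deriv_eq_zero (isPreconnected_Ioo (a := -ε) (b := ε))
    (fun s hs => (hd s hs).differentiableAt.differentiableWithinAt)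
    (fun s hs => (hd s hs).deriv) ht (y := 0) ⟨by linarith, hε⟩
  rw [h5, h0']
  rfl

/-- A smooth field near a point agrees near the point with a globally smooth field. -/
theorem exists_contDiff_eventuallyEq [HasContDiffBump V] {X : V → V} {U : Set V} (hU : IsOpen U)
    (hX : ContDiffOn ℝ ∞ X U) {y : V} (hy : y ∈ U) :
    ∃ Y : V → V, ContDiff ℝ ∞ Y ∧ ∃ O ⊆ U, IsOpen O ∧ y ∈ O ∧ ∀ z ∈ O, Y z = X z := by
  obtain ⟨r, hr, hb⟩ := Metric.isOpen_iff.1 hU y hy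
  -- The cut-off is `1` on the ball of radius `r / 4` and supported in the closed ball of radius `r
  -- / 2`, inside `U`; so `χ • X` is smooth even where `X` is not.
  let χ : ContDiffBump y := ⟨r / 4, r / 2, by positivity, by linarith⟩
  refine ⟨fun z => χ z • X z, ?_, Metric.ball y (r / 4),
    (Metric.ball_subset_ball (by linarith)).trans hb, Metric.isOpen_ball,
    Metric.mem_ball_self (by positivity), fun z hz => ?_⟩
  · rw [contDiff_iff_contDiffAt]
    intro z
    by_cases hz : z ∈ Metric.ball y r
    · exact χ.contDiffAt.smul (hX.contDiffAt (hU.mem_nhds (hb hz)))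
    · have h0 : (fun z => χ z • X z) =ᶠ[𝓝 z] fun _ => 0 := by
        have h1 : (tsupport χ)ᶜ ∈ 𝓝 z := by
          refine (isClosed_tsupport _).isOpen_compl.mem_nhds fun h => hz ?_
          rw [χ.tsupport_eq] at h
          exact Metric.closedBall_subset_ball (by change r / 2 < r; linarith) h
        filter_upwards [h1] with x hx
        rw [image_eq_zero_of_notMem_tsupport hx, zero_smul]
      exact contDiffAt_const.congr_of_eventuallyEq h0
  · change χ z • X z = X z
    rw [χ.one_of_mem_closedBall (Metric.ball_subset_closedBall hz), one_smul]

end Linear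

end HamiltonianFlow

/-! ### The local geodesic flow is smooth and symplectic -/

section LocalGeodesicFlow

open Topology Filter

variable {n : ℕ} {M : Type*} [TopologicalSpace M] [ChartedSpace (EuclideanSpace ℝ (Fin n)) M]
  [IsManifold (𝓡 n) ∞ M]

set_option synthInstance.maxHeartbeats 200000

theorem stdForm_anti (v w : PhaseSpace n) : stdForm n v w = -stdForm n w v := by
  rw [stdForm_apply, stdForm_apply]
  ring

/-- The local flow theorem needs a globally smooth field, so it is applied to a cut-off field.
Confining the orbits to the open set `O` where the two fields agree makes them orbits of the
Hamiltonian field itself. -/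
theorem exists_coordFlow (g : Metric n M) (x₀ : M) {y₀ : PhaseSpace n}
    (hy₀ : y₀.1 ∈ (extChartAt (𝓡 n) x₀).target) (hne : y₀.2 ≠ 0) :
    ∃ ε > 0, ∃ B : Set (PhaseSpace n), IsOpen B ∧ y₀ ∈ B ∧ ∃ φ : ℝ → PhaseSpace n → PhaseSpace n,
      ContDiffOn ℝ ∞ (fun p : ℝ × PhaseSpace n => φ p.1 p.2) (Ioo (-ε) ε ×ˢ B) ∧
      ∀ y ∈ B, φ 0 y = y ∧ ∀ t ∈ Ioo (-ε) ε,
        ((φ t y).1 ∈ (extChartAt (𝓡 n) x₀).target ∧ (φ t y).2 ≠ 0) ∧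
        HasDerivAt (fun s => φ s y) (coordField g x₀ (φ t y)) t ∧
        ∀ v w, stdForm n (fderiv ℝ (φ t) y v) (fderiv ℝ (φ t) y w) = stdForm n v w := by
  set U : Set (PhaseSpace n) := (extChartAt (𝓡 n) x₀).target ×ˢ {0}ᶜ
  have hU : IsOpen U := (isOpen_extChartAt_target x₀).prod isOpen_compl_singleton
  have hX : ContDiffOn ℝ ∞ (coordField g x₀) U := fun y hy =>
    (contDiffAt_coordField g x₀ hy.1 hy.2).contDiffWithinAt
  obtain ⟨Y, hY, O, hOU, hO, hyO, hYX⟩ := exists_contDiff_eventuallyEq hU hX (y := y₀) ⟨hy₀, hne⟩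
  obtain ⟨ε, hε, B, hB, hyB, φ, hφ, hflow⟩ := exists_contDiffOn_localFlow Y hY y₀ (hO.mem_nhds hyO)
  have hflow' : ∀ y ∈ B, ∀ t ∈ Ioo (-ε) ε,
      φ t y ∈ O ∧ HasDerivAt (fun s => φ s y) (coordField g x₀ (φ t y)) t := by
    intro y hy t ht
    obtain ⟨h1, h2⟩ := (hflow y hy).2 t ht
    rw [hYX _ h1] at h2
    exact ⟨h1, h2⟩
  refine ⟨ε, hε, B, hB, hyB, φ, hφ, fun y hy => ⟨(hflow y hy).1, fun t ht => ?_⟩⟩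
  refine ⟨hOU (hflow' y hy t ht).1, (hflow' y hy t ht).2, fun v w => ?_⟩
  exact hamiltonianFlow_preserves_form stdForm_anti hO (h := coordHam g x₀)
    (fun z hz => (contDiffAt_coordHam g x₀ (hOU hz).1 (hOU hz).2).contDiffWithinAt)
    (hX.mono hOU) (fun z _ w => stdForm_coordField g x₀ z w) hε hB hφ
    (fun z hz => (hflow z hz).1) hflow' hy ht v w

theorem exists_localGeodesicFlow (g : Metric n M) {p₀ : Cotangent n M} (hp₀ : 0 < conorm g p₀) :
    ∃ ε > 0, ∃ W : Set (Cotangent n M), IsOpen W ∧ p₀ ∈ W ∧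
      ∃ φ : ℝ → Cotangent n M → Cotangent n M,
      ContMDiffOn (𝓘(ℝ, ℝ).prod (cotangentModel n)) (cotangentModel n) ∞
        (fun q : ℝ × Cotangent n M => φ q.1 q.2) (Ioo (-ε) ε ×ˢ W) ∧
      ∀ p ∈ W, φ 0 p = p ∧ 0 < conorm g p ∧ ∀ t ∈ Ioo (-ε) ε,
        HasGeodesicVelocity g (fun s => φ s p) univ t ∧
        ∀ v w : TangentSpace (cotangentModel n) p,
          symplecticForm (φ t p) (mfderiv (cotangentModel n) (cotangentModel n) (φ t) p v)
            (mfderiv (cotangentModel n) (cotangentModel n) (φ t) p w) = symplecticForm p v w := by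
  set e := extChartAt (cotangentModel n) p₀ with he
  have hm : p₀ ∈ e.source := mem_extChartAt_source p₀
  obtain ⟨ε, hε, B, hB, hyB, φ, hφ, hflow⟩ := exists_coordFlow g p₀.proj
    (mem_target_of_mem_source hm) ((conorm_pos_iff g hm).1 hp₀)
  have hW : IsOpen (e.source ∩ e ⁻¹' B ∩ {p | 0 < conorm g p}) :=
    ((continuousOn_extChartAt p₀).isOpen_inter_preimage (isOpen_extChartAt_source p₀) hB).inter
      (isOpen_conorm_pos g)
  have htarget : ∀ y ∈ B, ∀ t ∈ Ioo (-ε) ε, φ t y ∈ e.target := by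
    intro y hy t ht
    rw [he, cotangent_extChartAt_target]
    exact ⟨((hflow y hy).2 t ht).1.1, mem_univ _⟩
  have hright : ∀ y ∈ B, ∀ t ∈ Ioo (-ε) ε, e (e.symm (φ t y)) = φ t y :=
    fun y hy t ht => e.right_inv (htarget y hy t ht)
  have hsmooth : ContMDiffOn (𝓘(ℝ, ℝ).prod (cotangentModel n)) (cotangentModel n) ∞
      (fun q : ℝ × Cotangent n M => e.symm (φ q.1 (e q.2)))
      (Ioo (-ε) ε ×ˢ (e.source ∩ e ⁻¹' B ∩ {p | 0 < conorm g p})) := by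
    have h1 : ContMDiffOn (𝓘(ℝ, ℝ).prod (cotangentModel n)) 𝓘(ℝ, PhaseSpace n) ∞
        (fun q : ℝ × Cotangent n M => (e q.2 : PhaseSpace n))
        (Ioo (-ε) ε ×ˢ (e.source ∩ e ⁻¹' B ∩ {p | 0 < conorm g p})) :=
      (contMDiffOn_extChartAt (x := p₀)).comp contMDiffOn_snd (fun q hq => by
        have := hq.2.1.1
        rwa [he, extChartAt_source] at this)
    have h2 : ContMDiffOn (𝓘(ℝ, ℝ).prod (cotangentModel n)) 𝓘(ℝ, ℝ × PhaseSpace n) ∞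
        (fun q : ℝ × Cotangent n M => ((q.1, e q.2) : ℝ × PhaseSpace n))
        (Ioo (-ε) ε ×ˢ (e.source ∩ e ⁻¹' B ∩ {p | 0 < conorm g p})) :=
      contMDiffOn_fst.prodMk_space h1
    exact (contMDiffOn_extChartAt_symm p₀).comp (hφ.contMDiffOn.comp h2
      (fun q hq => ⟨hq.1, hq.2.1.2⟩)) (fun q hq => htarget _ hq.2.1.2 _ hq.1)
  refine ⟨ε, hε, _, hW, ⟨⟨hm, hyB⟩, hp₀⟩, fun t p => e.symm (φ t (e p)), hsmooth, ?_⟩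
  rintro p ⟨⟨hps, hpB⟩, hpos⟩
  have hzero : e.symm (φ 0 (e p)) = p := by rw [(hflow _ hpB).1, e.left_inv hps]
  refine ⟨hzero, hpos, fun t ht => ⟨?_, fun v w => ?_⟩⟩
  · have hs : e.symm (φ t (e p)) ∈ e.source := e.map_target (htarget _ hpB t ht)
    have hd := ((hflow _ hpB).2 t ht).2.1
    rw [hasGeodesicVelocity_iff g (γ := fun s => e.symm (φ s (e p))) hs (by
      rw [conorm_pos_iff g hs, ← he, hright _ hpB t ht]
      exact ((hflow _ hpB).2 t ht).1.2)]
    constructor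
    · rw [continuousWithinAt_univ]
      exact ContinuousAt.comp (f := fun s => φ s (e p)) (g := e.symm)
        ((continuousOn_extChartAt_symm p₀).continuousAt
          ((isOpen_extChartAt_target p₀).mem_nhds (htarget _ hpB t ht))) hd.continuousAt
    · rw [hasDerivWithinAt_univ, ← he, hright _ hpB t ht]
      refine hd.congr_of_eventuallyEq ?_
      filter_upwards [isOpen_Ioo.mem_nhds ht] with s hs
      exact hright _ hpB s hs
  · have hs : e.symm (φ t (e p)) ∈ e.source := e.map_target (htarget _ hpB t ht)
    have hφt : ∀ y ∈ B, ContDiffAt ℝ ∞ (φ t) y := fun y hy =>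
      ContDiffAt.comp y (g := fun q : ℝ × PhaseSpace n => φ q.1 q.2) (f := fun z => (t, z))
        (hφ.contDiffAt ((isOpen_Ioo.prod hB).mem_nhds ⟨ht, hy⟩)) (contDiffAt_const.prodMk contDiffAt_id)
    have hmd : MDifferentiableAt (cotangentModel n) (cotangentModel n)
        (fun q => e.symm (φ t (e q))) p := by
      have h1 : ContMDiffAt (cotangentModel n) (𝓘(ℝ, ℝ).prod (cotangentModel n)) ∞
          (fun q : Cotangent n M => (t, q)) p := contMDiffAt_const.prodMk contMDiffAt_id
      have h2 := (hsmooth.contMDiffAt ((isOpen_Ioo.prod hW).mem_nhds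
        (show (t, p) ∈ _ from ⟨ht, ⟨hps, hpB⟩, hpos⟩)))
      exact (h2.comp p h1).mdifferentiableAt (by simp)
    have key : ∀ u : TangentSpace (cotangentModel n) p,
        chartDeriv p₀ (e.symm (φ t (e p))) (mfderiv (cotangentModel n) (cotangentModel n)
          (fun q => e.symm (φ t (e q))) p u) = fderiv ℝ (φ t) (e p) (chartDeriv p₀ p u) := by
      intro u
      have h1 := HasMFDerivAt.comp p (hasMFDerivAt_chart hs) hmd.hasMFDerivAt
      have h2 : HasMFDerivAt (cotangentModel n) 𝓘(ℝ, PhaseSpace n) (fun q => φ t (e q)) p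
          ((fderiv ℝ (φ t) (e p)).comp (chartDeriv p₀ p)) :=
        (((hφt _ hpB).differentiableAt (by simp)).hasFDerivAt.hasMFDerivAt).comp p
          (hasMFDerivAt_chart hps)
      have h3 : (e ∘ fun q => e.symm (φ t (e q))) =ᶠ[𝓝 p] fun q => φ t (e q) := by
        filter_upwards [hW.mem_nhds (show p ∈ _ from ⟨⟨hps, hpB⟩, hpos⟩)] with q hq
        exact hright _ hq.1.2 t ht
      exact DFunLike.congr_fun (hasMFDerivAt_unique h1 (h2.congr_of_eventuallyEq h3)) u
    rw [symplecticForm_eq hs, symplecticForm_eq hps, key, key]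
    exact ((hflow _ hpB).2 t ht).2.2 _ _

theorem symplecticForm_nondegenerate {p : Cotangent n M} {v : TangentSpace (cotangentModel n) p}
    (h : ∀ w, symplecticForm p v w = 0) : v = 0 := by
  have hp : p ∈ (extChartAt (cotangentModel n) p).source := mem_extChartAt_source p
  apply (chartDeriv_bijective hp).1
  rw [map_zero]
  refine stdForm_nondegenerate fun w => ?_
  obtain ⟨u, rfl⟩ := (chartDeriv_bijective hp).2 w
  rw [← symplecticForm_eq hp]
  exact h u

end LocalGeodesicFlow

/-! ### Immersions from injective differentials -/

section Immersions

variable {E F : Type*} [NormedAddCommGroup E] [NormedSpace ℝ E] [NormedAddCommGroup F]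
  [NormedSpace ℝ F] [FiniteDimensional ℝ E] [FiniteDimensional ℝ F]
  {H G : Type*} [TopologicalSpace H] [TopologicalSpace G]
  {I : ModelWithCorners ℝ E H} {J : ModelWithCorners ℝ F G} [I.Boundaryless] [J.Boundaryless]
  {N P : Type*} [TopologicalSpace N] [ChartedSpace H N] [TopologicalSpace P] [ChartedSpace G P]
  [IsManifold I ∞ N] [IsManifold J ∞ P]

/-- The local normal form gives a complement depending on the point, while a single one is wanted.
All have dimension `dim F - dim E`, so a Euclidean space of that dimension serves everywhere. -/
theorem isImmersion_of_injective {f : N → P} (hf : ContMDiff I J ∞ f)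
    (hinj : ∀ x, Function.Injective (mfderiv I J f x)) : Manifold.IsImmersion I J ∞ f := by
  have h : Manifold.IsImmersionOfComplement
      (EuclideanSpace ℝ (Fin (Module.finrank ℝ F - Module.finrank ℝ E))) I J ∞ f := by
    intro x
    have h1 : Manifold.IsImmersionAt I J ∞ f x :=
      isImmersionAt_of_injective isOpen_univ hf.contMDiffOn (mem_univ x) (hinj x)
    have hfin : FiniteDimensional ℝ h1.complement :=
      FiniteDimensional.of_injective
        ((h1.equiv : (E × h1.complement) →ₗ[ℝ] F).comp (LinearMap.inr ℝ E h1.complement))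
        (h1.equiv.injective.comp LinearMap.inr_injective)
    have hdim := h1.equiv.toLinearEquiv.finrank_eq
    rw [Module.finrank_prod] at hdim
    exact h1.isImmersionAtOfComplement_complement.trans_F
      (ContinuousLinearEquiv.ofFinrankEq (by rw [finrank_euclideanSpace_fin]; omega))
  exact h.isImmersion

end Immersions

/-! ### Euclidean coordinates for a positive definite form -/

section EuclideanForms

/-- A positive definite symmetric form is Euclidean in suitable linear coordinates. -/
theorem exists_euclidean_coordinates {V : Type*} [AddCommGroup V] [Module ℝ V]
    [FiniteDimensional ℝ V] {k : ℕ} (hk : Module.finrank ℝ V = k) (b : V →ₗ[ℝ] V →ₗ[ℝ] ℝ)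
    (hsymm : ∀ v w, b v w = b w v) (hpos : ∀ v, v ≠ 0 → 0 < b v v) :
    ∃ C : EuclideanSpace ℝ (Fin k) ≃ₗ[ℝ] V, ∀ v, b (C v) (C v) = ‖v‖ ^ 2 := by
  let core : InnerProductSpace.Core ℝ V :=
    { inner := fun v w => b v w
      conj_inner_symm := fun v w => hsymm w v
      re_inner_nonneg := fun v => by
        by_cases hv : v = 0
        · simp [hv]
        · exact (hpos v hv).le
      add_left := fun u v w => by simp
      smul_left := fun u v c => by simp
      definite := fun v hv => by_contra fun h => (hpos v h).ne' hv }
  let _ : NormedAddCommGroup V := core.toNormedAddCommGroup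
  let _ : InnerProductSpace ℝ V := InnerProductSpace.ofCore core.toCore
  let B := (stdOrthonormalBasis ℝ V).reindex (finCongr hk)
  refine ⟨B.repr.symm.toLinearEquiv, fun v => ?_⟩
  have h1 : inner ℝ (B.repr.symm v) (B.repr.symm v) = ‖v‖ ^ 2 := by
    rw [real_inner_self_eq_norm_sq, LinearIsometryEquiv.norm_map]
  exact h1

end EuclideanForms

/-! ### The unit cosphere as an embedded sphere -/

section Cosphere

open Topology

set_option synthInstance.maxHeartbeats 200000

variable {m : ℕ} {M : Type*} [TopologicalSpace M] [ChartedSpace (EuclideanSpace ℝ (Fin (m + 1))) M]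
  [IsManifold (𝓡 (m + 1)) ∞ M]

/-- Take coordinates `C` orthonormal for the metric at `z` and lower the index: the dual norm of `G
(C v)` is the `G`-norm of `C v`, which is `‖v‖`. -/
theorem exists_coordHam_euclidean (g : Metric (m + 1) M) (z : M) :
    ∃ A : EuclideanSpace ℝ (Fin (m + 1)) ≃L[ℝ] (EuclideanSpace ℝ (Fin (m + 1)) →L[ℝ] ℝ),
      ∀ v, coordHam g z (extChartAt (𝓡 (m + 1)) z z, A v) = ‖v‖ := by
  have hu : extChartAt (𝓡 (m + 1)) z z ∈ (extChartAt (𝓡 (m + 1)) z).target :=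
    mem_extChartAt_target z
  set G := metricInChart g z (extChartAt (𝓡 (m + 1)) z z) with hG
  have hpos := metricInChart_pos g z hu
  let b : EuclideanSpace ℝ (Fin (m + 1)) →ₗ[ℝ] EuclideanSpace ℝ (Fin (m + 1)) →ₗ[ℝ] ℝ :=
    LinearMap.mk₂ ℝ (fun v w => G v w) (by simp) (by simp) (by simp) (by simp)
  obtain ⟨C, hC⟩ := exists_euclidean_coordinates (k := m + 1) finrank_euclideanSpace_fin b
    (metricInChart_symm g z hu) hpos
  obtain ⟨e, he⟩ := posDef_isInvertible hpos
  refine ⟨C.toContinuousLinearEquiv.trans e, fun v => ?_⟩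
  have h1 : coordHam g z (extChartAt (𝓡 (m + 1)) z z, e (C v)) = √(b (C v) (C v)) := by
    unfold coordHam
    rw [← he, ContinuousLinearMap.inverse_equiv]
    congr 1
    change e (C v) (e.symm (e (C v))) = G (C v) (C v)
    rw [e.symm_apply_apply, hG, ← he]
    rfl
  change coordHam g z (extChartAt (𝓡 (m + 1)) z z, e (C v)) = ‖v‖
  rw [h1, hC, Real.sqrt_sq (norm_nonneg v)]

open scoped EuclideanSpace in
/-- The unit cosphere is a smooth embedded sphere; a map into it is smooth if it is smooth as a map
into the cotangent bundle. -/
theorem exists_cosphere_manifold (g : Metric (m + 1) M) (z : M) :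
    ∃ (_ : ChartedSpace (EuclideanSpace ℝ (Fin m)) (cosphere g z))
      (_ : IsManifold (𝓡 m) ∞ (cosphere g z)),
      (∃ D : Metric.sphere (0 : EuclideanSpace ℝ (Fin (m + 1))) 1 ≃ₘ⟮𝓡 m, 𝓡 m⟯ cosphere g z,
        ∀ v, (D (-v) : Cotangent (m + 1) M) = reversal (D v : Cotangent (m + 1) M)) ∧
      ContMDiff (𝓡 m) (cotangentModel (m + 1)) ∞
        (Subtype.val : cosphere g z → Cotangent (m + 1) M) ∧
      (∀ ξ, Function.Injective (mfderiv (𝓡 m) (cotangentModel (m + 1))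
        (Subtype.val : cosphere g z → Cotangent (m + 1) M) ξ)) ∧
      ∀ f : cosphere g z → cosphere g z, ContMDiff (𝓡 m) (cotangentModel (m + 1)) ∞
        (fun ξ => (f ξ : Cotangent (m + 1) M)) → ContMDiff (𝓡 m) (𝓡 m) ∞ f := by
  obtain ⟨A, hA⟩ := exists_coordHam_euclidean g z
  -- The chart at the zero covector contains the whole fibre over `z`, and there the fibre is `{u₀}`
  -- times the dual space.
  let p₀ : Cotangent (m + 1) M := ⟨z, 0⟩
  let u₀ := extChartAt (𝓡 (m + 1)) z z
  let e := extChartAt (cotangentModel (m + 1)) p₀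
  have hsrc : ∀ p : Cotangent (m + 1) M, p.proj = z → p ∈ e.source := by
    intro p hp
    rw [mem_cotangent_source, hp]
    exact mem_chart_source _ z
  have htgt : ∀ η, (u₀, η) ∈ e.target := by
    intro η
    rw [cotangent_extChartAt_target]
    exact ⟨mem_extChartAt_target z, mem_univ _⟩
  have hfst : ∀ p : Cotangent (m + 1) M, p.proj = z → (e p).1 = u₀ := by
    intro p hp
    change (extChartAt (cotangentModel (m + 1)) p₀ p).1 = _
    rw [cotangent_extChartAt_apply, hp]
  let j₀ : EuclideanSpace ℝ (Fin (m + 1)) → Cotangent (m + 1) M := fun v => e.symm (u₀, A v)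
  have hej : ∀ v, e (j₀ v) = (u₀, A v) := fun v => e.right_inv (htgt _)
  have hjproj : ∀ v, (j₀ v).proj = z := by
    intro v
    have hs : j₀ v ∈ e.source := e.map_target (htgt _)
    have h1 : (e (j₀ v)).1 = extChartAt (𝓡 (m + 1)) z (j₀ v).proj := by
      change (extChartAt (cotangentModel (m + 1)) p₀ (j₀ v)).1 = _
      rw [cotangent_extChartAt_apply]
    rw [hej] at h1
    have h2 := mem_cotangent_source.1 hs
    exact ((extChartAt (𝓡 (m + 1)) z).injOn (mem_extChartAt_source z)
      (by rw [extChartAt_source]; exact h2) h1).symm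
  have hjnorm : ∀ v, conorm g (j₀ v) = ‖v‖ := by
    intro v
    rw [conorm_eq g (hsrc _ (hjproj v))]
    change coordHam g z (e (j₀ v)) = _
    rw [hej, hA]
  -- This inverse of `j₀` on the fibre is smooth at the points of the fibre as a map on the
  -- cotangent bundle. It yields the continuous inverse of `j`, the immersion property and the
  -- factorization of smooth maps.
  let r : Cotangent (m + 1) M → EuclideanSpace ℝ (Fin (m + 1)) := fun p => A.symm (e p).2
  have hrj : ∀ v, r (j₀ v) = v := fun v => by
    change A.symm (e (j₀ v)).2 = v
    rw [hej, A.symm_apply_apply]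
  have hjr : ∀ p : Cotangent (m + 1) M, p.proj = z → j₀ (r p) = p := by
    intro p hp
    change e.symm (u₀, A (A.symm (e p).2)) = p
    rw [A.apply_symm_apply, ← hfst p hp]
    exact e.left_inv (hsrc p hp)
  have hj₀ : ContMDiff 𝓘(ℝ, EuclideanSpace ℝ (Fin (m + 1))) (cotangentModel (m + 1)) ∞ j₀ := by
    rw [← contMDiffOn_univ]
    have h1 : ContDiff ℝ ∞ (fun v => ((u₀, A v) : PhaseSpace (m + 1))) :=
      contDiff_const.prodMk A.contDiff
    exact (contMDiffOn_extChartAt_symm p₀).comp h1.contMDiff.contMDiffOn fun v _ => htgt _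
  have hr : ∀ p : Cotangent (m + 1) M, p.proj = z →
      ContMDiffAt (cotangentModel (m + 1)) 𝓘(ℝ, EuclideanSpace ℝ (Fin (m + 1))) ∞ r p := by
    intro p hp
    have h1 : ContDiff ℝ ∞ (fun y : PhaseSpace (m + 1) => A.symm y.2) :=
      A.symm.contDiff.comp contDiff_snd
    exact h1.contMDiff.contMDiffAt.comp p ((contMDiffOn_extChartAt (x := p₀)).contMDiffAt
      ((chartAt _ p₀).open_source.mem_nhds (by
        have := hsrc p hp
        rwa [show e.source = _ from extChartAt_source (cotangentModel (m + 1)) p₀] at this)))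
  have hjneg : ∀ v, j₀ (-v) = reversal (j₀ v) := by
    intro v
    refine e.injOn (hsrc _ (hjproj _)) (hsrc _ (hjproj v)) ((hej _).trans ?_)
    refine Eq.trans ?_ (extChartAt_reversal p₀ (j₀ v)).symm
    change _ = coordReversal (m + 1) (e (j₀ v))
    rw [hej, coordReversal_apply, map_neg]
  let S := Metric.sphere (0 : EuclideanSpace ℝ (Fin (m + 1))) 1
  let j : S ≃ₜ cosphere g z :=
    { toFun := fun v => ⟨j₀ v, hjproj _, by rw [hjnorm]; simp⟩
      invFun := fun ξ => ⟨r ξ, by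
        rw [mem_sphere_zero_iff_norm, ← hjnorm, hjr _ ξ.2.1]
        exact ξ.2.2⟩
      left_inv := fun v => Subtype.ext (hrj v)
      right_inv := fun ξ => Subtype.ext (hjr ξ ξ.2.1)
      continuous_toFun := (hj₀.continuous.comp continuous_subtype_val).subtype_mk _
      continuous_invFun := by
        refine Continuous.subtype_mk ?_ _
        rw [continuous_iff_continuousAt]
        exact fun ξ => ContinuousAt.comp (g := r) (hr ξ ξ.2.1).continuousAt
          continuous_subtype_val.continuousAt }
  have hjval : ∀ v, (j v : Cotangent (m + 1) M) = j₀ v := fun v => rfl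
  have : IsManifold (𝓡 m) ∞ S := EuclideanSpace.instIsManifoldSphere.of_le (by simp)
  obtain ⟨cs, hmf, hloc⟩ := exists_manifold_of_isLocalHomeomorph (I := 𝓡 m)
    (ContinuousLinearEquiv.refl ℝ (EuclideanSpace ℝ (Fin m))) (q := j)
    j.isLocalHomeomorph j.surjective (fun y y' h => ⟨id,
      (Diffeomorph.refl (𝓡 m) S ∞).isLocalDiffeomorph y, j.injective h, by rfl⟩)
  let jd := hloc.diffeomorphOfBijective j.bijective
  have hjd : ∀ v, jd v = j v := fun v => rfl
  have hval : ContMDiff (𝓡 m) (cotangentModel (m + 1)) ∞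
      (Subtype.val : cosphere g z → Cotangent (m + 1) M) := by
    have h1 : ContMDiff (𝓡 m) (cotangentModel (m + 1)) ∞ (fun v : S => j₀ v) :=
      hj₀.comp contMDiff_coe_sphere
    refine (h1.comp jd.symm.contMDiff).congr fun ξ => ?_
    change (ξ : Cotangent (m + 1) M) = j₀ (jd.symm ξ)
    rw [← hjval, ← hjd, jd.apply_symm_apply]
  refine ⟨cs, hmf, ⟨jd, fun v => hjneg v⟩, hval, fun ξ => ?_, fun f hf => ?_⟩
  -- After `r`, the inclusion of the cosphere becomes the inclusion of the round sphere up to a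
  -- diffeomorphism. The latter has injective differential, hence so does the former.
  · have h1 : (r ∘ (Subtype.val : cosphere g z → Cotangent (m + 1) M)) =
        (Subtype.val : S → EuclideanSpace ℝ (Fin (m + 1))) ∘ jd.symm := by
      funext ξ
      obtain ⟨v, rfl⟩ := jd.surjective ξ
      change r (j₀ v) = (jd.symm (jd v) : EuclideanSpace ℝ (Fin (m + 1)))
      rw [jd.symm_apply_apply, hrj]
    have h2 := HasMFDerivAt.comp ξ ((hr ξ ξ.2.1).mdifferentiableAt (by simp)).hasMFDerivAt
      ((hval ξ).mdifferentiableAt (by simp)).hasMFDerivAt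
    have h3 := HasMFDerivAt.comp ξ ((contMDiff_coe_sphere (m := 1)
      (jd.symm ξ)).mdifferentiableAt (by simp)).hasMFDerivAt
      ((jd.symm.contMDiff ξ).mdifferentiableAt (by simp)).hasMFDerivAt
    rw [← h1] at h3
    have h4 := hasMFDerivAt_unique h2 h3
    have h5 : Function.Injective (mfderiv (𝓡 m) (𝓡 m) jd.symm ξ) :=
      (jd.symm.mfderivToContinuousLinearEquiv (by simp) ξ).injective
    intro a b hab
    apply h5
    apply mfderiv_coe_sphere_injective (jd.symm ξ)
    have ha := DFunLike.congr_fun h4 a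
    have hb := DFunLike.congr_fun h4 b
    exact ha.symm.trans ((congrArg (mfderiv (cotangentModel (m + 1))
      𝓘(ℝ, EuclideanSpace ℝ (Fin (m + 1))) r ξ) hab).trans hb)
  · have h1 : ContMDiff (𝓡 m) 𝓘(ℝ, EuclideanSpace ℝ (Fin (m + 1))) ∞
        (fun ξ => r (f ξ)) := fun ξ => ContMDiffAt.comp (g := r) ξ (hr _ (f ξ).2.1) (hf ξ)
    have h2 := h1.codRestrict_sphere (n := m) (fun ξ => (j.symm (f ξ)).2)
    refine (jd.contMDiff.comp h2).congr fun ξ => ?_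
    exact (j.apply_symm_apply (f ξ)).symm

end Cosphere

/-! ### Return map, complete geodesics and their coincidences -/

section GlobalCurves

open Topology Filter

variable {n : ℕ} {M : Type*} [TopologicalSpace M] [ChartedSpace (EuclideanSpace ℝ (Fin n)) M]
  [IsManifold (𝓡 n) ∞ M]

/-- A curve that is an integral curve on each of the intervals `[kT, (k + 1)T]` is one on the
line. -/
theorem isMIntegralCurve_of_forall_Icc {g : Metric n M} {γ : ℝ → Cotangent n M} {T : ℝ} (hT : 0 < T)
    (h : ∀ k : ℤ, IsMIntegralCurveOn (I := cotangentModel n) γ (geodesicField g)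
      (Icc (k * T) ((k + 1) * T))) :
    IsMIntegralCurve (I := cotangentModel n) γ (geodesicField g) := by
  intro t
  -- The right derivative uses the interval with index `⌊t / T⌋` and the left one that with index
  -- `⌈t / T⌉ - 1`; they differ exactly when `t` is a multiple of `T`.
  have hr : HasGeodesicVelocity g γ (Ici t) t := by
    have h1 : (⌊t / T⌋ : ℝ) * T ≤ t := (le_div_iff₀ hT).1 (Int.floor_le _)
    have h2 : t < ((⌊t / T⌋ : ℝ) + 1) * T := (div_lt_iff₀ hT).1 (Int.lt_floor_add_one _)
    exact (h ⌊t / T⌋ t ⟨h1, h2.le⟩).mono_of_mem_nhdsWithin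
      (mem_of_superset (Icc_mem_nhdsGE h2) (Icc_subset_Icc_left h1))
  have hl : HasGeodesicVelocity g γ (Iic t) t := by
    have h1 : ((⌈t / T⌉ - 1 : ℤ) : ℝ) * T < t := (lt_div_iff₀ hT).1 (by
      push_cast
      linarith [Int.ceil_lt_add_one (t / T)])
    have h2 : t ≤ (((⌈t / T⌉ - 1 : ℤ) : ℝ) + 1) * T := (div_le_iff₀ hT).1 (by
      push_cast
      linarith [Int.le_ceil (t / T)])
    exact (h (⌈t / T⌉ - 1) t ⟨h1.le, h2⟩).mono_of_mem_nhdsWithin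
      (mem_of_superset (Icc_mem_nhdsLE h1) (Icc_subset_Icc_right h2))
  have h3 := hl.union hr
  rw [Iic_union_Ici] at h3
  exact hasMFDerivWithinAt_univ.1 h3

theorem isMIntegralCurveOn_congr {g : Metric n M} {γ γ' : ℝ → Cotangent n M} {s : Set ℝ}
    (h : IsMIntegralCurveOn (I := cotangentModel n) γ' (geodesicField g) s) (heq : EqOn γ γ' s) :
    IsMIntegralCurveOn (I := cotangentModel n) γ (geodesicField g) s := by
  intro t ht
  have h1 : ∀ p, p = γ' t → HasMFDerivWithinAt 𝓘(ℝ, ℝ) (cotangentModel n) γ s t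
      ((1 : ℝ →L[ℝ] ℝ).smulRight (geodesicField g p)) := by
    rintro _ rfl
    exact (h t ht).congr_mono heq (heq ht) subset_rfl
  exact h1 (γ t) (heq ht)

theorem isMIntegralCurveOn_reversal {g : Metric n M} {γ : ℝ → Cotangent n M} {s s' : Set ℝ}
    (h : IsMIntegralCurveOn (I := cotangentModel n) γ (geodesicField g) s)
    (hpos : ∀ t ∈ s, 0 < conorm g (γ t)) (hs : MapsTo Neg.neg s' s) :
    IsMIntegralCurveOn (I := cotangentModel n) (fun t => reversal (γ (-t))) (geodesicField g) s' := by
  intro t ht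
  have h1 := HasGeodesicVelocity.reversal (h (-t) (hs ht)) (hpos _ (hs ht)) hs
  rwa [neg_neg] at h1

theorem reversal_ne_self {g : Metric n M} {p : Cotangent n M} (hp : 0 < conorm g p) :
    reversal p ≠ p := by
  intro h1
  rw [conorm_pos_iff g (mem_extChartAt_source _)] at hp
  apply hp
  have h3 := congrArg (fun q => (extChartAt (cotangentModel n) p q).2) h1
  simp only [extChartAt_reversal, coordReversal_apply] at h3
  refine ContinuousLinearMap.ext fun v => ?_
  have h4 := DFunLike.congr_fun h3 v
  rw [neg_apply] at h4
  rw [zero_apply]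
  linarith

section BlowDownPoint

variable {g : Metric n M} {z : M} {T : ℝ}

theorem conorm_cosphere (ξ : cosphere g z) : conorm g (ξ : Cotangent n M) = 1 := ξ.2.2

theorem conorm_cosphere_pos (ξ : cosphere g z) : 0 < conorm g (ξ : Cotangent n M) := by
  rw [conorm_cosphere]
  exact one_pos

/-- The reversal of the unit cosphere. -/
def cosphereReversal (ξ : cosphere g z) : cosphere g z :=
  ⟨reversal ξ, ξ.2.1, by rw [conorm_reversal]; exact ξ.2.2⟩

theorem cosphereReversal_cosphereReversal (ξ : cosphere g z) :
    cosphereReversal (cosphereReversal ξ) = ξ := Subtype.ext (reversal_reversal _)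

variable [T2Space M]

theorem isMIntegralCurveOn_geodesicFlow (hz : IsBlowDownPoint g z T) (ξ : cosphere g z) :
    IsMIntegralCurveOn (I := cotangentModel n) (fun t => geodesicFlow g t (ξ : Cotangent n M))
      (geodesicField g) (Icc 0 T) := by
  obtain ⟨γ, h0, hγ⟩ := hz.defined ξ ξ.2
  rw [uIcc_of_le hz.pos.le] at hγ
  have heq : ∀ t ∈ Icc 0 T, geodesicFlow g t (ξ : Cotangent n M) = γ t := by
    intro t ht
    have h1 : IsMIntegralCurveOn (I := cotangentModel n) γ (geodesicField g) (uIcc 0 t) := by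
      rw [uIcc_of_le ht.1]
      exact hγ.mono (Icc_subset_Icc_right ht.2)
    rw [← geodesicFlow_eq h1 (by rw [h0]; exact conorm_cosphere_pos ξ), h0]
  exact isMIntegralCurveOn_congr hγ heq

theorem conorm_geodesicFlow (hz : IsBlowDownPoint g z T) (ξ : cosphere g z) {t : ℝ}
    (ht : t ∈ Icc 0 T) : conorm g (geodesicFlow g t (ξ : Cotangent n M)) = 1 := by
  have h := isMIntegralCurveOn_geodesicFlow hz ξ
  rw [← uIcc_of_le hz.pos.le] at h ht
  have h1 := conorm_integralCurve h (by
    rw [geodesicFlow_zero]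
    exact conorm_cosphere_pos ξ) t ht
  rwa [geodesicFlow_zero, conorm_cosphere] at h1

/-- The first return map. -/
def returnMap (hz : IsBlowDownPoint g z T) (ξ : cosphere g z) : cosphere g z :=
  ⟨geodesicFlow g T ξ, hz.returns ξ ξ.2, conorm_geodesicFlow hz ξ ⟨hz.pos.le, le_rfl⟩⟩

/-- The geodesic from `ξ`, run backwards from time `T` with reversed covectors, is the geodesic from
the reversed `returnMap hz ξ` and ends at the reversed `ξ`. This makes the return map invertible
without any assumption on backward existence. -/
theorem returnMap_reversal_returnMap (hz : IsBlowDownPoint g z T) (ξ : cosphere g z) :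
    returnMap hz (cosphereReversal (returnMap hz ξ)) = cosphereReversal ξ := by
  have h1 := (isMIntegralCurveOn_reversal (s' := Icc (-T) 0) (isMIntegralCurveOn_geodesicFlow hz ξ)
    (fun t ht => by rw [conorm_geodesicFlow hz ξ ht]; exact one_pos)
    (fun t ht => ⟨by linarith [ht.2], by linarith [ht.1]⟩)).comp_add (-T)
  have h2 : {t : ℝ | t + -T ∈ Icc (-T) 0} = uIcc 0 T := by
    rw [uIcc_of_le hz.pos.le]
    ext t
    simp only [mem_ofPred_eq, mem_Icc]
    constructor <;> rintro ⟨h1, h2⟩ <;> constructor <;> linarith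
  rw [h2] at h1
  have h3 : ((fun t => reversal (geodesicFlow g (-t) (ξ : Cotangent n M))) ∘ fun t => t + -T) 0 =
      (cosphereReversal (returnMap hz ξ) : Cotangent n M) := by
    simp only [Function.comp_apply, zero_add, neg_neg]
    rfl
  have h4 := geodesicFlow_eq h1 (by
    rw [h3]
    exact conorm_cosphere_pos _)
  rw [h3] at h4
  apply Subtype.ext
  refine h4.trans ?_
  simp only [Function.comp_apply, add_neg_cancel, neg_zero, geodesicFlow_zero]
  rfl

/-- The first return map as a bijection. -/
def returnEquiv (hz : IsBlowDownPoint g z T) : Equiv.Perm (cosphere g z) where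
  toFun := returnMap hz
  invFun ξ := cosphereReversal (returnMap hz (cosphereReversal ξ))
  left_inv ξ := by
    change cosphereReversal (returnMap hz (cosphereReversal (returnMap hz ξ))) = ξ
    rw [returnMap_reversal_returnMap, cosphereReversal_cosphereReversal]
  right_inv ξ := by
    change returnMap hz (cosphereReversal (returnMap hz (cosphereReversal ξ))) = ξ
    rw [returnMap_reversal_returnMap, cosphereReversal_cosphereReversal]

/-- The geodesic with initial covector `ξ`, for all times. -/
def geodesic (hz : IsBlowDownPoint g z T) (ξ : cosphere g z) (t : ℝ) : Cotangent n M :=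
  -- Negative times give negative powers, so the backward geodesic is also assembled from forward
  -- arcs of length `T`.
  geodesicFlow g (t - ⌊t / T⌋ * T) ((returnEquiv hz ^ ⌊t / T⌋) ξ : cosphere g z)

/-- The right endpoint is included, where the floor jumps to `k + 1`: the arc of index `k` ends at
the covector at which the next arc starts. -/
theorem geodesic_eq (hz : IsBlowDownPoint g z T) (ξ : cosphere g z) (k : ℤ) {t : ℝ}
    (ht : t ∈ Icc (k * T) ((k + 1) * T)) :
    geodesic hz ξ t = geodesicFlow g (t - k * T) ((returnEquiv hz ^ k) ξ : cosphere g z) := by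
  rcases ht.2.lt_or_eq with hlt | heq
  · have hk : ⌊t / T⌋ = k := by
      rw [Int.floor_eq_iff, le_div_iff₀ hz.pos, div_lt_iff₀ hz.pos]
      exact ⟨ht.1, hlt⟩
    rw [geodesic, hk]
  · have hk : ⌊t / T⌋ = k + 1 := by
      rw [heq, mul_div_cancel_right₀ _ hz.pos.ne']
      exact_mod_cast Int.floor_intCast (k + 1)
    rw [geodesic, hk, heq]
    push_cast
    rw [sub_self, geodesicFlow_zero, add_comm k 1, zpow_one_add, Equiv.Perm.mul_apply,
      show ((k : ℝ) + 1) * T - k * T = T by ring]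
    rfl

theorem isMIntegralCurve_geodesic (hz : IsBlowDownPoint g z T) (ξ : cosphere g z) :
    IsMIntegralCurve (I := cotangentModel n) (geodesic hz ξ) (geodesicField g) := by
  refine isMIntegralCurve_of_forall_Icc hz.pos fun k => ?_
  have h1 := (isMIntegralCurveOn_geodesicFlow hz ((returnEquiv hz ^ k) ξ)).comp_add (-(k * T))
  have h2 : {t : ℝ | t + -(k * T) ∈ Icc 0 T} = Icc (k * T) ((k + 1) * T) := by
    ext t
    simp only [mem_ofPred_eq, mem_Icc]
    constructor <;> rintro ⟨h1, h2⟩ <;> constructor <;> linarith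
  rw [h2] at h1
  exact isMIntegralCurveOn_congr h1 fun s hs => geodesic_eq hz ξ k hs

theorem geodesic_zero (hz : IsBlowDownPoint g z T) (ξ : cosphere g z) :
    geodesic hz ξ 0 = ξ := by
  simp [geodesic, geodesicFlow_zero]

theorem conorm_geodesic (hz : IsBlowDownPoint g z T) (ξ : cosphere g z) (t : ℝ) :
    conorm g (geodesic hz ξ t) = 1 := by
  have h := conorm_integralCurve ((isMIntegralCurve_geodesic hz ξ).isMIntegralCurveOn (uIcc 0 t))
    (by rw [geodesic_zero]; exact conorm_cosphere_pos ξ) t right_mem_uIcc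
  rwa [geodesic_zero, conorm_cosphere] at h

theorem conorm_geodesic_pos (hz : IsBlowDownPoint g z T) (ξ : cosphere g z) (t : ℝ) :
    0 < conorm g (geodesic hz ξ t) := by
  rw [conorm_geodesic]
  exact one_pos

theorem flowDefined_geodesic (hz : IsBlowDownPoint g z T) (ξ : cosphere g z) (s t : ℝ) :
    FlowDefined g s (geodesic hz ξ t) :=
  ⟨_, by simp, ((isMIntegralCurve_geodesic hz ξ).comp_add t).isMIntegralCurveOn _⟩

theorem geodesicFlow_geodesic (hz : IsBlowDownPoint g z T) (ξ : cosphere g z) (s t : ℝ) :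
    geodesicFlow g s (geodesic hz ξ t) = geodesic hz ξ (s + t) := by
  have h := geodesicFlow_eq (t := s)
    (((isMIntegralCurve_geodesic hz ξ).comp_add t).isMIntegralCurveOn _)
    (by simpa using conorm_geodesic_pos hz ξ t)
  simpa using h

theorem geodesicFlow_cosphere (hz : IsBlowDownPoint g z T) (ξ : cosphere g z) (t : ℝ) :
    geodesicFlow g t ξ = geodesic hz ξ t := by
  have := geodesicFlow_geodesic hz ξ t 0
  rwa [geodesic_zero, add_zero] at this

theorem geodesic_intCast_mul (hz : IsBlowDownPoint g z T) (ξ : cosphere g z) (k : ℤ) :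
    geodesic hz ξ (k * T) = ((returnEquiv hz ^ k) ξ : cosphere g z) := by
  rw [geodesic_eq hz ξ k ⟨le_rfl, by linarith [hz.pos]⟩, sub_self, geodesicFlow_zero]

theorem geodesic_zpow (hz : IsBlowDownPoint g z T) (ξ : cosphere g z) (k : ℤ) (t : ℝ) :
    geodesic hz ((returnEquiv hz ^ k) ξ) t = geodesic hz ξ (t + k * T) := by
  rw [← geodesicFlow_cosphere, ← geodesic_intCast_mul, geodesicFlow_geodesic]

theorem geodesic_returnMap (hz : IsBlowDownPoint g z T) (ξ : cosphere g z) (t : ℝ) :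
    geodesic hz (returnMap hz ξ) t = geodesic hz ξ (t + T) := by
  have := geodesic_zpow hz ξ 1 t
  rwa [zpow_one, Int.cast_one, one_mul] at this

theorem geodesic_proj_eq_iff (hz : IsBlowDownPoint g z T) (ξ : cosphere g z) (t : ℝ) :
    (geodesic hz ξ t).proj = z ↔ ∃ k : ℤ, t = k * T := by
  constructor
  · intro h
    refine ⟨⌊t / T⌋, ?_⟩
    have h1 : (⌊t / T⌋ : ℝ) * T ≤ t := (le_div_iff₀ hz.pos).1 (Int.floor_le _)
    have h2 : t < ((⌊t / T⌋ : ℝ) + 1) * T := (div_lt_iff₀ hz.pos).1 (Int.lt_floor_add_one _)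
    by_contra hne
    exact hz.first _ ((returnEquiv hz ^ ⌊t / T⌋) ξ).2 (t - ⌊t / T⌋ * T)
      ⟨sub_pos.2 (lt_of_le_of_ne h1 (Ne.symm hne)), by linarith⟩ h
  · rintro ⟨k, rfl⟩
    rw [geodesic_intCast_mul]
    exact ((returnEquiv hz ^ k) ξ).2.1

/-- Flowing both points back by `t` puts the geodesic of `ξ` over `z` at time `s - t`, which forces
a multiple of `T`. This fact determines the fibres of `sweep` and `unroll`. -/
theorem geodesic_eq_geodesic_iff (hz : IsBlowDownPoint g z T) (ξ η : cosphere g z) (s t : ℝ) :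
    geodesic hz ξ s = geodesic hz η t ↔
      ∃ k : ℤ, η = (returnEquiv hz ^ k) ξ ∧ s = t + k * T := by
  constructor
  · intro h
    have h1 : geodesic hz ξ (s - t) = η := by
      have h2 := congrArg (geodesicFlow g (-t)) h
      rw [geodesicFlow_geodesic, geodesicFlow_geodesic, neg_add_cancel, geodesic_zero] at h2
      rw [← h2]
      congr 1
      ring
    obtain ⟨k, hk⟩ := (geodesic_proj_eq_iff hz ξ (s - t)).1 (by rw [h1]; exact η.2.1)
    refine ⟨k, Subtype.ext ?_, by linarith⟩
    rw [← h1, hk, geodesic_intCast_mul]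
  · rintro ⟨k, rfl, rfl⟩
    rw [geodesic_zpow]

theorem reversal_geodesic (hz : IsBlowDownPoint g z T) (ξ : cosphere g z) (t : ℝ) :
    reversal (geodesic hz ξ (-t)) = geodesic hz (cosphereReversal ξ) t := by
  have h := isMIntegralCurveOn_reversal (s' := uIcc 0 t)
    ((isMIntegralCurve_geodesic hz ξ).isMIntegralCurveOn univ)
    (fun t _ => conorm_geodesic_pos hz ξ t) (mapsTo_univ _ _)
  refine eq_of_integralCurve h
    ((isMIntegralCurve_geodesic hz (cosphereReversal ξ)).isMIntegralCurveOn _) ?_ ?_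
  · rw [neg_zero, geodesic_zero, geodesic_zero]
    rfl
  · rw [conorm_reversal]
    exact conorm_geodesic_pos hz ξ _

/-- The return map sends no covector to its opposite. -/
theorem returnMap_ne_reversal (hz : IsBlowDownPoint g z T) (ξ : cosphere g z) :
    returnMap hz ξ ≠ cosphereReversal ξ := by
  intro h
  -- If the return map reversed `ξ`, the reversed geodesic would be the geodesic itself traversed
  -- from time `T` to `0`. At the midpoint `T / 2` a nonzero covector would equal its negative.
  have h1 := reversal_geodesic hz (cosphereReversal ξ) (T / 2)
  rw [cosphereReversal_cosphereReversal, ← h, geodesic_returnMap,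
    show -(T / 2) + T = T / 2 by ring] at h1
  exact reversal_ne_self (conorm_geodesic_pos hz ξ (T / 2)) h1

end BlowDownPoint

end GlobalCurves

/-! ### Isotropic immersions and their behaviour under composition -/

section IsotropicImmersions

open Topology Filter

set_option synthInstance.maxHeartbeats 200000

variable {n : ℕ} {M : Type*} [TopologicalSpace M] [ChartedSpace (EuclideanSpace ℝ (Fin n)) M]
  [IsManifold (𝓡 n) ∞ M]
  {E H : Type*} [NormedAddCommGroup E] [NormedSpace ℝ E] [TopologicalSpace H]
  {I : ModelWithCorners ℝ E H} {N : Type*} [TopologicalSpace N] [ChartedSpace H N]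

/-- The symplectic form, on vectors of the model space. -/
def modelForm (p : Cotangent n M) (v w : PhaseSpace n) : ℝ := symplecticForm p v w

/-- The differential of `f`, with values in the model space. -/
def modelDeriv (I : ModelWithCorners ℝ E H) (f : N → Cotangent n M) (a : N) : E →L[ℝ] PhaseSpace n :=
  mfderiv I (cotangentModel n) f a

/-- `f` is near `a` a smooth isotropic immersion, to first order. -/
structure IsIsotropicImmersionAt (I : ModelWithCorners ℝ E H) (f : N → Cotangent n M) (a : N) :
    Prop where
  contMDiffAt : ContMDiffAt I (cotangentModel n) ∞ f a
  injective : Function.Injective (modelDeriv I f a)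
  isotropic : ∀ u v, modelForm (f a) (modelDeriv I f a u) (modelDeriv I f a v) = 0

theorem IsIsotropicImmersionAt.congr {f f' : N → Cotangent n M} {a : N}
    (h : IsIsotropicImmersionAt I f a) (hf : f' =ᶠ[𝓝 a] f) : IsIsotropicImmersionAt I f' a := by
  have h1 : modelDeriv I f' a = modelDeriv I f a := hf.mfderiv_eq
  have h2 : f' a = f a := hf.self_of_nhds
  refine ⟨h.contMDiffAt.congr_of_eventuallyEq hf, ?_, ?_⟩
  · rw [h1]
    exact h.injective
  · rw [h1, h2]
    exact h.isotropic

theorem IsIsotropicImmersionAt.comp_diffeomorph {E' H' : Type*} [NormedAddCommGroup E']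
    [NormedSpace ℝ E'] [TopologicalSpace H'] {I' : ModelWithCorners ℝ E' H'} {N' : Type*}
    [TopologicalSpace N'] [ChartedSpace H' N'] {f : N → Cotangent n M} {s : N' → N}
    {a : N'} (hs : IsLocalDiffeomorphAt I' I ∞ s a) (h : IsIsotropicImmersionAt I f (s a)) :
    IsIsotropicImmersionAt I' (f ∘ s) a := by
  have hsa : MDifferentiableAt I' I s a := hs.mdifferentiableAt (by simp)
  let D : E' →L[ℝ] E := mfderiv I' I s a
  have h1 : modelDeriv I' (f ∘ s) a = (modelDeriv I f (s a)).comp D :=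
    mfderiv_comp a (h.contMDiffAt.mdifferentiableAt (by simp)) hsa
  have h2 : Function.Injective D := (hs.mfderivToContinuousLinearEquiv (by simp)).injective
  refine ⟨h.contMDiffAt.comp a hs.contMDiffAt, ?_, ?_⟩
  · rw [h1]
    exact h.injective.comp h2
  · rw [h1]
    exact fun u v => h.isotropic _ _

/-- A linear map preserving a nondegenerate form is injective, so symplecticity of `φ` provides both
the immersion and the isotropy condition. -/
theorem IsIsotropicImmersionAt.comp_symplectic {f : N → Cotangent n M} {a : N}
    {φ : Cotangent n M → Cotangent n M} (h : IsIsotropicImmersionAt I f a)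
    (hφ : ContMDiffAt (cotangentModel n) (cotangentModel n) ∞ φ (f a))
    (hs : ∀ v w : TangentSpace (cotangentModel n) (f a), symplecticForm (φ (f a))
      (mfderiv (cotangentModel n) (cotangentModel n) φ (f a) v)
      (mfderiv (cotangentModel n) (cotangentModel n) φ (f a) w) = symplecticForm (f a) v w) :
    IsIsotropicImmersionAt I (φ ∘ f) a := by
  let D : PhaseSpace n →L[ℝ] PhaseSpace n := mfderiv (cotangentModel n) (cotangentModel n) φ (f a)
  have h1 : modelDeriv I (φ ∘ f) a = D.comp (modelDeriv I f a) :=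
    mfderiv_comp a (hφ.mdifferentiableAt (by simp)) (h.contMDiffAt.mdifferentiableAt (by simp))
  have hs' : ∀ v w, modelForm (φ (f a)) (D v) (D w) = modelForm (f a) v w := hs
  have h2 : Function.Injective D := by
    rw [injective_iff_map_eq_zero]
    intro v hv
    have h3 : ∀ w : PhaseSpace n, modelForm (f a) v w = 0 := by
      intro w
      rw [← hs', hv]
      have h4 := symplecticForm_eq (mem_extChartAt_source (I := cotangentModel n) (φ (f a))) 0 (D w)
      rw [map_zero, map_zero] at h4
      exact h4
    exact symplecticForm_nondegenerate (p := f a) (v := v) h3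
  refine ⟨hφ.comp a h.contMDiffAt, ?_, ?_⟩
  · rw [h1]
    exact h2.comp h.injective
  · rw [h1]
    exact fun u v => (hs' _ _).trans (h.isotropic _ _)

end IsotropicImmersions

theorem bilinear_add_smul_eq_zero {V : Type*} [NormedAddCommGroup V] [NormedSpace ℝ V]
    (B : V →L[ℝ] V →L[ℝ] ℝ) {v w x : V} (hvw : B v w = 0) (hvx : B v x = 0) (hxw : B x w = 0)
    (hxx : B x x = 0) (a b : ℝ) : B (v + a • x) (w + b • x) = 0 := by
  simp only [map_add, map_smul, add_apply, smul_apply, hvw, hvx, hxw, hxx, smul_zero, add_zero]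

/-! ### The map swept out by the geodesics is an isotropic immersion -/

section SweepOut

open Topology Filter

set_option synthInstance.maxHeartbeats 200000

variable {m : ℕ} {M : Type*} [TopologicalSpace M] [T2Space M]
  [ChartedSpace (EuclideanSpace ℝ (Fin (m + 1))) M] [IsManifold (𝓡 (m + 1)) ∞ M]
  {g : Metric (m + 1) M} {z : M} {T : ℝ}

/-- The map `(ξ, t) ↦ G^t(z, ξ)` swept out by the geodesics from `z`. -/
def sweep (hz : IsBlowDownPoint g z T) (y : cosphere g z × ℝ) : Cotangent (m + 1) M :=
  geodesic hz y.1 y.2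

theorem eq_geodesicFlow_of_velocity {φ : ℝ → Cotangent (m + 1) M} {ε : ℝ}
    (h : ∀ t ∈ Ioo (-ε) ε, HasGeodesicVelocity g φ univ t) (hpos : 0 < conorm g (φ 0)) {t : ℝ}
    (ht : t ∈ Ioo (-ε) ε) : φ t = geodesicFlow g t (φ 0) := by
  refine (geodesicFlow_eq (γ := φ) (fun s hs => (h s ?_).mono (subset_univ _)) hpos).symm
  have h0 : (0 : ℝ) ∈ Ioo (-ε) ε := ⟨by linarith [ht.1, ht.2], by linarith [ht.1, ht.2]⟩
  exact ordConnected_Ioo.uIcc_subset h0 ht hs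

variable [ChartedSpace (EuclideanSpace ℝ (Fin m)) (cosphere g z)]

/-- Near `(ξ, s')` the map `sweep` is the local flow for time `s' - s` after `sweep` after a time
shift. The flow is symplectic and the shift a diffeomorphism, so the property passes from `s` to
`s'`, in either time direction. -/
theorem sweep_step (hz : IsBlowDownPoint g z T) (ξ : cosphere g z) (t : ℝ) :
    ∃ V ∈ 𝓝 t, ∀ s ∈ V, ∀ s' ∈ V,
      IsIsotropicImmersionAt ((𝓡 m).prod 𝓘(ℝ, ℝ)) (sweep hz) (ξ, s) →
      IsIsotropicImmersionAt ((𝓡 m).prod 𝓘(ℝ, ℝ)) (sweep hz) (ξ, s') := by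
  obtain ⟨ε, hε, W, hW, hpW, φ, hφ, hflow⟩ := exists_localGeodesicFlow g
    (conorm_geodesic_pos hz ξ t)
  have hc : ContinuousAt (geodesic hz ξ) t := (isMIntegralCurve_geodesic hz ξ t).continuousAt
  refine ⟨Metric.ball t (ε / 2) ∩ geodesic hz ξ ⁻¹' W,
    inter_mem (Metric.ball_mem_nhds t (by positivity)) (hc (hW.mem_nhds hpW)), ?_⟩
  rintro s ⟨hs, hsW⟩ s' ⟨hs', -⟩ h
  rw [Metric.mem_ball, Real.dist_eq, abs_lt] at hs hs'
  have hδ : s' - s ∈ Ioo (-ε) ε := ⟨by linarith, by linarith⟩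
  let τ : (cosphere g z × ℝ) ≃ₘ⟮(𝓡 m).prod 𝓘(ℝ, ℝ), (𝓡 m).prod 𝓘(ℝ, ℝ)⟯ (cosphere g z × ℝ) :=
    { toFun := fun y => (y.1, y.2 - (s' - s))
      invFun := fun y => (y.1, y.2 + (s' - s))
      left_inv := fun y => by simp
      right_inv := fun y => by simp
      contMDiff_toFun := contMDiff_fst.prodMk ((contDiff_id.sub contDiff_const).contMDiff.comp
        contMDiff_snd)
      contMDiff_invFun := contMDiff_fst.prodMk ((contDiff_id.add contDiff_const).contMDiff.comp
        contMDiff_snd) }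
  have hτ : τ (ξ, s') = (ξ, s) := Prod.ext rfl (by change s' - (s' - s) = s; ring)
  have h1 : IsIsotropicImmersionAt ((𝓡 m).prod 𝓘(ℝ, ℝ)) (sweep hz ∘ τ) (ξ, s') :=
    IsIsotropicImmersionAt.comp_diffeomorph (τ.isLocalDiffeomorph (ξ, s')) (by rwa [hτ])
  have hval : (sweep hz ∘ τ) (ξ, s') = geodesic hz ξ s := congrArg (sweep hz) hτ
  have hφs : ∀ p ∈ W, ContMDiffAt (cotangentModel (m + 1)) (cotangentModel (m + 1)) ∞
      (φ (s' - s)) p := fun p hp =>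
    (hφ.contMDiffAt ((isOpen_Ioo.prod hW).mem_nhds (show (s' - s, p) ∈ _ from ⟨hδ, hp⟩))).comp p
      (contMDiffAt_const.prodMk contMDiffAt_id)
  have hmem : (sweep hz ∘ τ) (ξ, s') ∈ W := by
    rw [hval]
    exact hsW
  refine (h1.comp_symplectic (hφs _ hmem) ((hflow _ hmem).2.2 _ hδ).2).congr ?_
  filter_upwards [h1.contMDiffAt.continuousAt (hW.mem_nhds hmem)] with y hy
  have h2 := eq_geodesicFlow_of_velocity (φ := fun r => φ r ((sweep hz ∘ τ) y))
    (fun r hr => ((hflow _ hy).2.2 r hr).1) (by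
      rw [(hflow _ hy).1]
      exact (hflow _ hy).2.1) hδ
  rw [(hflow _ hy).1] at h2
  refine Eq.trans ?_ h2.symm
  change geodesic hz y.1 y.2 = geodesicFlow g (s' - s) (geodesic hz y.1 (y.2 - (s' - s)))
  rw [geodesicFlow_geodesic]
  congr 1
  ring

-- At time `0` the differential is `(u, c) ↦ dv u + c X`, with `dv` the differential of the cosphere
-- inclusion and `X` the geodesic field. The vectors `dv u` are vertical, hence mutually orthogonal,
-- and tangent to a level set of `H`, hence orthogonal to `X`.
set_option maxHeartbeats 1000000 in
theorem sweep_base (hz : IsBlowDownPoint g z T)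
    (hval : ContMDiff (𝓡 m) (cotangentModel (m + 1)) ∞
      (Subtype.val : cosphere g z → Cotangent (m + 1) M))
    (hinj : ∀ ξ, Function.Injective (mfderiv (𝓡 m) (cotangentModel (m + 1))
      (Subtype.val : cosphere g z → Cotangent (m + 1) M) ξ)) (ξ : cosphere g z) :
    IsIsotropicImmersionAt ((𝓡 m).prod 𝓘(ℝ, ℝ)) (sweep hz) (ξ, 0) := by
  obtain ⟨ε, hε, W, hW, hpW, φ, hφ, hflow⟩ := exists_localGeodesicFlow g (conorm_cosphere_pos ξ)
  have h0 : (0 : ℝ) ∈ Ioo (-ε) ε := ⟨by linarith, hε⟩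
  have hsm : ContMDiffAt ((𝓡 m).prod 𝓘(ℝ, ℝ)) (cotangentModel (m + 1)) ∞ (sweep hz) (ξ, 0) := by
    have h1 : ContMDiff ((𝓡 m).prod 𝓘(ℝ, ℝ)) (𝓘(ℝ, ℝ).prod (cotangentModel (m + 1))) ∞
        (fun y : cosphere g z × ℝ => (y.2, (y.1 : Cotangent (m + 1) M))) :=
      contMDiff_snd.prodMk (hval.comp contMDiff_fst)
    have hO := (isOpen_Ioo (a := -ε) (b := ε)).prod hW
    refine (ContMDiffAt.comp (ξ, (0 : ℝ)) (hφ.contMDiffAt (hO.mem_nhds ⟨h0, hpW⟩))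
      h1.contMDiffAt).congr_of_eventuallyEq ?_
    filter_upwards [h1.continuous.continuousAt.preimage_mem_nhds (hO.mem_nhds ⟨h0, hpW⟩)]
      with y hy
    have h2 := eq_geodesicFlow_of_velocity (φ := fun r => φ r (y.1 : Cotangent (m + 1) M))
      (fun r hr => ((hflow _ hy.2).2.2 r hr).1) (by
        rw [(hflow _ hy.2).1]
        exact (hflow _ hy.2).2.1) hy.1
    rw [(hflow _ hy.2).1, geodesicFlow_cosphere hz] at h2
    exact h2.symm
  let D : (EuclideanSpace ℝ (Fin m) × ℝ) →L[ℝ] PhaseSpace (m + 1) :=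
    modelDeriv ((𝓡 m).prod 𝓘(ℝ, ℝ)) (sweep hz) (ξ, 0)
  have hD := (hsm.mdifferentiableAt (by simp)).hasMFDerivAt
  let dv : EuclideanSpace ℝ (Fin m) →L[ℝ] PhaseSpace (m + 1) :=
    mfderiv (𝓡 m) (cotangentModel (m + 1)) (Subtype.val : cosphere g z → Cotangent (m + 1) M) ξ
  have hdv := ((hval ξ).mdifferentiableAt (by simp)).hasMFDerivAt
  let X : PhaseSpace (m + 1) := geodesicField g (ξ : Cotangent (m + 1) M)
  have hDu : ∀ u, D (u, 0) = dv u := by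
    intro u
    have h1 := HasMFDerivAt.comp ξ (g := sweep hz) (f := fun x : cosphere g z => (x, (0 : ℝ))) hD
      ((hasMFDerivAt_id ξ).prodMk (hasMFDerivAt_const (0 : ℝ) ξ))
    have h2 : (sweep hz ∘ fun x : cosphere g z => (x, (0 : ℝ))) = Subtype.val :=
      funext fun x => geodesic_zero hz x
    rw [h2] at h1
    exact DFunLike.congr_fun (hasMFDerivAt_unique h1 hdv) u
  have hDt : ∀ c : ℝ, D (0, c) = c • X := by
    intro c
    have h1 := HasMFDerivAt.comp (0 : ℝ) (g := sweep hz) (f := fun r : ℝ => (ξ, r)) hD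
      ((hasMFDerivAt_const ξ (0 : ℝ)).prodMk (hasMFDerivAt_id (0 : ℝ)))
    have h2 := DFunLike.congr_fun (hasMFDerivAt_unique h1 (isMIntegralCurve_geodesic hz ξ 0)) c
    have h3 : (geodesicField g (geodesic hz ξ 0) : PhaseSpace (m + 1)) = X :=
      congrArg (fun p => (geodesicField g p : PhaseSpace (m + 1))) (geodesic_zero hz ξ)
    rw [← h3]
    exact h2
  have hDsum : ∀ a, D a = dv a.1 + a.2 • X := by
    intro a
    rw [← hDu, ← hDt, ← map_add]
    congr 1
    simp
  have hm : (ξ : Cotangent (m + 1) M) ∈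
    (extChartAt (cotangentModel (m + 1)) (ξ : Cotangent (m + 1) M)).source := mem_extChartAt_source _
  let c : PhaseSpace (m + 1) →L[ℝ] PhaseSpace (m + 1) :=
    chartDeriv (ξ : Cotangent (m + 1) M) (ξ : Cotangent (m + 1) M)
  set y₀ : PhaseSpace (m + 1) := extChartAt (cotangentModel (m + 1)) (ξ : Cotangent (m + 1) M) ξ
    with hy₀
  have hcX : c X = coordField g (ξ : Cotangent (m + 1) M).proj y₀ :=
    geodesicField_eq g hm (conorm_cosphere_pos ξ)
  have hy₁ := mem_target_of_mem_source hm
  have hy₂ := (conorm_pos_iff g hm).1 (conorm_cosphere_pos ξ)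
  have hcv := HasMFDerivAt.comp ξ (hasMFDerivAt_chart hm) hdv
  have hvert : ∀ u, (c (dv u)).1 = 0 := by
    intro u
    have h1 := HasMFDerivAt.comp ξ
      (ContinuousLinearMap.fst ℝ (EuclideanSpace ℝ (Fin (m + 1)))
        (EuclideanSpace ℝ (Fin (m + 1)) →L[ℝ] ℝ)).hasFDerivAt.hasMFDerivAt hcv
    have h2 : ((ContinuousLinearMap.fst ℝ (EuclideanSpace ℝ (Fin (m + 1)))
        (EuclideanSpace ℝ (Fin (m + 1)) →L[ℝ] ℝ)) ∘
        (extChartAt (cotangentModel (m + 1)) (ξ : Cotangent (m + 1) M) ∘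
          (Subtype.val : cosphere g z → Cotangent (m + 1) M))) =
        fun _ => extChartAt (𝓡 (m + 1)) (ξ : Cotangent (m + 1) M).proj z := by
      funext x
      change (extChartAt (cotangentModel (m + 1)) (ξ : Cotangent (m + 1) M) x).1 = _
      rw [cotangent_extChartAt_apply, x.2.1]
    rw [h2] at h1
    exact DFunLike.congr_fun (hasMFDerivAt_unique h1 (hasMFDerivAt_const _ ξ)) u
  have henergy : ∀ u, fderiv ℝ (coordHam g (ξ : Cotangent (m + 1) M).proj) y₀ (c (dv u)) = 0 := by
    intro u
    have h1 := HasMFDerivAt.comp ξ ((contDiffAt_coordHam g (ξ : Cotangent (m + 1) M).proj hy₁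
      hy₂).differentiableAt (by simp)).hasFDerivAt.hasMFDerivAt hcv
    have h2 : (coordHam g (ξ : Cotangent (m + 1) M).proj ∘
        (extChartAt (cotangentModel (m + 1)) (ξ : Cotangent (m + 1) M) ∘
          (Subtype.val : cosphere g z → Cotangent (m + 1) M))) = fun _ => 1 := by
      funext x
      have hx : (x : Cotangent (m + 1) M) ∈
          (extChartAt (cotangentModel (m + 1)) (ξ : Cotangent (m + 1) M)).source := by
        rw [mem_cotangent_source, show (x : Cotangent (m + 1) M).proj =
          (ξ : Cotangent (m + 1) M).proj from x.2.1.trans ξ.2.1.symm]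
        exact mem_chart_source _ _
      exact (conorm_eq g hx).symm.trans (conorm_cosphere x)
    rw [h2] at h1
    exact DFunLike.congr_fun (hasMFDerivAt_unique h1 (hasMFDerivAt_const _ ξ)) u
  refine ⟨hsm, ?_, ?_⟩
  · rw [injective_iff_map_eq_zero]
    intro a ha
    have h1 : D a = 0 := ha
    rw [hDsum] at h1
    -- Pairing the base component with the covector annihilates the vertical part, and on `X` gives
    -- `H = 1` by Euler's identity. So the coefficient of `X` can be read off.
    have h2 : y₀.2 (c (dv a.1 + a.2 • X)).1 = a.2 := by
      rw [map_add, map_smul, Prod.fst_add, hvert, zero_add, Prod.smul_fst, hcX, map_smul,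
        coordField_pairing g _ hy₁ hy₂, ← conorm_eq g hm, conorm_cosphere]
      simp
    rw [h1] at h2
    have h3 : a.2 = 0 := by
      rw [← h2]
      simp
    rw [h3, zero_smul, add_zero] at h1
    have h4 : a.1 = 0 := hinj ξ (h1.trans (map_zero dv).symm)
    exact Prod.ext h4 h3
  · intro a b
    have h1 : modelForm (sweep hz (ξ, 0)) (D a) (D b) = stdForm (m + 1) (c (D a)) (c (D b)) := by
      have h2 : sweep hz (ξ, 0) = ξ := geodesic_zero hz ξ
      rw [h2]
      exact symplecticForm_eq hm _ _
    refine h1.trans ?_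
    have hvv : ∀ u w, stdForm (m + 1) (c (dv u)) (c (dv w)) = 0 := by
      intro u w
      rw [stdForm_apply, hvert, hvert, map_zero, map_zero, sub_zero]
    have hXv : ∀ w, stdForm (m + 1) (c X) (c (dv w)) = 0 := by
      intro w
      rw [hcX, stdForm_coordField, henergy, neg_zero]
    have hvX : ∀ w, stdForm (m + 1) (c (dv w)) (c X) = 0 := by
      intro w
      rw [stdForm_anti, hXv, neg_zero]
    have hXX : stdForm (m + 1) (c X) (c X) = 0 := by
      rw [stdForm_apply, sub_self]
    rw [hDsum, hDsum, map_add c, map_smul c, map_add c, map_smul c]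
    exact bilinear_add_smul_eq_zero (stdForm (m + 1)) (hvv _ _) (hvX _) (hXv _) hXX _ _

/-- For fixed `ξ` the good times form a clopen set by `sweep_step`, nonempty by `sweep_base`, and
the line is connected. -/
theorem isIsotropicImmersionAt_sweep (hz : IsBlowDownPoint g z T)
    (hval : ContMDiff (𝓡 m) (cotangentModel (m + 1)) ∞
      (Subtype.val : cosphere g z → Cotangent (m + 1) M))
    (hinj : ∀ ξ, Function.Injective (mfderiv (𝓡 m) (cotangentModel (m + 1))
      (Subtype.val : cosphere g z → Cotangent (m + 1) M) ξ)) (y : cosphere g z × ℝ) :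
    IsIsotropicImmersionAt ((𝓡 m).prod 𝓘(ℝ, ℝ)) (sweep hz) y := by
  obtain ⟨ξ, t⟩ := y
  let A : Set ℝ := {t | IsIsotropicImmersionAt ((𝓡 m).prod 𝓘(ℝ, ℝ)) (sweep hz) (ξ, t)}
  have hA : IsClopen A := by
    refine ⟨⟨isOpen_iff_mem_nhds.2 fun s hs => ?_⟩, isOpen_iff_mem_nhds.2 fun s hs => ?_⟩
    · obtain ⟨V, hV, h⟩ := sweep_step (m := m) hz ξ s
      exact mem_of_superset hV fun r hr hrA => hs (h r hr s (mem_of_mem_nhds hV) hrA)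
    · obtain ⟨V, hV, h⟩ := sweep_step (m := m) hz ξ s
      exact mem_of_superset hV fun r hr => h s (mem_of_mem_nhds hV) r hr hs
  have h1 : A = univ := hA.eq_univ ⟨0, sweep_base hz hval hinj ξ⟩
  have h2 : t ∈ A := by
    rw [h1]
    exact mem_univ t
  exact h2

end SweepOut

/-! ### Descent along local diffeomorphisms and the Lagrangian condition -/

section Descent

open Topology Filter

set_option synthInstance.maxHeartbeats 200000

variable {E E' F H H' G : Type*} [NormedAddCommGroup E] [NormedSpace ℝ E] [NormedAddCommGroup E']
  [NormedSpace ℝ E'] [NormedAddCommGroup F] [NormedSpace ℝ F] [TopologicalSpace H]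
  [TopologicalSpace H'] [TopologicalSpace G] {I : ModelWithCorners ℝ E H}
  {I' : ModelWithCorners ℝ E' H'} {J : ModelWithCorners ℝ F G}
  {N X P : Type*} [TopologicalSpace N] [ChartedSpace H N] [TopologicalSpace X] [ChartedSpace H' X]
  [TopologicalSpace P] [ChartedSpace G P]

/-- A local diffeomorphism has a local section which is a local diffeomorphism. -/
theorem exists_local_section {q : N → X} {y : N} (hq : IsLocalDiffeomorphAt I I' ∞ q y) :
    ∃ s : X → N, IsLocalDiffeomorphAt I' I ∞ s (q y) ∧ s (q y) = y ∧ ∀ᶠ x in 𝓝 (q y), q (s x) = x := by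
  obtain ⟨Ξ, hy, hΞ⟩ := hq
  have hqy : q y = Ξ y := hΞ hy
  have ht : q y ∈ Ξ.target := hqy ▸ Ξ.map_source hy
  refine ⟨Ξ.symm, Ξ.symm.isLocalDiffeomorphAt _ _ _ ht, ?_, ?_⟩
  · rw [hqy]
    exact Ξ.left_inv hy
  · filter_upwards [Ξ.open_target.mem_nhds ht] with x hx
    have h1 : Ξ.symm x ∈ Ξ.source := Ξ.map_target hx
    exact (hΞ h1).trans (Ξ.right_inv hx)

theorem isLocalDiffeomorphAt_of_comp {q : N → X} {f : X → P} {y : N}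
    (hq : IsLocalDiffeomorphAt I I' ∞ q y) (hf : IsLocalDiffeomorphAt I J ∞ (f ∘ q) y) :
    IsLocalDiffeomorphAt I' J ∞ f (q y) := by
  obtain ⟨s, hs, hsy, hqs⟩ := exists_local_section hq
  have h1 : IsLocalDiffeomorphAt I' J ∞ ((f ∘ q) ∘ s) (q y) := hs.comp J P (by rwa [hsy])
  refine IsLocalDiffeomorphAt.congr h1 ?_
  filter_upwards [hqs] with x hx
  simp only [Function.comp_apply, hx]

variable {n : ℕ} {M : Type*} [TopologicalSpace M] [ChartedSpace (EuclideanSpace ℝ (Fin n)) M]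
  [IsManifold (𝓡 n) ∞ M]

theorem isIsotropicImmersionAt_of_comp {q : N → X} {f : X → Cotangent n M} {y : N}
    (hq : IsLocalDiffeomorphAt I I' ∞ q y) (hf : IsIsotropicImmersionAt I (f ∘ q) y) :
    IsIsotropicImmersionAt I' f (q y) := by
  obtain ⟨s, hs, hsy, hqs⟩ := exists_local_section hq
  have h1 : IsIsotropicImmersionAt I' ((f ∘ q) ∘ s) (q y) :=
    IsIsotropicImmersionAt.comp_diffeomorph hs (by rwa [hsy])
  refine h1.congr ?_
  filter_upwards [hqs] with x hx
  simp only [Function.comp_apply, hx]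

/-- An isotropic subspace of half the dimension is its own orthogonal complement. -/
theorem exists_of_orthogonal [FiniteDimensional ℝ E] [FiniteDimensional ℝ F]
    {B : F →L[ℝ] F →L[ℝ] ℝ} (hB : Function.Surjective B) {D : E →L[ℝ] F}
    (hD : Function.Injective D) (hiso : ∀ u v, B (D u) (D v) = 0)
    (hdim : Module.finrank ℝ F = Module.finrank ℝ E + Module.finrank ℝ E) {v : F}
    (hv : ∀ u, B v (D u) = 0) : ∃ u, D u = v := by
  let ψ : F →ₗ[ℝ] Module.Dual ℝ E := LinearMap.mk₂ ℝ (fun v u => B v (D u)) (by simp) (by simp)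
    (by simp) (by simp)
  -- A functional on `E` extends to `F` through a left inverse of `D`, and `B` represents the
  -- extension by a vector.
  have hψ : Function.Surjective ψ := by
    intro l
    obtain ⟨r, hr⟩ := LinearMap.exists_leftInverse_of_injective (D : E →ₗ[ℝ] F)
      (LinearMap.ker_eq_bot.2 hD)
    obtain ⟨v, hv⟩ := hB (LinearMap.toContinuousLinearMap (l.comp r))
    refine ⟨v, LinearMap.ext fun u => ?_⟩
    change B v (D u) = l u
    rw [hv]
    exact congrArg l (DFunLike.congr_fun hr u)
  -- Rank–nullity gives the orthogonal complement of the range of `D` the dimension of `E`, so the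
  -- inclusion given by isotropy is an equality.
  have h1 := LinearMap.finrank_range_add_finrank_ker ψ
  rw [LinearMap.range_eq_top.2 hψ, finrank_top, Subspace.dual_finrank_eq, hdim] at h1
  have h2 : LinearMap.range (D : E →ₗ[ℝ] F) = LinearMap.ker ψ := by
    refine Submodule.eq_of_le_of_finrank_eq ?_ ?_
    · rintro _ ⟨u, rfl⟩
      exact LinearMap.ext fun v => hiso u v
    · rw [LinearMap.finrank_range_of_inj hD]
      omega
  have h3 : v ∈ LinearMap.ker ψ := LinearMap.ext hv
  rw [← h2] at h3
  exact h3

theorem isLagrangianEmbedding_of_isotropic [FiniteDimensional ℝ E'] [I'.Boundaryless]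
    [IsManifold I' ∞ X] (hdim : Module.finrank ℝ E' = n) {f : X → Cotangent n M}
    (hemb : IsEmbedding f) (h : ∀ a, IsIsotropicImmersionAt I' f a) :
    IsLagrangianEmbedding I' f := by
  refine ⟨⟨isImmersion_of_injective (fun a => (h a).contMDiffAt) fun a => (h a).injective, hemb⟩,
    fun a v => ?_⟩
  have hm := mem_extChartAt_source (I := cotangentModel n) (f a)
  let c : PhaseSpace n →L[ℝ] PhaseSpace n := chartDeriv (f a) (f a)
  have hc : Function.Bijective c := chartDeriv_bijective hm
  have hform : ∀ v w, modelForm (f a) v w = stdForm n (c v) (c w) := symplecticForm_eq hm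
  have hiso := (h a).isotropic
  constructor
  · rintro ⟨u, rfl⟩ w
    exact hiso u w
  · intro hv
    have hv' : ∀ u, modelForm (f a) v (modelDeriv I' f a u) = 0 := hv
    have hdim' : Module.finrank ℝ (PhaseSpace n) =
        Module.finrank ℝ E' + Module.finrank ℝ E' := by
      rw [Module.finrank_prod, hdim, ← (LinearMap.toContinuousLinearMap (𝕜 := ℝ)
        (E := EuclideanSpace ℝ (Fin n)) (F' := ℝ)).finrank_eq]
      have h1 : Module.finrank ℝ (EuclideanSpace ℝ (Fin n) →ₗ[ℝ] ℝ) =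
          Module.finrank ℝ (EuclideanSpace ℝ (Fin n)) :=
        Subspace.dual_finrank_eq (K := ℝ) (V := EuclideanSpace ℝ (Fin n))
      rw [h1, finrank_euclideanSpace_fin]
    obtain ⟨u, hu⟩ := exists_of_orthogonal (B := stdForm n) (D := c.comp (modelDeriv I' f a))
      (stdFlat n).surjective (hc.1.comp (h a).injective)
      (fun u w => (hform _ _).symm.trans (hiso u w)) hdim' (v := c v)
      (fun u => (hform _ _).symm.trans (hv' u))
    exact ⟨u, hc.1 hu⟩

end Descent

/-! ### The mapping cylinder as a quotient of the cosphere times the line -/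

section Cylinder

open Topology Filter

set_option synthInstance.maxHeartbeats 200000

variable {m : ℕ} {M : Type*} [TopologicalSpace M] [T2Space M]
  [ChartedSpace (EuclideanSpace ℝ (Fin (m + 1))) M] [IsManifold (𝓡 (m + 1)) ∞ M]
  {g : Metric (m + 1) M} {z : M} {T : ℝ}

/-- Coincidence on the image means `s = t + k T`. With both times in `[0, T]` this leaves `k = 0`,
or `k = ±1` with `s` and `t` at opposite ends, which is the gluing relation. Identities in the
cylinder can thus be checked after `iota`. -/
theorem iota_injective (hz : IsBlowDownPoint g z T) : Function.Injective (iota g z T) := by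
  rintro ⟨ξ, s⟩ ⟨η, t⟩ h
  have h1 : geodesic hz ξ s = geodesic hz η t := by
    rw [← geodesicFlow_cosphere, ← geodesicFlow_cosphere]
    exact h
  obtain ⟨k, hk, hst⟩ := (geodesic_eq_geodesic_iff hz ξ η s t).1 h1
  have hT := hz.pos
  have hs := s.2
  have ht := t.2
  have hk1 : k < 2 := by
    by_contra hlt
    have : (2 : ℝ) ≤ k := by exact_mod_cast not_lt.1 hlt
    nlinarith [hs.2, ht.1]
  have hk2 : -2 < k := by
    by_contra hlt
    have : (k : ℝ) ≤ -2 := by exact_mod_cast not_lt.1 hlt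
    nlinarith [hs.1, ht.2]
  obtain rfl | rfl | rfl : k = -1 ∨ k = 0 ∨ k = 1 := by omega
  · refine (Quot.sound ⟨?_, ?_, ?_⟩).symm
    · push_cast at hst
      linarith [hs.1, ht.2]
    · push_cast at hst
      linarith [hs.1, ht.2]
    · have h2 : returnMap hz η = ξ := by
        rw [hk, zpow_neg_one]
        exact (returnEquiv hz).apply_symm_apply ξ
      exact (congrArg Subtype.val h2).symm
  · have h2 : s = t := Subtype.ext (by simpa using hst)
    rw [hk, h2, zpow_zero]
    rfl
  · refine Quot.sound ⟨?_, ?_, ?_⟩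
    · push_cast at hst
      linarith [hs.2, ht.1]
    · push_cast at hst
      linarith [hs.2, ht.1]
    · rw [hk, zpow_one]
      rfl

/-- The unrolling map of the mapping cylinder. -/
def unroll (hz : IsBlowDownPoint g z T) (y : cosphere g z × ℝ) : MappingCylinder g z T :=
  Quot.mk _ ((returnEquiv hz ^ ⌊y.2 / T⌋) y.1, ⟨y.2 - ⌊y.2 / T⌋ * T,
    sub_nonneg.2 ((le_div_iff₀ hz.pos).1 (Int.floor_le _)), by
      linarith [(div_lt_iff₀ hz.pos).1 (Int.lt_floor_add_one (y.2 / T))]⟩)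

theorem iota_unroll (hz : IsBlowDownPoint g z T) (y : cosphere g z × ℝ) :
    iota g z T (unroll hz y) = sweep hz y := rfl

theorem unroll_mk (hz : IsBlowDownPoint g z T) (ξ : cosphere g z) (t : Icc (0 : ℝ) T) :
    unroll hz (ξ, (t : ℝ)) = Quot.mk _ (ξ, t) :=
  iota_injective hz (geodesicFlow_cosphere hz ξ t).symm

theorem unroll_add (hz : IsBlowDownPoint g z T) (ξ : cosphere g z) (t : ℝ) :
    unroll hz (ξ, t + T) = unroll hz (returnMap hz ξ, t) :=
  iota_injective hz (geodesic_returnMap hz ξ t).symm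

theorem unroll_surjective (hz : IsBlowDownPoint g z T) : Function.Surjective (unroll hz) := by
  rintro ⟨ξ, t⟩
  exact ⟨(ξ, t), unroll_mk hz ξ t⟩

theorem unroll_eq_iff (hz : IsBlowDownPoint g z T) (y y' : cosphere g z × ℝ) :
    unroll hz y = unroll hz y' ↔ ∃ k : ℤ, y' = ((returnEquiv hz ^ k) y.1, y.2 - k * T) := by
  rw [← (iota_injective hz).eq_iff, iota_unroll, iota_unroll]
  refine (geodesic_eq_geodesic_iff hz y.1 y'.1 y.2 y'.2).trans (exists_congr fun k => ?_)
  rw [Prod.ext_iff]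
  refine and_congr_right fun _ => ⟨fun h => ?_, fun h => ?_⟩
  · change y'.2 = y.2 - k * T
    linarith
  · rw [h]
    ring

theorem mem_blowDownLagrangian_iff (hz : IsBlowDownPoint g z T) (p : Cotangent (m + 1) M) :
    p ∈ blowDownLagrangian g z T ↔ ∃ ξ t, geodesic hz ξ t = p := by
  constructor
  · rintro ⟨c, rfl⟩
    obtain ⟨y, rfl⟩ := unroll_surjective hz c
    exact ⟨y.1, y.2, rfl⟩
  · rintro ⟨ξ, t, rfl⟩
    exact ⟨unroll hz (ξ, t), rfl⟩

theorem blowDownLagrangian_invariant (hz : IsBlowDownPoint g z T) :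
    ∀ p ∈ blowDownLagrangian g z T, ∀ t : ℝ,
      FlowDefined g t p ∧ geodesicFlow g t p ∈ blowDownLagrangian g z T := by
  intro p hp t
  obtain ⟨ξ, s, rfl⟩ := (mem_blowDownLagrangian_iff hz p).1 hp
  refine ⟨flowDefined_geodesic hz ξ t s, ?_⟩
  rw [geodesicFlow_geodesic]
  exact (mem_blowDownLagrangian_iff hz _).2 ⟨ξ, _, rfl⟩

theorem continuous_iota (hz : IsBlowDownPoint g z T)
    (hsw : Continuous (sweep hz)) : Continuous (iota g z T) := by
  refine continuous_quot_lift _ ?_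
  have h1 : (fun a : cosphere g z × Icc (0 : ℝ) T =>
      geodesicFlow g a.2 (a.1 : Cotangent (m + 1) M)) = fun a => sweep hz (a.1, (a.2 : ℝ)) :=
    funext fun a => geodesicFlow_cosphere hz a.1 a.2
  rw [h1]
  exact hsw.comp (continuous_fst.prodMk (continuous_subtype_val.comp continuous_snd))

variable [ChartedSpace (EuclideanSpace ℝ (Fin m)) (cosphere g z)]

theorem contMDiff_zpow {E H N : Type*} [NormedAddCommGroup E] [NormedSpace ℝ E]
    [TopologicalSpace H] {I : ModelWithCorners ℝ E H} [TopologicalSpace N] [ChartedSpace H N]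
    {e : Equiv.Perm N} (he : ContMDiff I I ∞ e) (he' : ContMDiff I I ∞ (e⁻¹ : Equiv.Perm N))
    (k : ℤ) : ContMDiff I I ∞ (e ^ k : Equiv.Perm N) := by
  induction k using Int.induction_on with
  | zero => exact contMDiff_id
  | succ k ih =>
    rw [zpow_add_one]
    exact ih.comp he
  | pred k ih =>
    rw [zpow_sub_one]
    exact ih.comp he'

/-- The deck transformations of the unrolling map. -/
def deck (hz : IsBlowDownPoint g z T)
    (h : ∀ k : ℤ, ContMDiff (𝓡 m) (𝓡 m) ∞ (returnEquiv hz ^ k : Equiv.Perm (cosphere g z)))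
    (k : ℤ) : (cosphere g z × ℝ) ≃ₘ⟮(𝓡 m).prod 𝓘(ℝ, ℝ), (𝓡 m).prod 𝓘(ℝ, ℝ)⟯
      (cosphere g z × ℝ) where
  toFun y := ((returnEquiv hz ^ k) y.1, y.2 - k * T)
  invFun y := ((returnEquiv hz ^ (-k)) y.1, y.2 + k * T)
  left_inv y := by simp
  right_inv y := by simp
  contMDiff_toFun := ((h k).comp contMDiff_fst).prodMk
    ((contDiff_id.sub contDiff_const).contMDiff.comp contMDiff_snd)
  contMDiff_invFun := ((h (-k)).comp contMDiff_fst).prodMk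
    ((contDiff_id.add contDiff_const).contMDiff.comp contMDiff_snd)

/-- The fibres are the orbits of the deck group, so the saturation of an open set is a union of open
translates and the map is open. It is injective on strips of width `T`, since a nontrivial deck
transformation moves the time by at least `T`. -/
theorem isLocalHomeomorph_unroll (hz : IsBlowDownPoint g z T)
    (h : ∀ k : ℤ, ContMDiff (𝓡 m) (𝓡 m) ∞ (returnEquiv hz ^ k : Equiv.Perm (cosphere g z)))
    (hc : Continuous (unroll hz)) : IsLocalHomeomorph (unroll hz) := by
  have hopen : IsOpenMap (unroll hz) := by
    intro U hU
    have h1 : unroll hz ⁻¹' (unroll hz '' U) = ⋃ k : ℤ, deck hz h k ⁻¹' U := by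
      ext y
      simp only [mem_preimage, mem_image, mem_iUnion]
      constructor
      · rintro ⟨y', hy', he⟩
        obtain ⟨k, rfl⟩ := (unroll_eq_iff hz y y').1 he.symm
        exact ⟨k, hy'⟩
      · rintro ⟨k, hk⟩
        exact ⟨_, hk, ((unroll_eq_iff hz y _).2 ⟨k, rfl⟩).symm⟩
    have h2 : IsOpen (unroll hz ⁻¹' (unroll hz '' U)) := by
      rw [h1]
      exact isOpen_iUnion fun k => hU.preimage (deck hz h k).continuous
    rw [← isQuotientMap_quot_mk.isOpen_preimage]
    have h3 : Continuous fun a : cosphere g z × Icc (0 : ℝ) T => (a.1, (a.2 : ℝ)) :=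
      continuous_fst.prodMk (continuous_subtype_val.comp continuous_snd)
    have h4 := h2.preimage h3
    rw [← preimage_comp] at h4
    have h5 : (unroll hz ∘ fun a : cosphere g z × Icc (0 : ℝ) T => (a.1, (a.2 : ℝ))) =
        Quot.mk _ := funext fun a => unroll_mk hz a.1 a.2
    rwa [h5] at h4
  rw [isLocalHomeomorph_iff_isOpenEmbedding_restrict]
  intro y
  have hT := hz.pos
  have hO : IsOpen (Prod.snd ⁻¹' Metric.ball y.2 (T / 2) : Set (cosphere g z × ℝ)) :=
    Metric.isOpen_ball.preimage continuous_snd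
  refine ⟨_, hO.mem_nhds (Metric.mem_ball_self (by positivity)),
    IsOpenEmbedding.of_continuous_injective_isOpenMap (hc.comp continuous_subtype_val) ?_
      (hopen.domRestrict hO)⟩
  rintro ⟨a, ha⟩ ⟨b, hb⟩ hab
  obtain ⟨k, hk⟩ := (unroll_eq_iff hz a b).1 hab
  have ha' : |a.2 - y.2| < T / 2 := ha
  have hb' : |b.2 - y.2| < T / 2 := hb
  have hb2 : b.2 = a.2 - k * T := congrArg Prod.snd hk
  rw [abs_lt] at ha' hb'
  have hk0 : k = 0 := by
    by_contra hne
    rcases lt_or_gt_of_ne hne with h1 | h1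
    · have : (k : ℝ) ≤ -1 := by exact_mod_cast (by omega : k ≤ -1)
      nlinarith
    · have : (1 : ℝ) ≤ k := by exact_mod_cast (by omega : 1 ≤ k)
      nlinarith
  apply Subtype.ext
  change a = b
  rw [hk, hk0]
  simp

/-- Smoothness of the return map comes from that of `sweep` at time `T`. The inverse is the return
map conjugated by reversal, hence smooth as well. -/
theorem contMDiff_returnEquiv_zpow (hz : IsBlowDownPoint g z T)
    (hval : ContMDiff (𝓡 m) (cotangentModel (m + 1)) ∞
      (Subtype.val : cosphere g z → Cotangent (m + 1) M))
    (hinj : ∀ ξ, Function.Injective (mfderiv (𝓡 m) (cotangentModel (m + 1))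
      (Subtype.val : cosphere g z → Cotangent (m + 1) M) ξ))
    (hfac : ∀ f : cosphere g z → cosphere g z, ContMDiff (𝓡 m) (cotangentModel (m + 1)) ∞
      (fun ξ => (f ξ : Cotangent (m + 1) M)) → ContMDiff (𝓡 m) (𝓡 m) ∞ f) (k : ℤ) :
    ContMDiff (𝓡 m) (𝓡 m) ∞ (returnEquiv hz ^ k : Equiv.Perm (cosphere g z)) := by
  have hsw : ContMDiff ((𝓡 m).prod 𝓘(ℝ, ℝ)) (cotangentModel (m + 1)) ∞ (sweep hz) :=
    fun y => (isIsotropicImmersionAt_sweep hz hval hinj y).contMDiffAt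
  have h1 : ContMDiff (𝓡 m) (𝓡 m) ∞ (returnMap hz) := by
    refine hfac _ ((hsw.comp (contMDiff_id.prodMk (contMDiff_const (c := T)))).congr fun ξ => ?_)
    exact geodesicFlow_cosphere hz ξ T
  have h2 : ContMDiff (𝓡 m) (𝓡 m) ∞ (cosphereReversal : cosphere g z → cosphere g z) :=
    hfac _ (contMDiff_reversal.comp hval)
  exact contMDiff_zpow h1 (h2.comp (h1.comp h2)) k

end Cylinder

/-! ### Topology and smooth structure of the mapping cylinder -/

section Structures

open Topology Filter

set_option synthInstance.maxHeartbeats 200000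

variable {m : ℕ} {M : Type*} [TopologicalSpace M] [T2Space M]
  [ChartedSpace (EuclideanSpace ℝ (Fin (m + 1))) M] [IsManifold (𝓡 (m + 1)) ∞ M]
  {g : Metric (m + 1) M} {z : M} {T : ℝ}

/-- A continuous injection from a compact space to a Hausdorff space is a closed embedding. -/
theorem isClosedEmbedding_iota [CompactSpace (cosphere g z)] (hz : IsBlowDownPoint g z T)
    (hsw : Continuous (sweep hz)) : IsClosedEmbedding (iota g z T) :=
  (continuous_iota hz hsw).isClosedEmbedding (iota_injective hz)

variable [ChartedSpace (EuclideanSpace ℝ (Fin m)) (cosphere g z)]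
  [IsManifold (𝓡 m) ∞ (cosphere g z)]

theorem exists_cylinder_manifold [CompactSpace (cosphere g z)] (hz : IsBlowDownPoint g z T)
    (hsw : Continuous (sweep hz))
    (h : ∀ k : ℤ, ContMDiff (𝓡 m) (𝓡 m) ∞ (returnEquiv hz ^ k : Equiv.Perm (cosphere g z))) :
    ∃ (_ : ChartedSpace (EuclideanSpace ℝ (Fin (m + 1))) (MappingCylinder g z T))
      (_ : IsManifold (𝓡 (m + 1)) ∞ (MappingCylinder g z T)),
      IsLocalDiffeomorph ((𝓡 m).prod 𝓘(ℝ, ℝ)) (𝓡 (m + 1)) ∞ (unroll hz) := by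
  have hc : Continuous (unroll hz) :=
    (isClosedEmbedding_iota hz hsw).isEmbedding.continuous_iff.2 hsw
  have A : (EuclideanSpace ℝ (Fin m) × ℝ) ≃L[ℝ] EuclideanSpace ℝ (Fin (m + 1)) :=
    ContinuousLinearEquiv.ofFinrankEq (by simp)
  refine exists_manifold_of_isLocalHomeomorph A (isLocalHomeomorph_unroll hz h hc)
    (unroll_surjective hz) fun y y' hy => ?_
  obtain ⟨k, hk⟩ := (unroll_eq_iff hz y y').1 hy
  refine ⟨deck hz h k, (deck hz h k).isLocalDiffeomorph y, hk.symm, Eventually.of_forall fun w => ?_⟩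
  exact ((unroll_eq_iff hz w _).2 ⟨k, rfl⟩).symm

end Structures

/-! ### Smooth structure on the image of an isotropic embedding -/

section Range

open Topology Filter

set_option synthInstance.maxHeartbeats 200000

variable {n : ℕ} {M : Type*} [TopologicalSpace M] [ChartedSpace (EuclideanSpace ℝ (Fin n)) M]
  [IsManifold (𝓡 n) ∞ M]

/-- The image of an isotropic embedding is a submanifold, with the isotropic inclusion. -/
theorem exists_range_manifold {E H X : Type*} [NormedAddCommGroup E] [NormedSpace ℝ E]
    [TopologicalSpace H] {I : ModelWithCorners ℝ E H} [I.Boundaryless] [TopologicalSpace X]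
    [ChartedSpace H X] [IsManifold I ∞ X] {f : X → Cotangent n M} (hf : IsEmbedding f)
    (h : ∀ a, IsIsotropicImmersionAt I f a) :
    ∃ (_ : ChartedSpace E (range f)) (_ : IsManifold 𝓘(ℝ, E) ∞ (range f)),
      (∀ a, IsIsotropicImmersionAt 𝓘(ℝ, E) (Subtype.val : range f → Cotangent n M) a) ∧
        Nonempty (X ≃ₘ⟮I, 𝓘(ℝ, E)⟯ range f) := by
  let e : X ≃ₜ range f := hf.toHomeomorph
  obtain ⟨cs, hm, he⟩ := exists_manifold_of_isLocalHomeomorph (I := I)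
    (ContinuousLinearEquiv.refl ℝ E) e.isLocalHomeomorph e.surjective fun y y' hy =>
      ⟨id, (Diffeomorph.refl I X ∞).isLocalDiffeomorph y, e.injective hy, EventuallyEq.rfl⟩
  refine ⟨cs, hm, fun a => ?_, ⟨he.diffeomorphOfBijective e.bijective⟩⟩
  obtain ⟨x, rfl⟩ := e.surjective a
  exact isIsotropicImmersionAt_of_comp (he x) (h x)

end Range

/-! ### Trivialization of the mapping torus by an isotopy -/

section MappingTorus

open Topology Filter

set_option synthInstance.maxHeartbeats 200000

theorem isLocalDiffeomorph_of_injective {E F H G N P : Type*} [NormedAddCommGroup E]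
    [NormedSpace ℝ E] [NormedAddCommGroup F] [NormedSpace ℝ F] [TopologicalSpace H]
    [TopologicalSpace G] {I : ModelWithCorners ℝ E H} {J : ModelWithCorners ℝ F G}
    [TopologicalSpace N] [ChartedSpace H N] [TopologicalSpace P] [ChartedSpace G P]
    [FiniteDimensional ℝ E] [FiniteDimensional ℝ F]
    (hdim : Module.finrank ℝ E = Module.finrank ℝ F) [I.Boundaryless] [J.Boundaryless]
    [IsManifold I ∞ N] [IsManifold J ∞ P] {f : N → P} (hf : ContMDiff I J ∞ f)
    (hinj : ∀ x, Function.Injective (mfderiv I J f x)) : IsLocalDiffeomorph I J ∞ f := by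
  intro x
  let D : E →L[ℝ] F := mfderiv I J f x
  have hD : HasMFDerivAt I J f x D := ((hf x).mdifferentiableAt (by simp)).hasMFDerivAt
  let L : E ≃L[ℝ] F := (LinearEquiv.ofInjectiveOfFinrankEq (D : E →ₗ[ℝ] F) (hinj x)
    hdim).toContinuousLinearEquiv
  have hL : (L : E →L[ℝ] F) = D := ContinuousLinearMap.ext fun v => rfl
  exact isLocalDiffeomorphAt_of_hasMFDerivAt isOpen_univ hf.contMDiffOn (mem_univ x) L (by rwa [hL])

theorem contMDiff_exp_mul (c : ℝ) :
    ContMDiff 𝓘(ℝ, ℝ) (𝓡 1) ∞ (fun t : ℝ => Circle.exp (c * t)) :=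
  contMDiff_circleExp.comp (contDiff_const.mul contDiff_id).contMDiff

theorem hasDerivAt_exp_mul (c t : ℝ) :
    HasDerivAt (fun t : ℝ => (Circle.exp (c * t) : ℂ))
      (Complex.exp ((c * t : ℝ) * Complex.I) * (c * Complex.I)) t := by
  simp only [Circle.coe_exp]
  have h1 : HasDerivAt (fun t : ℝ => ((c * t : ℝ) : ℂ) * Complex.I) (c * Complex.I) t := by
    have := (((hasDerivAt_id t).const_mul c).ofReal_comp).mul_const Complex.I
    simpa using this
  exact h1.cexp

theorem injective_mfderiv_exp_mul {c : ℝ} (hc : c ≠ 0) (t : ℝ) :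
    Function.Injective (mfderiv 𝓘(ℝ, ℝ) (𝓡 1) (fun t : ℝ => Circle.exp (c * t)) t) := by
  have := finrank_real_complex_fact'
  have hcs : ContMDiff (𝓡 1) 𝓘(ℝ, ℂ) ∞ (fun w : Circle => (w : ℂ)) :=
    contMDiff_coe_sphere (E := ℂ) (n := 1)
  let D : ℝ →L[ℝ] EuclideanSpace ℝ (Fin 1) :=
    mfderiv 𝓘(ℝ, ℝ) (𝓡 1) (fun t : ℝ => Circle.exp (c * t)) t
  have hD : HasMFDerivAt 𝓘(ℝ, ℝ) (𝓡 1) (fun t : ℝ => Circle.exp (c * t)) t D :=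
    ((contMDiff_exp_mul c t).mdifferentiableAt (by simp)).hasMFDerivAt
  have h1 := HasMFDerivAt.comp t ((hcs _).mdifferentiableAt (by simp)).hasMFDerivAt hD
  have h2 := (hasDerivAt_exp_mul c t).hasFDerivAt.hasMFDerivAt
  have h3 := hasMFDerivAt_unique h1 h2
  change Function.Injective D
  rw [injective_iff_map_eq_zero]
  intro s hs
  have h4 := DFunLike.congr_fun h3 s
  have h5 : (0 : ℂ) = s • (Complex.exp ((c * t : ℝ) * Complex.I) * (c * Complex.I)) := by
    refine Eq.trans ?_ h4
    refine ((congrArg (mfderiv (𝓡 1) 𝓘(ℝ, ℂ) (fun w : Circle => (w : ℂ)) _) hs).trans ?_).symm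
    exact map_zero (M := EuclideanSpace ℝ (Fin 1)) (N := ℂ) _
  rcases smul_eq_zero.1 h5.symm with h6 | h6
  · exact h6
  · simp [hc] at h6

/-- The first component depends on the second variable only, so the differential is block triangular
and injectivity of the two diagonal blocks suffices. -/
theorem injective_mfderiv_triangular {E₁ E₂ E₃ E₄ H₁ H₂ H₃ H₄ N R C P : Type*}
    [NormedAddCommGroup E₁] [NormedSpace ℝ E₁] [NormedAddCommGroup E₂] [NormedSpace ℝ E₂]
    [NormedAddCommGroup E₃] [NormedSpace ℝ E₃] [NormedAddCommGroup E₄] [NormedSpace ℝ E₄]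
    [TopologicalSpace H₁] [TopologicalSpace H₂] [TopologicalSpace H₃] [TopologicalSpace H₄]
    {I₁ : ModelWithCorners ℝ E₁ H₁} {I₂ : ModelWithCorners ℝ E₂ H₂}
    {I₃ : ModelWithCorners ℝ E₃ H₃} {I₄ : ModelWithCorners ℝ E₄ H₄}
    [TopologicalSpace N] [ChartedSpace H₁ N] [TopologicalSpace R] [ChartedSpace H₂ R]
    [TopologicalSpace C] [ChartedSpace H₃ C] [TopologicalSpace P] [ChartedSpace H₄ P]
    {c : R → C} {f : N × R → P} (hc : ContMDiff I₂ I₃ ∞ c) (hf : ContMDiff (I₁.prod I₂) I₄ ∞ f)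
    {y : N × R} (hc' : Function.Injective (mfderiv I₂ I₃ c y.2))
    (hf' : Function.Injective (mfderiv I₁ I₄ (fun x => f (x, y.2)) y.1)) :
    Function.Injective (mfderiv (I₁.prod I₂) (I₃.prod I₄) (fun y : N × R => (c y.2, f y)) y) := by
  let A : E₂ →L[ℝ] E₃ := mfderiv I₂ I₃ c y.2
  let B : E₁ × E₂ →L[ℝ] E₄ := mfderiv (I₁.prod I₂) I₄ f y
  have hA : HasMFDerivAt I₂ I₃ c y.2 A := ((hc _).mdifferentiableAt (by simp)).hasMFDerivAt
  have hB : HasMFDerivAt (I₁.prod I₂) I₄ f y B :=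
    ((hf _).mdifferentiableAt (by simp)).hasMFDerivAt
  have h1 := HasMFDerivAt.prodMk (HasMFDerivAt.comp y hA (hasMFDerivAt_snd (I := I₁) y)) hB
  have h2 : HasMFDerivAt I₁ (I₁.prod I₂) (fun x : N => (x, y.2)) y.1
      (ContinuousLinearMap.inl ℝ E₁ E₂) := by
    have h := HasMFDerivAt.prodMk (hasMFDerivAt_id (I := I₁) y.1)
      (hasMFDerivAt_const (I := I₁) (I' := I₂) y.2 y.1)
    exact h
  have h3 : HasMFDerivAt I₁ I₄ (fun x => f (x, y.2)) y.1
      (B.comp (ContinuousLinearMap.inl ℝ E₁ E₂)) := HasMFDerivAt.comp y.1 hB h2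
  rw [h3.mfderiv] at hf'
  have h4 : Function.Injective ((A.comp (ContinuousLinearMap.snd ℝ E₁ E₂)).prod B) := by
    rw [injective_iff_map_eq_zero]
    rintro ⟨u, s⟩ h
    have hs : s = 0 := (injective_iff_map_eq_zero A).1 hc' s (congrArg Prod.fst h)
    subst hs
    have hu : u = 0 := (injective_iff_map_eq_zero (B.comp (ContinuousLinearMap.inl ℝ E₁ E₂))).1 hf' u
      (congrArg Prod.snd h)
    rw [hu]
    rfl
  have h5 := h1.mfderiv
  have h6 : (mfderiv (I₁.prod I₂) (I₃.prod I₄) (fun y : N × R => (c y.2, f y)) y :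
      E₁ × E₂ →L[ℝ] E₃ × E₄) = (A.comp (ContinuousLinearMap.snd ℝ E₁ E₂)).prod B := h5
  exact fun a b hab => h4 ((DFunLike.congr_fun h6 a).symm.trans (hab.trans (DFunLike.congr_fun h6 b)))

variable {m : ℕ} {S : Type*} [TopologicalSpace S] [ChartedSpace (EuclideanSpace ℝ (Fin m)) S]

/-- The isotopy `F` from the identity to `e`, continued to all times by `e`. -/
def flowOfIsotopy (F : ℝ → (S ≃ₘ⟮𝓡 m, 𝓡 m⟯ S)) (e : Equiv.Perm S) (t : ℝ) : Equiv.Perm S :=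
  -- The parameter of the isotopy is `0` when the fractional part is at most `1 / 4` and `1` when it
  -- is at least `3 / 4`. The family is therefore constant near integer times, where consecutive
  -- pieces join smoothly.
  (F (Real.smoothTransition (2 * Int.fract t - 1 / 2))).toEquiv * e ^ ⌊t⌋

variable {F : ℝ → (S ≃ₘ⟮𝓡 m, 𝓡 m⟯ S)} {e : Equiv.Perm S}

/-- One formula covers an open interval around `[k, k + 1]`: beyond either end, both this piece and
its neighbour are in their constant range and agree because `F 1` is `e`. Smoothness in the time
follows. -/
theorem flowOfIsotopy_eq (h0 : ∀ ξ, F 0 ξ = ξ) (h1 : ∀ ξ, F 1 ξ = e ξ) (k : ℤ) {t : ℝ}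
    (hk : (k : ℝ) - 1 / 4 < t) (hk' : t < k + 5 / 4) (ξ : S) :
    flowOfIsotopy F e t ξ = F (Real.smoothTransition (2 * (t - k) - 1 / 2)) ((e ^ k) ξ) := by
  have hf := Int.floor_le t
  have hf' := Int.lt_floor_add_one t
  have hlt : k - 2 < ⌊t⌋ := by
    have : ((k - 2 : ℤ) : ℝ) < ⌊t⌋ := by
      push_cast
      linarith
    exact_mod_cast this
  have hlt' : ⌊t⌋ < k + 2 := by
    have : (⌊t⌋ : ℝ) < (k + 2 : ℤ) := by
      push_cast
      linarith
    exact_mod_cast this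
  change F (Real.smoothTransition (2 * (t - ⌊t⌋) - 1 / 2)) ((e ^ ⌊t⌋) ξ) = _
  obtain h | h | h : ⌊t⌋ = k - 1 ∨ ⌊t⌋ = k ∨ ⌊t⌋ = k + 1 := by omega
  · rw [h] at hf hf' ⊢
    push_cast at hf hf' ⊢
    rw [Real.smoothTransition.one_of_one_le (by linarith),
      Real.smoothTransition.zero_of_nonpos (by linarith), h0, h1, ← Equiv.Perm.mul_apply,
      ← zpow_one_add]
    congr 2
    ring
  · rw [h]
  · rw [h] at hf hf' ⊢
    push_cast at hf hf' ⊢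
    rw [Real.smoothTransition.zero_of_nonpos (by linarith),
      Real.smoothTransition.one_of_one_le (by linarith), h0, h1, ← Equiv.Perm.mul_apply,
      ← zpow_one_add, add_comm]

theorem flowOfIsotopy_add_int (t : ℝ) (k : ℤ) (ξ : S) :
    flowOfIsotopy F e (t + k) ξ = flowOfIsotopy F e t ((e ^ k) ξ) := by
  unfold flowOfIsotopy
  rw [Int.fract_add_intCast, Int.floor_add_intCast, zpow_add]
  rfl

theorem contMDiff_flowOfIsotopy (hF : ContMDiff (𝓘(ℝ, ℝ).prod (𝓡 m)) (𝓡 m) ∞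
      (fun a : ℝ × S => F a.1 a.2)) (h0 : ∀ ξ, F 0 ξ = ξ) (h1 : ∀ ξ, F 1 ξ = e ξ)
    (he : ∀ k : ℤ, ContMDiff (𝓡 m) (𝓡 m) ∞ (e ^ k : Equiv.Perm S)) :
    ContMDiff ((𝓡 m).prod 𝓘(ℝ, ℝ)) (𝓡 m) ∞ (fun y : S × ℝ => flowOfIsotopy F e y.2 y.1) := by
  intro y
  let k := ⌊y.2⌋
  have h2 : ContMDiff ((𝓡 m).prod 𝓘(ℝ, ℝ)) 𝓘(ℝ, ℝ) ∞
      (fun y : S × ℝ => Real.smoothTransition (2 * (y.2 - k) - 1 / 2)) := by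
    have h3 : ContDiff ℝ ∞ (fun t : ℝ => Real.smoothTransition (2 * (t - k) - 1 / 2)) :=
      Real.smoothTransition.contDiff.comp (by fun_prop)
    exact h3.contMDiff.comp contMDiff_snd
  have h4 := hF.comp (h2.prodMk ((he k).comp contMDiff_fst))
  refine (h4 y).congr_of_eventuallyEq ?_
  have hf := Int.floor_le y.2
  have hf' := Int.lt_floor_add_one y.2
  have h5 : ∀ᶠ w : S × ℝ in 𝓝 y, w.2 ∈ Ioo ((k : ℝ) - 1 / 4) (k + 5 / 4) :=
    continuous_snd.continuousAt.preimage_mem_nhds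
      (Ioo_mem_nhds (by change (k : ℝ) - 1 / 4 < y.2; linarith) (by
        change y.2 < (k : ℝ) + 5 / 4
        linarith))
  filter_upwards [h5] with w hw
  exact flowOfIsotopy_eq h0 h1 k hw.1 hw.2 w.1

theorem injective_mfderiv_flowOfIsotopy
    (he : ∀ k : ℤ, ContMDiff (𝓡 m) (𝓡 m) ∞ (e ^ k : Equiv.Perm S)) (t : ℝ) (ξ : S) :
    Function.Injective (mfderiv (𝓡 m) (𝓡 m) (flowOfIsotopy F e t) ξ) := by
  let d : S ≃ₘ⟮𝓡 m, 𝓡 m⟯ S :=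
    { toEquiv := flowOfIsotopy F e t
      contMDiff_toFun := (F _).contMDiff.comp (he _)
      contMDiff_invFun := by
        have h := (he (-⌊t⌋)).comp
          (F (Real.smoothTransition (2 * Int.fract t - 1 / 2))).symm.contMDiff
        rw [zpow_neg] at h
        exact h }
  exact (d.mfderivToContinuousLinearEquiv (by simp) ξ).injective

/-- The trivialization of the mapping torus of `e`, unrolled. -/
def trivialization (F : ℝ → (S ≃ₘ⟮𝓡 m, 𝓡 m⟯ S)) (e : Equiv.Perm S) (T : ℝ) (y : S × ℝ) :
    Circle × S :=
  (Circle.exp (2 * Real.pi / T * y.2), flowOfIsotopy F e (T⁻¹ * y.2) y.1)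

/-- Equal circle components mean that the times differ by `k T`; the second component then compares
the points through `flowOfIsotopy_add_int`. For the return map these are the fibres of `unroll`. -/
theorem trivialization_eq_iff {T : ℝ} (hT : 0 < T) (y y' : S × ℝ) :
    trivialization F e T y = trivialization F e T y' ↔
      ∃ k : ℤ, y' = ((e ^ k) y.1, y.2 - k * T) := by
  have hpi := Real.pi_pos
  have key : ∀ k : ℤ, y.2 = y'.2 + k * T → flowOfIsotopy F e (T⁻¹ * y.2) y.1 =
      flowOfIsotopy F e (T⁻¹ * y'.2) ((e ^ k) y.1) := by
    intro k hk
    rw [← flowOfIsotopy_add_int, hk]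
    congr 2
    field_simp
  unfold trivialization
  rw [Prod.ext_iff, Circle.exp_eq_exp]
  constructor
  · rintro ⟨⟨k, hk⟩, h⟩
    have hk2 : y.2 = y'.2 + k * T := by
      field_simp at hk
      linarith
    refine ⟨k, Prod.ext ?_ ?_⟩
    · have h' : flowOfIsotopy F e (T⁻¹ * y.2) y.1 = flowOfIsotopy F e (T⁻¹ * y'.2) y'.1 := h
      rw [key k hk2] at h'
      exact ((flowOfIsotopy F e (T⁻¹ * y'.2)).injective h').symm
    · change y'.2 = y.2 - k * T
      linarith
  · rintro ⟨k, hk⟩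
    have h1 : y'.1 = (e ^ k) y.1 := congrArg Prod.fst hk
    have h2 : y'.2 = y.2 - k * T := congrArg Prod.snd hk
    refine ⟨⟨k, ?_⟩, ?_⟩
    · rw [h2]
      field_simp
      ring
    · rw [h1]
      exact key k (by linarith)

theorem trivialization_surjective {T : ℝ} (hT : 0 < T) :
    Function.Surjective (trivialization F e T) := by
  rintro ⟨w, η⟩
  obtain ⟨s, rfl⟩ := Circle.exp_surjective w
  have hpi := Real.pi_pos
  refine ⟨((flowOfIsotopy F e (T⁻¹ * (T / (2 * Real.pi) * s))).symm η,
    T / (2 * Real.pi) * s), Prod.ext ?_ ?_⟩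
  · change Circle.exp _ = _
    congr 1
    field_simp
  · exact (flowOfIsotopy F e (T⁻¹ * (T / (2 * Real.pi) * s))).apply_symm_apply η

theorem contMDiff_flowOfIsotopy_mul (hF : ContMDiff (𝓘(ℝ, ℝ).prod (𝓡 m)) (𝓡 m) ∞
      (fun a : ℝ × S => F a.1 a.2)) (h0 : ∀ ξ, F 0 ξ = ξ) (h1 : ∀ ξ, F 1 ξ = e ξ)
    (he : ∀ k : ℤ, ContMDiff (𝓡 m) (𝓡 m) ∞ (e ^ k : Equiv.Perm S)) (c : ℝ) :
    ContMDiff ((𝓡 m).prod 𝓘(ℝ, ℝ)) (𝓡 m) ∞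
      (fun y : S × ℝ => flowOfIsotopy F e (c * y.2) y.1) := by
  have h4 : ContDiff ℝ ∞ (fun t : ℝ => c * t) := contDiff_const.mul contDiff_id
  have h5 : ContMDiff ((𝓡 m).prod 𝓘(ℝ, ℝ)) ((𝓡 m).prod 𝓘(ℝ, ℝ)) ∞
      (fun y : S × ℝ => (y.1, c * y.2)) :=
    contMDiff_fst.prodMk (h4.contMDiff.comp contMDiff_snd)
  have h6 := contMDiff_flowOfIsotopy hF h0 h1 he
  have h7 := h6.comp h5
  exact h7

theorem isLocalDiffeomorph_trivialization [IsManifold (𝓡 m) ∞ S]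
    (hF : ContMDiff (𝓘(ℝ, ℝ).prod (𝓡 m)) (𝓡 m) ∞
      (fun a : ℝ × S => F a.1 a.2)) (h0 : ∀ ξ, F 0 ξ = ξ) (h1 : ∀ ξ, F 1 ξ = e ξ)
    (he : ∀ k : ℤ, ContMDiff (𝓡 m) (𝓡 m) ∞ (e ^ k : Equiv.Perm S)) {T : ℝ} (hT : 0 < T) :
    IsLocalDiffeomorph ((𝓡 m).prod 𝓘(ℝ, ℝ)) ((𝓡 1).prod (𝓡 m)) ∞ (trivialization F e T) := by
  have h3 : IsManifold (𝓡 1) ω Circle := inferInstance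
  have : IsManifold (𝓡 1) ∞ Circle := h3.of_le (by simp)
  have hs2 := contMDiff_flowOfIsotopy_mul hF h0 h1 he T⁻¹
  have hs1 := contMDiff_exp_mul (2 * Real.pi / T)
  have hs : ContMDiff ((𝓡 m).prod 𝓘(ℝ, ℝ)) ((𝓡 1).prod (𝓡 m)) ∞ (trivialization F e T) := by
    have h4 := hs1.comp (contMDiff_snd (I := 𝓡 m) (M := S))
    exact h4.prodMk hs2
  have hd : Module.finrank ℝ (EuclideanSpace ℝ (Fin m) × ℝ) =
    Module.finrank ℝ (EuclideanSpace ℝ (Fin 1) × EuclideanSpace ℝ (Fin m)) := by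
    simp [add_comm]
  refine isLocalDiffeomorph_of_injective hd hs fun y => ?_
  have h4 := injective_mfderiv_exp_mul (c := 2 * Real.pi / T) (by positivity) y.2
  have h5 := injective_mfderiv_flowOfIsotopy (F := F) he (T⁻¹ * y.2) y.1
  exact injective_mfderiv_triangular hs1 hs2 h4 h5

/-- Two surjective local diffeomorphisms from one manifold with the same fibres present the same
quotient: the induced bijection is a local diffeomorphism by descent. -/
theorem nonempty_diffeomorph_of_fibers {E E' H H' N X F' G P : Type*} [NormedAddCommGroup E]
    [NormedSpace ℝ E] [NormedAddCommGroup E'] [NormedSpace ℝ E'] [NormedAddCommGroup F']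
    [NormedSpace ℝ F'] [TopologicalSpace H] [TopologicalSpace H'] [TopologicalSpace G]
    {I : ModelWithCorners ℝ E H} {I' : ModelWithCorners ℝ E' H'} {J : ModelWithCorners ℝ F' G}
    [TopologicalSpace N] [ChartedSpace H N] [TopologicalSpace X] [ChartedSpace H' X]
    [TopologicalSpace P] [ChartedSpace G P] {q : N → X} {p : N → P}
    (hq : IsLocalDiffeomorph I I' ∞ q) (hqs : Function.Surjective q)
    (hp : IsLocalDiffeomorph I J ∞ p) (hps : Function.Surjective p)
    (h : ∀ y y', q y = q y' ↔ p y = p y') : Nonempty (X ≃ₘ⟮I', J⟯ P) := by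
  let f : X → P := fun x => p (Function.surjInv hqs x)
  have hf : ∀ y, f (q y) = p y := fun y => (h _ _).1 (Function.surjInv_eq hqs (q y))
  have hfq : f ∘ q = p := funext hf
  have hloc : IsLocalDiffeomorph I' J ∞ f := by
    intro x
    obtain ⟨y, rfl⟩ := hqs x
    exact isLocalDiffeomorphAt_of_comp (hq y) (by rw [hfq]; exact hp y)
  refine ⟨hloc.diffeomorphOfBijective ⟨fun x x' hxx => ?_, fun w => ?_⟩⟩
  · obtain ⟨y, rfl⟩ := hqs x
    obtain ⟨y', rfl⟩ := hqs x'
    rw [hf, hf] at hxx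
    exact (h y y').2 hxx
  · obtain ⟨y, rfl⟩ := hps w
    exact ⟨q y, hf y⟩

end MappingTorus

/-! ### Circle diffeomorphisms without antipodal displacement are isotopic to the identity -/

section CircleIsotopy

open Topology Filter

set_option synthInstance.maxHeartbeats 200000

/-- A diffeomorphism of a circle, unrolled to the line: it moves every point by less than half a
turn. -/
theorem exists_lift {S : Type*} [TopologicalSpace S] [ChartedSpace (EuclideanSpace ℝ (Fin 1)) S]
    {p : ℝ → S} (hp : IsLocalDiffeomorph 𝓘(ℝ, ℝ) (𝓡 1) ∞ p) (hps : Function.Surjective p)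
    (hpf : ∀ t t', p t = p t' ↔ ∃ k : ℤ, t = t' + k * (2 * Real.pi))
    (Φ : S ≃ₘ⟮𝓡 1, 𝓡 1⟯ S) (hΦ : ∀ t, Φ (p t) ≠ p (t + Real.pi)) :
    ∃ f : ℝ → ℝ, ContDiff ℝ ∞ f ∧ (∀ t, deriv f t ≠ 0) ∧ (∀ t, p (f t) = Φ (p t)) ∧
      (∀ t, |f t - t| < Real.pi) ∧ ∀ t, ∀ k : ℤ, f (t + k * (2 * Real.pi)) = f t + k * (2 * Real.pi) := by
  have hpi := Real.pi_pos
  have huniq : ∀ t u u' : ℝ, |u - t| < Real.pi → |u' - t| < Real.pi → p u = p u' → u = u' := by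
    intro t u u' h1 h2 h
    obtain ⟨k, hk⟩ := (hpf u u').1 h
    rw [abs_lt] at h1 h2
    have hk0 : k = 0 := by
      by_contra hne
      rcases lt_or_gt_of_ne hne with h1 | h1
      · have : (k : ℝ) ≤ -1 := by exact_mod_cast (by omega : k ≤ -1)
        nlinarith
      · have : (1 : ℝ) ≤ k := by exact_mod_cast (by omega : 1 ≤ k)
        nlinarith
    rw [hk, hk0]
    simp
  -- The representative of `Φ (p t)` in `(t - π, t + π]` is not the endpoint, since no point goes to
  -- its antipode. The open interval makes the choice both unique and locally smooth.
  have hex : ∀ t : ℝ, ∃ u, |u - t| < Real.pi ∧ p u = Φ (p t) := by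
    intro t
    obtain ⟨u, hu⟩ := hps (Φ (p t))
    refine ⟨toIocMod Real.two_pi_pos (t - Real.pi) u, ?_⟩
    have h1 := toIocMod_mem_Ioc Real.two_pi_pos (t - Real.pi) u
    have h2 : p (toIocMod Real.two_pi_pos (t - Real.pi) u) = Φ (p t) := by
      rw [← hu, hpf]
      refine ⟨-toIocDiv Real.two_pi_pos (t - Real.pi) u, ?_⟩
      rw [toIocMod, zsmul_eq_mul]
      push_cast
      ring
    have h3 : toIocMod Real.two_pi_pos (t - Real.pi) u ≠ t + Real.pi := fun h =>
      hΦ t (by rw [← h2, h])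
    have h4 := lt_of_le_of_ne (h1.2.trans_eq (by ring)) h3
    exact ⟨abs_lt.2 ⟨by linarith [h1.1], by linarith⟩, h2⟩
  choose f hf hpf' using hex
  -- Near `t` the composite of `Φ ∘ p` with a local section of `p` through `f t` also stays within
  -- distance `π`, so by uniqueness it is `f`.
  have hloc : IsLocalDiffeomorph 𝓘(ℝ, ℝ) 𝓘(ℝ, ℝ) ∞ f := by
    intro t
    obtain ⟨s, hs, hst, hps'⟩ := exists_local_section (hp (f t))
    rw [hpf'] at hs hst hps'
    have h1 : IsLocalDiffeomorphAt 𝓘(ℝ, ℝ) 𝓘(ℝ, ℝ) ∞ (s ∘ (Φ ∘ p)) t :=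
      ((hp t).comp (𝓡 1) S (Φ.isLocalDiffeomorph _)).comp 𝓘(ℝ, ℝ) ℝ hs
    have hc : ContinuousAt (Φ ∘ p) t := Φ.continuous.continuousAt.comp (hp t).contMDiffAt.continuousAt
    have hc' : ContinuousAt (fun w => |(s ∘ (Φ ∘ p)) w - w|) t :=
      (h1.contMDiffAt.continuousAt.sub continuousAt_id).abs
    refine IsLocalDiffeomorphAt.congr h1 ?_
    have h2 : ∀ᶠ w in 𝓝 t, |(s ∘ (Φ ∘ p)) w - w| < Real.pi := by
      refine hc'.eventually_lt_const ?_
      change |s (Φ (p t)) - t| < Real.pi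
      rw [hst]
      exact hf t
    filter_upwards [h2, hc.eventually hps'] with w hw hw'
    exact huniq w _ _ hw (hf w) (hw'.trans (hpf' w).symm)
  refine ⟨f, hloc.contMDiff.contDiff, fun t h0 => ?_, hpf', hf, fun t k => ?_⟩
  · have h1 := ((hloc t).mfderivToContinuousLinearEquiv (by simp)).injective
    have h2 : fderiv ℝ f t 1 = fderiv ℝ f t 0 := by
      rw [fderiv_apply_one_eq_deriv, h0, map_zero]
    rw [← mfderiv_eq_fderiv] at h2
    have h3 : (1 : ℝ) = 0 := h1 h2
    exact one_ne_zero h3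
  · refine huniq (t + k * (2 * Real.pi)) _ _ (hf _) (by simpa using hf t) ?_
    rw [hpf', (hpf _ _).2 ⟨k, rfl⟩, (hpf (f t + k * (2 * Real.pi)) (f t)).2 ⟨k, rfl⟩, hpf']

/-- A nowhere vanishing derivative has constant sign by Darboux, and by the mean value theorem it
equals `1` somewhere on a period. -/
theorem deriv_pos_of_periodic {f : ℝ → ℝ} {c : ℝ} (hc : 0 < c) (hf : Differentiable ℝ f)
    (h0 : ∀ t, deriv f t ≠ 0) (hper : f c = f 0 + c) (t : ℝ) : 0 < deriv f t := by
  obtain ⟨u, hu, hu'⟩ := exists_deriv_eq_slope f hc hf.continuous.continuousOn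
    hf.differentiableOn
  have h1 : deriv f u = 1 := by
    rw [hu', hper, sub_zero, add_sub_cancel_left, div_self hc.ne']
  rcases hasDerivWithinAt_forall_lt_or_forall_gt_of_forall_ne convex_univ
    (fun x _ => (hf x).hasDerivAt.hasDerivWithinAt) (fun x _ => h0 x) with h | h
  · have := h u (mem_univ u)
    linarith
  · exact h t (mem_univ t)

variable {S : Type*} {p : ℝ → S}

/-- The map of the circle with the lift `f`. -/
def descend (hps : Function.Surjective p) (f : ℝ → ℝ) (x : S) : S := p (f (Function.surjInv hps x))

theorem descend_apply (hps : Function.Surjective p)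
    (hpf : ∀ t t', p t = p t' ↔ ∃ k : ℤ, t = t' + k * (2 * Real.pi)) {f : ℝ → ℝ}
    (hf : ∀ t, ∀ k : ℤ, f (t + k * (2 * Real.pi)) = f t + k * (2 * Real.pi)) (t : ℝ) :
    descend hps f (p t) = p (f t) := by
  obtain ⟨k, hk⟩ := (hpf _ _).1 (Function.surjInv_eq hps (p t))
  unfold descend
  rw [hk, hf]
  exact (hpf _ _).2 ⟨k, rfl⟩

variable [TopologicalSpace S] [ChartedSpace (EuclideanSpace ℝ (Fin 1)) S]

theorem exists_diffeomorph_descend (hp : IsLocalDiffeomorph 𝓘(ℝ, ℝ) (𝓡 1) ∞ p)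
    (hps : Function.Surjective p)
    (hpf : ∀ t t', p t = p t' ↔ ∃ k : ℤ, t = t' + k * (2 * Real.pi)) {f : ℝ → ℝ}
    (hf : ∀ t, ∀ k : ℤ, f (t + k * (2 * Real.pi)) = f t + k * (2 * Real.pi))
    (hfs : ContDiff ℝ ∞ f) (hf' : ∀ t, 0 < deriv f t) (hb : ∀ t, |f t - t| < Real.pi) :
    ∃ Ψ : S ≃ₘ⟮𝓡 1, 𝓡 1⟯ S, ∀ t, Ψ (p t) = p (f t) := by
  have hd := descend_apply hps hpf hf
  have hmono : StrictMono f := strictMono_of_deriv_pos hf'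
  have hfsurj : Function.Surjective f := by
    refine hfs.continuous.surjective ?_ ?_
    · refine tendsto_atTop_mono (fun t => ?_) (tendsto_atTop_add_const_right atTop (-Real.pi)
        tendsto_id)
      have := (abs_lt.1 (hb t)).1
      simp only [id]
      linarith
    · refine tendsto_atBot_mono (fun t => ?_) (tendsto_atBot_add_const_right atBot Real.pi
        tendsto_id)
      have := (abs_lt.1 (hb t)).2
      simp only [id]
      linarith
  have hfloc : IsLocalDiffeomorph 𝓘(ℝ, ℝ) 𝓘(ℝ, ℝ) ∞ f := by
    refine isLocalDiffeomorph_of_injective rfl hfs.contMDiff fun t => ?_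
    have h1 : HasFDerivAt f (ContinuousLinearMap.toSpanSingleton ℝ (deriv f t)) t :=
      ((hfs.differentiable (by simp)) t).hasDerivAt.hasFDerivAt
    rw [mfderiv_eq_fderiv, h1.fderiv]
    intro a b hab
    exact mul_right_cancel₀ (M₀ := ℝ) (hf' t).ne' hab
  have hloc : IsLocalDiffeomorph (𝓡 1) (𝓡 1) ∞ (descend hps f) := by
    intro x
    obtain ⟨t, rfl⟩ := hps x
    refine isLocalDiffeomorphAt_of_comp (hp t) ?_
    have h1 : descend hps f ∘ p = p ∘ f := funext hd
    rw [h1]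
    exact (hfloc t).comp (𝓡 1) S (hp (f t))
  have hbij : Function.Bijective (descend hps f) := by
    constructor
    · intro x x' h
      obtain ⟨t, rfl⟩ := hps x
      obtain ⟨t', rfl⟩ := hps x'
      rw [hd, hd] at h
      obtain ⟨k, hk⟩ := (hpf _ _).1 h
      rw [← hf] at hk
      exact (hpf _ _).2 ⟨k, hmono.injective hk⟩
    · intro x
      obtain ⟨t, rfl⟩ := hps x
      obtain ⟨u, rfl⟩ := hfsurj t
      exact ⟨p u, hd u⟩
  exact ⟨hloc.diffeomorphOfBijective hbij, hd⟩

/-- The lift is increasing, so the straight-line homotopy from the identity of the line to the lift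
runs through increasing maps commuting with the period, and descends to an isotopy of the circle. -/
theorem isIsotopicToId_of_lift (hp : IsLocalDiffeomorph 𝓘(ℝ, ℝ) (𝓡 1) ∞ p)
    (hps : Function.Surjective p)
    (hpf : ∀ t t', p t = p t' ↔ ∃ k : ℤ, t = t' + k * (2 * Real.pi))
    (Φ : S ≃ₘ⟮𝓡 1, 𝓡 1⟯ S) (hΦ : ∀ t, Φ (p t) ≠ p (t + Real.pi)) : IsIsotopicToId Φ := by
  obtain ⟨f, hfs, hf0, hfΦ, hb, hper⟩ := exists_lift hp hps hpf Φ hΦ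
  have hfd : Differentiable ℝ f := hfs.differentiable (by simp)
  have hpos := deriv_pos_of_periodic Real.two_pi_pos hfd hf0 (by simpa using hper 0 1)
  -- The isotopy parameter runs over the whole line, while the interpolation weight has to stay in
  -- `[0, 1]`.
  let r : ℝ → ℝ := Real.smoothTransition
  have hr : ContDiff ℝ ∞ r := Real.smoothTransition.contDiff
  let G : ℝ → ℝ → ℝ := fun s t => t + r s * (f t - t)
  have hΨ : ∀ s, ∃ Ψ : S ≃ₘ⟮𝓡 1, 𝓡 1⟯ S, ∀ t, Ψ (p t) = p (G s t) := by
    intro s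
    have hs0 : 0 ≤ r s := Real.smoothTransition.nonneg s
    have hs1 : r s ≤ 1 := Real.smoothTransition.le_one s
    refine exists_diffeomorph_descend hp hps hpf (fun t k => ?_) ?_ (fun t => ?_) fun t => ?_
    · simp only [G, hper]
      ring
    · exact contDiff_id.add (contDiff_const.mul (hfs.sub contDiff_id))
    -- The derivative is a convex combination of `1` and `deriv f t`, both positive.
    · have h1 : HasDerivAt (G s) (1 + r s * (deriv f t - 1)) t :=
        (hasDerivAt_id t).add (((hfd t).hasDerivAt.sub (hasDerivAt_id t)).const_mul (r s))
      rw [h1.deriv]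
      have := hpos t
      rcases hs1.lt_or_eq with h | h
      · nlinarith [mul_nonneg hs0 this.le]
      · rw [h]
        linarith
    · simp only [G, add_sub_cancel_left, abs_mul, abs_of_nonneg hs0]
      exact (mul_le_of_le_one_left (abs_nonneg _) hs1).trans_lt (hb t)
  choose Ψ hΨ using hΨ
  refine ⟨Ψ, ?_, fun ξ => ?_, fun ξ => ?_⟩
  · rintro ⟨s, x⟩
    obtain ⟨t, rfl⟩ := hps x
    obtain ⟨σ, hσ, hσt, hpσ⟩ := exists_local_section (hp t)
    have hG : ContDiff ℝ ∞ (fun a : ℝ × ℝ => G a.1 a.2) :=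
      contDiff_snd.add ((hr.comp contDiff_fst).mul ((hfs.comp contDiff_snd).sub contDiff_snd))
    have h1 : ContMDiffAt (𝓘(ℝ, ℝ).prod (𝓡 1)) 𝓘(ℝ, ℝ) ∞ (fun a : ℝ × S => σ a.2) (s, p t) :=
      ContMDiffAt.comp (s, p t) (g := σ) hσ.contMDiffAt contMDiffAt_snd
    have h2 : ContMDiffAt (𝓘(ℝ, ℝ).prod (𝓡 1)) 𝓘(ℝ, ℝ × ℝ) ∞ (fun a : ℝ × S => (a.1, σ a.2))
        (s, p t) := contMDiffAt_fst.prodMk_space h1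
    have h3 := (hp.contMDiff.comp hG.contMDiff).contMDiffAt.comp (s, p t) h2
    refine h3.congr_of_eventuallyEq ?_
    filter_upwards [continuous_snd.continuousAt.eventually hpσ] with a ha
    change Ψ a.1 a.2 = p (G a.1 (σ a.2))
    rw [← hΨ, ha]
  · obtain ⟨t, rfl⟩ := hps ξ
    rw [hΨ]
    simp [G, r]
  · obtain ⟨t, rfl⟩ := hps ξ
    rw [hΨ, ← hfΦ]
    simp [G, r]

end CircleIsotopy

/-! ### Spheres of dimension zero and one -/

section LowDimension

open Topology Filter

set_option synthInstance.maxHeartbeats 200000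

/-- The standard parametrization of the unit circle of the Euclidean plane. -/
def planeCircle (t : ℝ) : Metric.sphere (0 : EuclideanSpace ℝ (Fin (1 + 1))) 1 :=
  ⟨!₂[Real.cos t, Real.sin t], by
    simp [EuclideanSpace.norm_eq]⟩

theorem planeCircle_eq_iff (t t' : ℝ) :
    planeCircle t = planeCircle t' ↔ ∃ k : ℤ, t = t' + k * (2 * Real.pi) := by
  constructor
  · intro h
    have h1 := congrArg (fun v : Metric.sphere (0 : EuclideanSpace ℝ (Fin (1 + 1))) 1 =>
      (v : EuclideanSpace ℝ (Fin (1 + 1))) 0) h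
    have h2 := congrArg (fun v : Metric.sphere (0 : EuclideanSpace ℝ (Fin (1 + 1))) 1 =>
      (v : EuclideanSpace ℝ (Fin (1 + 1))) 1) h
    simp only [planeCircle] at h1 h2
    obtain ⟨k, hk⟩ := Real.Angle.angle_eq_iff_two_pi_dvd_sub.1 (Real.Angle.cos_sin_inj h1 h2)
    exact ⟨k, by linarith⟩
  · rintro ⟨k, rfl⟩
    simp [planeCircle]

theorem planeCircle_surjective : Function.Surjective planeCircle := by
  rintro ⟨v, hv⟩
  have h1 : v 0 ^ 2 + v 1 ^ 2 = 1 := by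
    rw [mem_sphere_zero_iff_norm] at hv
    have := EuclideanSpace.real_norm_sq_eq v
    rw [hv, Fin.sum_univ_two] at this
    linarith
  have h2 : ‖(⟨v 0, v 1⟩ : ℂ)‖ = 1 := by
    rw [Complex.norm_def, Complex.normSq_mk, ← sq, ← sq, h1, Real.sqrt_one]
  have h3 := Complex.norm_mul_exp_arg_mul_I ⟨v 0, v 1⟩
  rw [h2, Complex.ofReal_one, one_mul] at h3
  have h4 := congrArg Complex.re h3
  have h5 := congrArg Complex.im h3
  rw [Complex.exp_ofReal_mul_I_re] at h4
  rw [Complex.exp_ofReal_mul_I_im] at h5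
  refine ⟨Complex.arg ⟨v 0, v 1⟩, Subtype.ext ?_⟩
  ext i
  fin_cases i
  · exact h4
  · exact h5

theorem planeCircle_add_pi (t : ℝ) : planeCircle (t + Real.pi) = -planeCircle t := by
  apply Subtype.ext
  ext i
  fin_cases i
  · simp [planeCircle]
  · simp [planeCircle]

open scoped EuclideanSpace in
theorem isLocalDiffeomorph_planeCircle : IsLocalDiffeomorph 𝓘(ℝ, ℝ) (𝓡 1) ∞ planeCircle := by
  have : IsManifold (𝓡 1) ∞ (Metric.sphere (0 : EuclideanSpace ℝ (Fin (1 + 1))) 1) :=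
    EuclideanSpace.instIsManifoldSphere.of_le (by simp)
  have hs : ContDiff ℝ ∞ (fun t : ℝ => (!₂[Real.cos t, Real.sin t] : EuclideanSpace ℝ (Fin (1 + 1)))) := by
    rw [contDiff_euclidean]
    intro i
    fin_cases i
    · exact Real.contDiff_cos
    · exact Real.contDiff_sin
  have hc : ContMDiff 𝓘(ℝ, ℝ) (𝓡 1) ∞ planeCircle := hs.contMDiff.codRestrict_sphere _
  refine isLocalDiffeomorph_of_injective (by simp) hc fun t => ?_
  let D : ℝ →L[ℝ] EuclideanSpace ℝ (Fin 1) := mfderiv 𝓘(ℝ, ℝ) (𝓡 1) planeCircle t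
  have hD : HasMFDerivAt 𝓘(ℝ, ℝ) (𝓡 1) planeCircle t D :=
    ((hc t).mdifferentiableAt (by simp)).hasMFDerivAt
  have hcs : ContMDiff (𝓡 1) 𝓘(ℝ, EuclideanSpace ℝ (Fin (1 + 1))) ∞
      (Subtype.val : Metric.sphere (0 : EuclideanSpace ℝ (Fin (1 + 1))) 1 → EuclideanSpace ℝ (Fin (1 + 1))) :=
    contMDiff_coe_sphere
  have h1 := HasMFDerivAt.comp t ((hcs _).mdifferentiableAt (by simp)).hasMFDerivAt hD
  have key : ∀ i, HasFDerivAt (fun t : ℝ => (!₂[Real.cos t, Real.sin t] : EuclideanSpace ℝ (Fin (1 + 1))) i)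
    ((EuclideanSpace.proj i).comp (fderiv ℝ
      (fun t : ℝ => (!₂[Real.cos t, Real.sin t] : EuclideanSpace ℝ (Fin (1 + 1)))) t)) t := fun i =>
    (EuclideanSpace.proj i : EuclideanSpace ℝ (Fin (1 + 1)) →L[ℝ] ℝ).hasFDerivAt.comp t
      ((hs.differentiable (by simp)) t).hasFDerivAt
  have hk0 := (key 0).unique (Real.hasDerivAt_cos t).hasFDerivAt
  have hk1 := (key 1).unique (Real.hasDerivAt_sin t).hasFDerivAt
  have h2 := hasMFDerivAt_unique h1 ((hs.differentiable (by simp)) t).hasFDerivAt.hasMFDerivAt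
  change Function.Injective D
  rw [injective_iff_map_eq_zero]
  intro s h0
  have h3 : fderiv ℝ (fun t : ℝ => (!₂[Real.cos t, Real.sin t] : EuclideanSpace ℝ (Fin (1 + 1)))) t s =
      0 := by
    refine (DFunLike.congr_fun h2 s).symm.trans ?_
    refine (congrArg (mfderiv (𝓡 1) 𝓘(ℝ, EuclideanSpace ℝ (Fin (1 + 1))) Subtype.val
      (planeCircle t)) h0).trans ?_
    exact map_zero (M := EuclideanSpace ℝ (Fin 1)) (N := EuclideanSpace ℝ (Fin (1 + 1))) _
  have h4 : (0 : ℝ) = s * -Real.sin t := by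
    have := DFunLike.congr_fun hk0 s
    simp only [ContinuousLinearMap.comp_apply, h3, map_zero] at this
    simpa using this
  have h5 : (0 : ℝ) = s * Real.cos t := by
    have := DFunLike.congr_fun hk1 s
    simp only [ContinuousLinearMap.comp_apply, h3, map_zero] at this
    simpa using this
  have h6 := Real.sin_sq_add_cos_sq t
  -- The two components of the velocity give `s sin t = 0` and `s cos t = 0`, and `sin² + cos² = 1`
  -- then forces `s = 0`.
  linear_combination s * (-h6) + Real.sin t * h4 - Real.cos t * h5

theorem eq_or_eq_neg_of_sphere_zero (v w : Metric.sphere (0 : EuclideanSpace ℝ (Fin 1)) 1) :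
    w = v ∨ w = -v := by
  have h : ∀ v : Metric.sphere (0 : EuclideanSpace ℝ (Fin 1)) 1,
      (v : EuclideanSpace ℝ (Fin 1)) 0 ^ 2 = 1 := by
    rintro ⟨v, hv⟩
    rw [mem_sphere_zero_iff_norm] at hv
    have := EuclideanSpace.real_norm_sq_eq v
    rw [hv, Fin.sum_univ_one] at this
    linarith
  rcases sq_eq_sq_iff_eq_or_eq_neg.1 ((h w).trans (h v).symm) with h1 | h1
  · left
    apply Subtype.ext
    ext i
    fin_cases i
    exact h1
  · right
    apply Subtype.ext
    ext i
    fin_cases i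
    exact h1

/-- A diffeomorphism of a sphere of dimension at most one that sends no point to its opposite is
isotopic to the identity. -/
theorem isIsotopicToId_of_ne_neg {m : ℕ} (hm : m ≤ 1) {S : Type*} [TopologicalSpace S]
    [ChartedSpace (EuclideanSpace ℝ (Fin m)) S]
    (D : Metric.sphere (0 : EuclideanSpace ℝ (Fin (m + 1))) 1 ≃ₘ⟮𝓡 m, 𝓡 m⟯ S)
    (Φ : S ≃ₘ⟮𝓡 m, 𝓡 m⟯ S) (hΦ : ∀ v, Φ (D v) ≠ D (-v)) : IsIsotopicToId Φ := by
  obtain rfl | rfl : m = 0 ∨ m = 1 := by omega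
  -- The sphere consists of two antipodal points, so a map sending neither to its opposite is the
  -- identity.
  · refine ⟨fun _ => Diffeomorph.refl (𝓡 0) S ∞, contMDiff_snd, fun _ => rfl, fun ξ => ?_⟩
    obtain ⟨v, rfl⟩ := D.surjective ξ
    obtain ⟨w, hw⟩ := D.surjective (Φ (D v))
    rcases eq_or_eq_neg_of_sphere_zero v w with rfl | rfl
    · exact hw
    · exact absurd hw.symm (hΦ v)
  · refine isIsotopicToId_of_lift (p := D ∘ planeCircle)
      (fun t => (isLocalDiffeomorph_planeCircle t).comp (𝓡 1) S (D.isLocalDiffeomorph _))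
      (D.surjective.comp planeCircle_surjective) (fun t t' => ?_) Φ fun t => ?_
    · rw [← planeCircle_eq_iff]
      exact D.injective.eq_iff
    · change Φ (D (planeCircle t)) ≠ D (planeCircle (t + Real.pi))
      rw [planeCircle_add_pi]
      exact hΦ _

end LowDimension

end BlowDown

end

/-! ### Assembly of the theorem -/

theorem mainTheorem5 {m : ℕ} {M : Type*} [TopologicalSpace M] [T2Space M]
    [ChartedSpace (EuclideanSpace ℝ (Fin (m + 1))) M] [IsManifold (𝓡 (m + 1)) ∞ M]
    (g : BlowDown.Metric (m + 1) M) (z : M) (T : ℝ) (hz : BlowDown.IsBlowDownPoint g z T) :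
    -- the cosphere is a smooth embedded sphere, and `G^T` restricts to a diffeomorphism `Φ` of it
    ∃ (_ : ChartedSpace (EuclideanSpace ℝ (Fin m)) (BlowDown.cosphere g z))
      (_ : IsManifold (𝓡 m) ∞ (BlowDown.cosphere g z))
      (Φ : BlowDown.cosphere g z ≃ₘ⟮𝓡 m, 𝓡 m⟯ BlowDown.cosphere g z),
      Manifold.IsSmoothEmbedding (𝓡 m) (BlowDown.cotangentModel (m + 1)) ∞
        (Subtype.val : BlowDown.cosphere g z → BlowDown.Cotangent (m + 1) M) ∧
      (∀ ξ, (Φ ξ : BlowDown.Cotangent (m + 1) M) = BlowDown.geodesicFlow g T ξ) ∧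
    -- the mapping cylinder is a smooth manifold, with its usual structure: the unrolling map `q`
    -- from the product of the cosphere with the line is a local diffeomorphism
    ∃ (_ : ChartedSpace (EuclideanSpace ℝ (Fin (m + 1))) (BlowDown.MappingCylinder g z T))
      (_ : IsManifold (𝓡 (m + 1)) ∞ (BlowDown.MappingCylinder g z T)),
      (∃ q : BlowDown.cosphere g z × ℝ → BlowDown.MappingCylinder g z T,
        IsLocalDiffeomorph ((𝓡 m).prod 𝓘(ℝ, ℝ)) (𝓡 (m + 1)) ∞ q ∧
        (∀ ξ (t : Icc (0 : ℝ) T), q (ξ, t) = Quot.mk _ (ξ, t)) ∧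
        ∀ ξ t, q (ξ, t + T) = q (Φ ξ, t)) ∧
    -- `ι_z` is a Lagrangian embedding
      BlowDown.IsLagrangianEmbedding (𝓡 (m + 1)) (BlowDown.iota g z T) ∧
    -- its image is invariant under the geodesic flow
      (∀ p ∈ BlowDown.blowDownLagrangian g z T, ∀ t : ℝ,
        BlowDown.FlowDefined g t p ∧
          BlowDown.geodesicFlow g t p ∈ BlowDown.blowDownLagrangian g z T) ∧
    -- its image is a Lagrangian submanifold, diffeomorphic to the mapping cylinder
      ∃ (_ : ChartedSpace (EuclideanSpace ℝ (Fin (m + 1))) (BlowDown.blowDownLagrangian g z T))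
        (_ : IsManifold (𝓡 (m + 1)) ∞ (BlowDown.blowDownLagrangian g z T)),
        BlowDown.IsLagrangianEmbedding (𝓡 (m + 1))
          (Subtype.val : BlowDown.blowDownLagrangian g z T → BlowDown.Cotangent (m + 1) M) ∧
        Nonempty (BlowDown.MappingCylinder g z T ≃ₘ⟮𝓡 (m + 1), 𝓡 (m + 1)⟯
          BlowDown.blowDownLagrangian g z T) ∧
    -- and to the product of the circle and the standard sphere
        (m + 1 ≤ 2 ∨ BlowDown.IsIsotopicToId Φ →
          Nonempty (BlowDown.blowDownLagrangian g z T ≃ₘ⟮𝓡 (m + 1), (𝓡 1).prod (𝓡 m)⟯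
            (Circle × Metric.sphere (0 : EuclideanSpace ℝ (Fin (m + 1))) 1))) := by
  obtain ⟨cs, hm, ⟨D, hD⟩, hval, hinj, hfac⟩ := BlowDown.exists_cosphere_manifold g z
  have : CompactSpace (BlowDown.cosphere g z) := D.toHomeomorph.compactSpace
  have hk := BlowDown.contMDiff_returnEquiv_zpow hz hval hinj hfac
  have hiso := BlowDown.isIsotropicImmersionAt_sweep hz hval hinj
  have hsw : Continuous (BlowDown.sweep hz) :=
    continuous_iff_continuousAt.2 fun y => (hiso y).contMDiffAt.continuousAt
  obtain ⟨cC, hC, hq⟩ := BlowDown.exists_cylinder_manifold hz hsw hk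
  have hemb := (BlowDown.isClosedEmbedding_iota hz hsw).isEmbedding
  have hiota : ∀ a, BlowDown.IsIsotropicImmersionAt (𝓡 (m + 1)) (BlowDown.iota g z T) a := by
    intro a
    obtain ⟨y, rfl⟩ := BlowDown.unroll_surjective hz a
    exact BlowDown.isIsotropicImmersionAt_of_comp (hq y) (hiso y)
  obtain ⟨cL, hL, hinc, ⟨Ψ⟩⟩ :
      ∃ (_ : ChartedSpace (EuclideanSpace ℝ (Fin (m + 1))) (BlowDown.blowDownLagrangian g z T))
        (_ : IsManifold (𝓡 (m + 1)) ∞ (BlowDown.blowDownLagrangian g z T)),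
        (∀ a, BlowDown.IsIsotropicImmersionAt (𝓡 (m + 1))
          (Subtype.val : BlowDown.blowDownLagrangian g z T → BlowDown.Cotangent (m + 1) M) a) ∧
        Nonempty (BlowDown.MappingCylinder g z T ≃ₘ⟮𝓡 (m + 1), 𝓡 (m + 1)⟯
          BlowDown.blowDownLagrangian g z T) := BlowDown.exists_range_manifold hemb hiota
  let Φ : BlowDown.cosphere g z ≃ₘ⟮𝓡 m, 𝓡 m⟯ BlowDown.cosphere g z :=
    { toEquiv := BlowDown.returnEquiv hz
      contMDiff_toFun := by simpa using hk 1
      contMDiff_invFun := by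
        have h := hk (-1)
        rwa [zpow_neg_one] at h }
  refine ⟨cs, hm, Φ, ⟨BlowDown.isImmersion_of_injective hval hinj, Topology.IsEmbedding.subtypeVal⟩,
    fun ξ => rfl, cC, hC, ⟨BlowDown.unroll hz, hq, BlowDown.unroll_mk hz, BlowDown.unroll_add hz⟩,
    BlowDown.isLagrangianEmbedding_of_isotropic finrank_euclideanSpace_fin hemb hiota,
    BlowDown.blowDownLagrangian_invariant hz, cL, hL,
    BlowDown.isLagrangianEmbedding_of_isotropic finrank_euclideanSpace_fin
      Topology.IsEmbedding.subtypeVal hinc, ⟨Ψ⟩, fun h => ?_⟩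
  -- In dimension at most two the isotopy is automatic: the parametrization `D` carries the
  -- antipodal map to covector reversal, and the return map reverses no covector.
  have hΦ : BlowDown.IsIsotopicToId Φ := by
    refine h.elim (fun hn => BlowDown.isIsotopicToId_of_ne_neg (by omega) D Φ fun v hv => ?_) id
    exact BlowDown.returnMap_ne_reversal hz (D v) (hv.trans (Subtype.ext (hD v)))
  obtain ⟨F, hF, hF0, hF1⟩ := hΦ
  -- Both `unroll` and `trivialization` have the deck orbits as fibres, so their targets are
  -- diffeomorphic.
  obtain ⟨Θ⟩ := BlowDown.nonempty_diffeomorph_of_fibers hq (BlowDown.unroll_surjective hz)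
    (BlowDown.isLocalDiffeomorph_trivialization hF hF0 hF1 hk hz.pos)
    (BlowDown.trivialization_surjective hz.pos) fun y y' =>
      (BlowDown.unroll_eq_iff hz y y').trans (BlowDown.trivialization_eq_iff hz.pos y y').symm
  exact ⟨(Ψ.symm.trans Θ).trans ((Diffeomorph.refl (𝓡 1) Circle ∞).prodCongr D.symm)⟩
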